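/- Let $k$ be a perfect field of characteristic $p>0$ and let $Y$, $X$ be schemes essentially of finite type over $k$, with $Y$ normal. Let $G$ be a smooth affine algebraic group over $k$ which is linearly reductive (every finite-dimensional representation of $G$ is completely reducible), acting on $Y$ over $k$, and let $\pi\colon Y\to X$ be a good quotient by $G$, i.e. a $G$-invariant affine morphism of $k$-schemes with $\mathscr O_X=(\pi_*\mathscr O_Y)^G$. A lifting of a $k$-scheme $Z$ is a flat scheme $\widetilde Z$ over the ring $W_2(k)$ of Witt vectors of length two together with an identification $Z\simeq\widetilde Z\otimes_{W_2(k)}k$. Let $(\widetilde Y,\widetilde F_Y)$ be a Frobenius lifting of $Y$, that is, a lifting $\widetilde Y$ of $Y$ together with a morphism $\widetilde F_Y\colon\widetilde Y\to\widetilde Y$ lifting the absolute Frobenius $F_Y$. Then there exist a lifting $\widetilde X$ of $X$, a morphism $\widetilde\pi\colon\widetilde Y\to\widetilde X$ over $W_2(k)$ lifting $\pi$, and a morphism $\widetilde F_X\colon\widetilde X\to\widetilde X$ lifting the absolute Frobenius $F_X$ of $X$. -/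

import Mathlib

universe u

open CategoryTheory AlgebraicGeometry Limits MonoidalCategory
open scoped TensorProduct MonoidalLeftAction

noncomputable section

namespace FrobLift

/-! ### The absolute Frobenius -/

/-- The `p`-th power map of a commutative ring in which `p = 0`. -/
def powHom (p : ℕ) [hp : Fact p.Prime] (R : Type u) [CommRing R] (h : (p : R) = 0) : R →+* R where
  toFun x := x ^ p
  map_one' := one_pow p
  map_mul' x y := mul_pow x y p
  map_zero' := zero_pow hp.out.ne_zero
  map_add' x y := by
    obtain ⟨r, hr⟩ := exists_add_pow_prime_eq hp.out x y
    rw [hr, h]; ring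

/-- On a scheme with `p = 0` in its global sections, `p = 0` in all rings of sections. -/
theorem natCast_section_eq_zero {p : ℕ} {X : Scheme.{u}} (h : (p : Γ(X, ⊤)) = 0) (U : X.Opens) :
    (p : Γ(X, U)) = 0 := by
  have := congrArg (X.presheaf.map (homOfLE (le_top : U ≤ ⊤)).op).hom h
  simpa using this

/-- The absolute Frobenius of a scheme on which `p = 0`, as a morphism of presheafed spaces: the
identity on the underlying space, and `s ↦ s ^ p` on sections. -/
def absFrobeniusAux (p : ℕ) [Fact p.Prime] (X : Scheme.{u}) (h : (p : Γ(X, ⊤)) = 0) :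
    X.toPresheafedSpace ⟶ X.toPresheafedSpace where
  base := 𝟙 _
  c :=
    { app U := CommRingCat.ofHom (powHom p Γ(X, U.unop) (natCast_section_eq_zero h U.unop))
      naturality U V i := by
        ext s
        exact (map_pow (X.presheaf.map i).hom s p).symm }

/-- The absolute Frobenius of a scheme on which `p = 0`. -/
def absFrobenius (p : ℕ) [hp : Fact p.Prime] (X : Scheme.{u}) (h : (p : Γ(X, ⊤)) = 0) : X ⟶ X where
  __ := absFrobeniusAux p X h
  prop x := by
    refine ⟨fun a ha => ?_⟩
    obtain ⟨U, hxU, s, rfl⟩ := TopCat.Presheaf.exists_germ_eq X.presheaf a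
    have e : (absFrobeniusAux p X h).stalkMap x (X.presheaf.germ U x hxU s) =
        X.presheaf.germ U x hxU (s ^ p) :=
      PresheafedSpace.stalkMap_germ_apply (absFrobeniusAux p X h) U x hxU s
    have key : X.presheaf.germ U x hxU (s ^ p) = (X.presheaf.germ U x hxU s) ^ p :=
      map_pow (X.presheaf.germ U x hxU).hom s p
    exact (isUnit_pow_iff hp.out.ne_zero).1 ((e.trans key) ▸ ha)

theorem absFrobenius_apply (p : ℕ) [Fact p.Prime] (X : Scheme.{u}) (h : (p : Γ(X, ⊤)) = 0)
    (x : X) : absFrobenius p X h x = x := rfl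

theorem absFrobenius_app (p : ℕ) [Fact p.Prime] (X : Scheme.{u}) (h : (p : Γ(X, ⊤)) = 0)
    (U : X.Opens) (s : Γ(X, U)) : (absFrobenius p X h).app U s = s ^ p := rfl

/-- On a scheme over a field of characteristic `p`, one has `p = 0`. -/
theorem natCast_top_eq_zero (p : ℕ) {k : Type u} [Field k] [CharP k p]
    (X : Over (Spec (.of k))) : (p : Γ(X.left, ⊤)) = 0 := by
  have h : (p : k) = 0 := CharP.cast_eq_zero k p
  have h' := congrArg ((Scheme.ΓSpecIso (.of k)).inv ≫ X.hom.appTop).hom h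
  rw [map_zero] at h'
  exact (map_natCast ((Scheme.ΓSpecIso (.of k)).inv ≫ X.hom.appTop).hom p).symm.trans h'

/-- The absolute Frobenius `F_X` of a scheme over a field of characteristic `p`. -/
def frob (p : ℕ) [Fact p.Prime] {k : Type u} [Field k] [CharP k p]
    (X : Over (Spec (.of k))) : X.left ⟶ X.left :=
  absFrobenius p X.left (natCast_top_eq_zero p X)

/-! ### Liftings modulo `p ^ 2` -/

/-- The ring `W₂(k)` of Witt vectors of length two. -/
abbrev W2 (p : ℕ) [Fact p.Prime] (k : Type u) [CommRing k] : Type u := TruncatedWittVector p 2 k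

theorem ker_truncate_le (p : ℕ) [Fact p.Prime] (k : Type u) [CommRing k] :
    RingHom.ker (WittVector.truncate (p := p) (R := k) 2) ≤
      RingHom.ker (WittVector.constantCoeff (p := p) (R := k)) := by
  intro x hx
  exact (WittVector.mem_ker_truncate 2 x).1 hx 0 (by norm_num)

/-- The reduction map `W₂(k) → k`, `(a₀, a₁) ↦ a₀`. -/
def residue (p : ℕ) [Fact p.Prime] (k : Type u) [CommRing k] : W2 p k →+* k :=
  (WittVector.truncate (p := p) 2).liftOfSurjective (WittVector.truncate_surjective p 2 k)
    ⟨WittVector.constantCoeff, ker_truncate_le p k⟩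

theorem residue_apply (p : ℕ) [Fact p.Prime] (k : Type u) [CommRing k] (x : W2 p k) :
    residue p k x = x.coeff 0 := by
  obtain ⟨y, rfl⟩ := WittVector.truncate_surjective p 2 k x
  rw [WittVector.coeff_truncate]
  exact RingHom.liftOfRightInverse_comp_apply _ _ _ _ y

/-- A lifting of a `k`-scheme `X`: a flat `W₂(k)`-scheme `X̃` together with an identification of
`X` with the base change of `X̃` to `k`. -/
structure Lifting (p : ℕ) [Fact p.Prime] {k : Type u} [Field k] (X : Over (Spec (.of k))) where
  /-- the lifted scheme `X̃` over `W₂(k)` -/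
  total : Over (Spec (.of (W2 p k)))
  flat : Flat total.hom
  /-- the inclusion `X ⟶ X̃` of the special fibre -/
  incl : X.left ⟶ total.left
  isPullback : IsPullback incl X.hom total.hom (Spec.map (CommRingCat.ofHom (residue p k)))

/-- `Ft : X̃ ⟶ X̃` lifts the absolute Frobenius of `X`. -/
def Lifting.LiftsFrobenius {p : ℕ} [Fact p.Prime] {k : Type u} [Field k] [CharP k p]
    {X : Over (Spec (.of k))} (Xt : Lifting p X) (Ft : Xt.total.left ⟶ Xt.total.left) : Prop :=
  Xt.incl ≫ Ft = frob p X ≫ Xt.incl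

/-- The `W₂(k)`-morphism `ft : Ỹ ⟶ X̃` lifts the `k`-morphism `f : Y ⟶ X`. -/
def Lifting.LiftsHom {p : ℕ} [Fact p.Prime] {k : Type u} [Field k]
    {X Y : Over (Spec (.of k))} (Yt : Lifting p Y) (Xt : Lifting p X)
    (f : Y ⟶ X) (ft : Yt.total ⟶ Xt.total) : Prop :=
  Yt.incl ≫ ft.left = f.left ≫ Xt.incl

/-! ### Conditions on schemes -/

/-- A scheme is normal if all its local rings are integrally closed domains. -/
def IsNormal (X : Scheme.{u}) : Prop :=
  ∀ x : X, IsDomain (X.presheaf.stalk x) ∧ IsIntegrallyClosed (X.presheaf.stalk x)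

/-- A `k`-scheme is essentially of finite type if it is quasi-compact and covered by affine opens
whose coordinate rings are localizations of `k`-algebras of finite type. -/
def IsEssFiniteType {k : Type u} [Field k] (X : Over (Spec (.of k))) : Prop :=
  CompactSpace X.left ∧ ∀ x : X.left, ∃ U : X.left.Opens, x ∈ U ∧ IsAffineOpen U ∧
    ((Scheme.ΓSpecIso (.of k)).inv ≫ X.hom.appLE ⊤ U le_top).hom.EssFiniteType

/-! ### Linearly reductive groups -/

/-- A representation of the affine group scheme `Spec H` on a `k`-vector space `V`, that is, a
right `H`-comodule structure on `V`. -/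
structure GroupRep (k : Type u) [Field k] (H : Type u) [CommRing H] [HopfAlgebra k H]
    (V : Type u) [AddCommGroup V] [Module k V] where
  /-- the coaction `V → V ⊗ H` -/
  coact : V →ₗ[k] V ⊗[k] H
  coassoc : (TensorProduct.assoc k V H H).toLinearMap ∘ₗ coact.rTensor H ∘ₗ coact =
    (Coalgebra.comul (R := k) (A := H)).lTensor V ∘ₗ coact
  counit : (Coalgebra.counit (R := k) (A := H)).lTensor V ∘ₗ coact =
    (TensorProduct.mk k V k).flip 1

/-- A subspace `W` of a representation is a subrepresentation if the coaction maps it into the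
image of `W ⊗ H`. -/
def GroupRep.IsSubrep {k : Type u} [Field k] {H : Type u} [CommRing H] [HopfAlgebra k H]
    {V : Type u} [AddCommGroup V] [Module k V] (ρ : GroupRep k H V) (W : Submodule k V) : Prop :=
  ∀ w ∈ W, ρ.coact w ∈ LinearMap.range (W.subtype.rTensor H)

/-- The affine group scheme `Spec H` is linearly reductive if every finite-dimensional
representation is completely reducible: every subrepresentation has a complement. -/
def IsLinearlyReductive (k : Type u) [Field k] (H : Type u) [CommRing H] [HopfAlgebra k H] :
    Prop :=
  ∀ (V : Type u) [AddCommGroup V] [Module k V] [Module.Finite k V] (ρ : GroupRep k H V)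
    (W : Submodule k V), ρ.IsSubrep W → ∃ W' : Submodule k V, ρ.IsSubrep W' ∧ IsCompl W W'

/-! ### Good quotients -/

/-- The group scheme `Spec H` over `k` of a commutative Hopf algebra `H`; every affine group
scheme over `k` is of this form. -/
abbrev groupOf (k : Type u) [Field k] (H : Type u) [CommRing H] [HopfAlgebra k H] :
    Over (Spec (.of k)) :=
  (Spec (.of H)).asOver (Spec (.of k))

/-- The action morphism `G × Y ⟶ Y` of a group scheme `G` acting on `Y`. -/
def act {k : Type u} [Field k] (G Y : Over (Spec (.of k))) [GrpObj G] [ModObj G Y] : G ⊗ Y ⟶ Y :=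
  ModObj.smul (M := G) (X := Y)

/-- The projection `G × Y ⟶ Y`. -/
def proj {k : Type u} [Field k] (G Y : Over (Spec (.of k))) : G ⊗ Y ⟶ Y :=
  SemiCartesianMonoidalCategory.snd G Y

/-- A good quotient of a `k`-scheme `Y` by an action of a group scheme `G`: a `G`-invariant affine
morphism `π : Y ⟶ X` with `𝒪_X = (π_* 𝒪_Y)^G`. Here a section `s` of `𝒪_Y` over `π⁻¹ U` is
`G`-invariant if its pullbacks along the action and along the projection `G × Y ⟶ Y` agree. -/
structure IsGoodQuotient {k : Type u} [Field k] (G : Over (Spec (.of k))) [GrpObj G]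
    {Y X : Over (Spec (.of k))} [ModObj G Y] (π : Y ⟶ X) : Prop where
  invariant : act G Y ≫ π = proj G Y ≫ π
  affine : IsAffineHom π.left
  injective (U : X.left.Opens) : Function.Injective (π.left.app U)
  range_eq (U : X.left.Opens) : Set.range (π.left.app U) =
    {s | (act G Y).left.appLE (π.left ⁻¹ᵁ U) ((proj G Y).left ⁻¹ᵁ π.left ⁻¹ᵁ U)
        (by rw [← Scheme.Hom.comp_preimage, ← Scheme.Hom.comp_preimage, ← Over.comp_left,
              ← Over.comp_left, invariant]) s =
      (proj G Y).left.app (π.left ⁻¹ᵁ U) s}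

end FrobLift

end

open CategoryTheory AlgebraicGeometry Limits MonoidalCategory
open scoped TensorProduct MonoidalLeftAction

noncomputable section

set_option linter.unusedSectionVars false

namespace FrobLift

section

/-! ### `p`-bases -/

section PBasis

/-! Over an affine open of `X`, let `A` be the sections of `Y` over its preimage, `S` those of the
lifting, and `B = A ^ G`. Write the lifted Frobenius as `φ x = x ^ p + p δ(x)` with `δ : S → A`. The
group is not assumed to act on `S`, so a lifting of `B` cannot be obtained as a ring of invariants.
It is cut out of `S` by means of `δ` and two projections of `A`: the Reynolds operator `R : A → B`,
and a Frobenius splitting `τ` of `A` (additive, `τ (a ^ p b) = a τ(b)`, `τ 1 = 1`) attached to `φ`.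

For `x` with reduction in `B`, put `ob(x) = (1 - R) τ (1 - R) δ(x)`. The Leibniz rule for `δ` along
the Frobenius makes `ob` a derivation on such elements (`obstr_mul`). From `δ(p x) = x̄ ^ p`, and
because `R` commutes with `p`-th powers, one gets `ob(p x) = (1 - R) x̄` (`obstr_p_mul`). Hence
every `b ∈ B` has a lift with `ob = 0`, unique up to `p B`. The elements with reduction in `B` and
`ob = 0` form a subring of `S` that lifts `B` flatly, with lifted Frobenius `x ↦ x ^ p + p R(δ x)`
(`FrobLiftAlg.descend`). This Frobenius is not claimed to be the restriction of `φ`.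

The splitting comes from the inverse Cartier operator `dx ↦ x ^ (p - 1) dx + d δ(x)`. At a generic
point with field `L` and a `p`-basis `t`, its determinant in the frame `dlog tᵢ`, followed by the
Cartier operator on top forms, gives the splitting of `L`. It is normalized (`trace_one`), since
`dlog tᵢ` goes to itself plus an exact form, and independent of `t` (`trace_eq`), since the Cartier
operator kills precisely the exact top forms. It preserves local rings that have a `p`-basis
(`trace_integral`), in particular `F`-finite noetherian local domains with nonzero principal maximal
ideal. In a noetherian normal domain, a non-integral fraction already fails to be integral at a
prime with such a local ring (`exists_prime_principal`), so the splitting preserves `A`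
(`exists_isSplitting`).

Linear reductivity provides a unique normalized invariant functional on `H`, and contracting the
coaction with it gives `R`. This functional commutes with the Frobenius because its Frobenius twist
is again a normalized invariant functional; smoothness enters through the reducedness of `H`
(`integral_pow`).

Both `R` and `τ` commute with restriction, so the subrings and their Frobenius maps define a sheaf
on `X` (`exists_descentDatum`). A sheaf of this kind defines a scheme (`Thickening.toScheme`), flat
over `W2 p k` with special fibre `X` (`Thickening.toLifting`). -/

/-- The monomial `∏ tᵢ ^ mᵢ`. -/
def monom {R : Type*} [CommRing R] {n : ℕ} (t : Fin n → R) (m : Fin n → ℕ) : R := ∏ i, t i ^ m i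

theorem monom_add {R : Type*} [CommRing R] {n : ℕ} (t : Fin n → R) (m m' : Fin n → ℕ) :
    monom t (m + m') = monom t m * monom t m' := by
  simp [monom, pow_add, Finset.prod_mul_distrib]

theorem monom_zero {R : Type*} [CommRing R] {n : ℕ} (t : Fin n → R) : monom t 0 = 1 := by
  simp [monom]

theorem monom_smul {R : Type*} [CommRing R] {n : ℕ} (t : Fin n → R) (m : Fin n → ℕ) (p : ℕ) :
    monom t (p • m) = monom t m ^ p := by
  simp [monom, ← Finset.prod_pow, ← pow_mul, mul_comm p]

theorem monom_sum {R : Type*} [CommRing R] {n : ℕ} (t : Fin n → R) {ι : Type*} (s : Finset ι)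
    (m : ι → Fin n → ℕ) : monom t (∑ j ∈ s, m j) = ∏ j ∈ s, monom t (m j) := by
  classical
  induction s using Finset.induction_on with
  | empty => simp [monom_zero]
  | insert a s ha ih => rw [Finset.sum_insert ha, Finset.prod_insert ha, monom_add, ih]

theorem map_monom {R S : Type*} [CommRing R] [CommRing S] (f : R →+* S) {n : ℕ} (t : Fin n → R)
    (m : Fin n → ℕ) : f (monom t m) = monom (fun i => f (t i)) m := by
  simp [monom, map_prod]

theorem monom_pi_single {R : Type*} [CommRing R] {n : ℕ} (t : Fin n → R) (i : Fin n) :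
    monom t (Pi.single i 1) = t i := by
  rw [monom, Finset.prod_eq_single i] <;> simp +contextual

/-- `t` is a `p`-basis of `R` over the subring of `p`-th powers: every element is uniquely
`∑ c_I ^ p * t ^ I` with exponents `0 ≤ I_i < p`. -/
def IsPBasis (p : ℕ) {R : Type*} [CommRing R] {n : ℕ} (t : Fin n → R) : Prop :=
  ∀ x : R, ∃! c : (Fin n → Fin p) → R, x = ∑ I, c I ^ p * monom t (fun i => (I i : ℕ))

variable {p : ℕ} [hp : Fact p.Prime] {R : Type*} [CommRing R] {n : ℕ}
  {t : Fin n → R}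

/-- The coordinates with respect to a `p`-basis. -/
def IsPBasis.coord (hb : IsPBasis p t) (x : R) : (Fin n → Fin p) → R := (hb x).choose

theorem IsPBasis.eq_sum (hb : IsPBasis p t) (x : R) :
    x = ∑ I, hb.coord x I ^ p * monom t (fun i => (I i : ℕ)) := (hb x).choose_spec.1

theorem IsPBasis.coord_unique (hb : IsPBasis p t) {x : R} {c : (Fin n → Fin p) → R}
    (h : x = ∑ I, c I ^ p * monom t (fun i => (I i : ℕ))) : hb.coord x = c :=
  ((hb x).choose_spec.2 c h).symm

variable [CharP R p]

theorem IsPBasis.coord_add (hb : IsPBasis p t) (x y : R) :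
    hb.coord (x + y) = hb.coord x + hb.coord y := by
  apply hb.coord_unique
  conv_lhs => rw [hb.eq_sum x, hb.eq_sum y]
  rw [← Finset.sum_add_distrib]
  exact Finset.sum_congr rfl fun I _ => by rw [Pi.add_apply, add_pow_char, add_mul]

theorem IsPBasis.coord_pow_mul (hb : IsPBasis p t) (a x : R) :
    hb.coord (a ^ p * x) = fun I => a * hb.coord x I := by
  apply hb.coord_unique
  conv_lhs => rw [hb.eq_sum x]
  rw [Finset.mul_sum]
  exact Finset.sum_congr rfl fun I _ => by rw [mul_pow, mul_assoc]

/-- The exponent reduced modulo `p`. -/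
def redExp (p : ℕ) [hp : Fact p.Prime] {n : ℕ} (m : Fin n → ℕ) : Fin n → Fin p :=
  fun i => ⟨m i % p, Nat.mod_lt _ hp.out.pos⟩

theorem monom_eq_redExp (t : Fin n → R) (m : Fin n → ℕ) :
    monom t m = monom t (fun i => m i / p) ^ p * monom t (fun i => (redExp p m i : ℕ)) := by
  rw [← monom_smul, ← monom_add]
  congr 1
  ext i
  simp [redExp, Nat.div_add_mod]

theorem IsPBasis.coord_monom (hb : IsPBasis p t) (c : R) (m : Fin n → ℕ) :
    hb.coord (c ^ p * monom t m) =
      Pi.single (redExp p m) (c * monom t (fun i => m i / p)) := by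
  apply hb.coord_unique
  rw [Finset.sum_eq_single (redExp p m)]
  · rw [Pi.single_eq_same, mul_pow, mul_assoc, ← monom_eq_redExp]
  · intro I _ hI
    rw [Pi.single_eq_of_ne hI, zero_pow hp.out.ne_zero, zero_mul]
  · simp

/-- The operator which is diagonal in the basis of monomials, with eigenvalues `w`. -/
def IsPBasis.diag (hb : IsPBasis p t) (w : (Fin n → Fin p) → R) : R →+ R where
  toFun x := ∑ I, w I * (hb.coord x I ^ p * monom t (fun i => (I i : ℕ)))
  map_zero' := by
    have : hb.coord (0 : R) = 0 := by
      apply hb.coord_unique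
      simp [hp.out.ne_zero]
    simp [this, hp.out.ne_zero]
  map_add' x y := by
    rw [← Finset.sum_add_distrib]
    exact Finset.sum_congr rfl fun I _ => by
      rw [hb.coord_add, Pi.add_apply, add_pow_char]; ring

theorem IsPBasis.diag_apply (hb : IsPBasis p t) (w : (Fin n → Fin p) → R) (x : R) :
    hb.diag w x = ∑ I, w I * (hb.coord x I ^ p * monom t (fun i => (I i : ℕ))) := rfl

theorem IsPBasis.diag_pow_mul (hb : IsPBasis p t) (w : (Fin n → Fin p) → R) (a x : R) :
    hb.diag w (a ^ p * x) = a ^ p * hb.diag w x := by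
  rw [diag_apply, diag_apply, hb.coord_pow_mul, Finset.mul_sum]
  exact Finset.sum_congr rfl fun I _ => by rw [mul_pow]; ring

theorem IsPBasis.diag_monom (hb : IsPBasis p t) (w : (Fin n → Fin p) → R) (c : R)
    (m : Fin n → ℕ) :
    hb.diag w (c ^ p * monom t m) = w (redExp p m) * (c ^ p * monom t m) := by
  rw [diag_apply, hb.coord_monom, Finset.sum_eq_single (redExp p m)]
  · rw [Pi.single_eq_same, mul_pow, mul_assoc, ← monom_eq_redExp]
  · intro I _ hI
    rw [Pi.single_eq_of_ne hI, zero_pow hp.out.ne_zero, zero_mul, mul_zero]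
  · simp

/-- Additive maps agreeing on all multiples of monomials by `p`-th powers agree. -/
theorem IsPBasis.addHom_ext (hb : IsPBasis p t) {M : Type*} [AddCommMonoid M] {f g : R →+ M}
    (h : ∀ (c : R) (m : Fin n → ℕ), f (c ^ p * monom t m) = g (c ^ p * monom t m)) : f = g := by
  ext x
  rw [hb.eq_sum x, map_sum, map_sum]
  exact Finset.sum_congr rfl fun I _ => h _ _

/-- The derivation `tᵢ ∂/∂tᵢ`. -/
def IsPBasis.theta (hb : IsPBasis p t) (i : Fin n) : R →+ R := hb.diag fun I => ((I i : ℕ) : R)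

/-- The projection onto the `p`-th powers, killing all nontrivial monomials. -/
def IsPBasis.proj (hb : IsPBasis p t) : R →+ R := hb.diag fun I => if ∀ i, (I i : ℕ) = 0 then 1 else 0

/-- The exponents `m` are arbitrary: the eigenvalue depends only on `m i` modulo `p`, so no
reduction of exponents is needed in later computations. -/
theorem IsPBasis.theta_monom (hb : IsPBasis p t) (i : Fin n) (c : R) (m : Fin n → ℕ) :
    hb.theta i (c ^ p * monom t m) = (m i : R) * (c ^ p * monom t m) := by
  rw [theta, diag_monom]
  congr 1
  exact ((CharP.cast_eq_iff_mod_eq R p).2 (by simp [redExp]))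

theorem IsPBasis.proj_monom (hb : IsPBasis p t) (c : R) (m : Fin n → ℕ) :
    hb.proj (c ^ p * monom t m) = if ∀ i, p ∣ m i then c ^ p * monom t m else 0 := by
  rw [proj, diag_monom]
  have key : (∀ i, (redExp p m i : ℕ) = 0) ↔ ∀ i, p ∣ m i := by
    simp [redExp, Nat.dvd_iff_mod_eq_zero]
  by_cases h : ∀ i, p ∣ m i
  · rw [if_pos h, if_pos (key.2 h), one_mul]
  · rw [if_neg h, if_neg (mt key.1 h), zero_mul]

theorem IsPBasis.proj_pow_mul (hb : IsPBasis p t) (a x : R) :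
    hb.proj (a ^ p * x) = a ^ p * hb.proj x := hb.diag_pow_mul _ a x

theorem IsPBasis.theta_pow_mul (hb : IsPBasis p t) (i : Fin n) (a x : R) :
    hb.theta i (a ^ p * x) = a ^ p * hb.theta i x := hb.diag_pow_mul _ a x

/-- So `proj` takes values in `p`-th powers. In the frame `dlog tᵢ` of top forms, its `p`-th root is
the Cartier operator on coefficients. -/
theorem IsPBasis.proj_eq (hb : IsPBasis p t) (x : R) :
    hb.proj x = hb.coord x (redExp p 0) ^ p := by
  rw [proj, diag_apply, Finset.sum_eq_single (redExp p 0)]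
  · rw [if_pos (by simp [redExp]), one_mul]
    have : (fun i => ((redExp p (0 : Fin n → ℕ) i : Fin p) : ℕ)) = 0 := by ext i; simp [redExp]
    rw [this, monom_zero, mul_one]
  · intro I _ hI
    rw [if_neg, zero_mul]
    contrapose! hI
    ext i
    simp [redExp, hI]
  · simp

/-- By additivity and linearity over `p`-th powers it suffices to treat products of monomials, where
the Leibniz rule says that the exponent of `t i` is additive. -/
theorem IsPBasis.theta_mul (hb : IsPBasis p t) (i : Fin n) (x y : R) :
    hb.theta i (x * y) = x * hb.theta i y + y * hb.theta i x := by
  conv_lhs => rw [hb.eq_sum x, hb.eq_sum y]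
  conv_rhs =>
    rw [show hb.theta i y = hb.theta i (∑ I, hb.coord y I ^ p * monom t (fun i => (I i : ℕ))) by
      rw [← hb.eq_sum y], show hb.theta i x =
        hb.theta i (∑ I, hb.coord x I ^ p * monom t (fun i => (I i : ℕ))) by rw [← hb.eq_sum x]]
    enter [1, 1]; rw [hb.eq_sum x]
  conv_rhs => enter [2, 1]; rw [hb.eq_sum y]
  rw [map_sum, map_sum, Finset.sum_mul_sum, map_sum, Finset.sum_mul_sum, Finset.sum_mul_sum]
  conv_rhs => enter [2]; rw [Finset.sum_comm]
  rw [← Finset.sum_add_distrib]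
  refine Finset.sum_congr rfl fun I _ => ?_
  rw [map_sum, ← Finset.sum_add_distrib]
  refine Finset.sum_congr rfl fun J _ => ?_
  rw [show hb.coord x I ^ p * monom t (fun i => (I i : ℕ)) *
    (hb.coord y J ^ p * monom t (fun i => (J i : ℕ))) = (hb.coord x I * hb.coord y J) ^ p *
      monom t ((fun i => (I i : ℕ)) + (fun i => (J i : ℕ))) by rw [monom_add, mul_pow]; ring,
    theta_monom, theta_monom, theta_monom, monom_add, mul_pow, Pi.add_apply, Nat.cast_add]
  ring

end PBasis

end

/-! ### The Cartier operator and exact top forms over a field. -/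

section

section PBasis

variable {p : ℕ} [hp : Fact p.Prime] {L : Type*} [Field L] [CharP L p] {n : ℕ} {t : Fin n → L}

theorem IsPBasis.ne_zero (hb : IsPBasis p t) (i : Fin n) : t i ≠ 0 := by
  intro h
  have h1 := hb.coord_monom 1 (Pi.single i 1)
  have h2 : (1 : L) ^ p * monom t (Pi.single i 1) = 0 ^ p * monom t (Pi.single i 1) := by
    rw [monom_pi_single, h]; simp
  rw [h2, hb.coord_monom] at h1
  have h3 := congrFun h1 (redExp p (Pi.single i 1))
  rw [Pi.single_eq_same, Pi.single_eq_same, zero_mul, one_mul] at h3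
  have h4 : (fun j => (Pi.single i 1 : Fin n → ℕ) j / p) = 0 := by
    ext j
    rw [Pi.zero_apply, Nat.div_eq_zero_iff]
    right
    refine lt_of_le_of_lt ?_ hp.out.one_lt
    rw [Pi.single_apply]
    split_ifs <;> simp
  rw [h4, monom_zero] at h3
  exact zero_ne_one h3

/-- The exponents of the monomials in the expansion of a determinant. -/
def optExp {n p : ℕ} (r : Option (Fin n → Fin p)) : Fin n → ℕ := r.elim 0 fun I i => (I i : ℕ)

/-- A closed `n`-form `∏ (eⱼ ^ p dlog tⱼ + d gⱼ)` has the same class modulo exact forms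
as `∏ eⱼ ^ p dlog tⱼ`. -/
theorem IsPBasis.proj_det (hb : IsPBasis p t) (e g : Fin n → L) :
    hb.proj (Matrix.det (Matrix.of fun j i => (if j = i then e j ^ p else 0) + hb.theta i (g j))) =
      ∏ j, e j ^ p := by
  classical
  -- Row `j` is expanded over `none`, the term `e j ^ p`, and over `some I`, the monomials of `g j`.
  -- The remaining row vectors `V j r` are integral, so multilinearity yields a sum of `p`-th powers
  -- times monomials times integer determinants.
  let V : Fin n → Option (Fin n → Fin p) → Fin n → ℤ := fun j r i =>
    r.elim (if j = i then 1 else 0) fun I => ((I i : ℕ) : ℤ)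
  let c : Fin n → Option (Fin n → Fin p) → L := fun j r => r.elim (e j) fun I => hb.coord (g j) I
  have hrow : ∀ j i, (if j = i then e j ^ p else 0) + hb.theta i (g j) =
      (∑ r, (c j r ^ p * monom t (optExp r)) • fun i => (V j r i : L)) i := by
    intro j i
    rw [Fintype.sum_option, Pi.add_apply, Finset.sum_apply]
    congr 1
    · simp [c, optExp, V, monom_zero]
    · rw [theta, diag_apply]
      refine Finset.sum_congr rfl fun I _ => ?_
      simp [c, optExp, V]
      ring
  have hdet : Matrix.det (Matrix.of fun j i => (if j = i then e j ^ p else 0) + hb.theta i (g j)) =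
      ∑ r : Fin n → Option (Fin n → Fin p), ((∏ j, c j (r j)) ^ p * monom t (∑ j, optExp (r j))) *
        ((Matrix.det (Matrix.of fun j i => V j (r j) i) : ℤ) : L) := by
    have h1 : (Matrix.of fun j i => (if j = i then e j ^ p else 0) + hb.theta i (g j)) =
        fun j => ∑ r, (c j r ^ p * monom t (optExp r)) • fun i => (V j r i : L) := by
      ext j i; exact hrow j i
    change Matrix.detRowAlternating.toMultilinearMap _ = _
    rw [h1, MultilinearMap.map_sum]
    refine Finset.sum_congr rfl fun r _ => ?_
    rw [MultilinearMap.map_smul_univ, smul_eq_mul, Finset.prod_mul_distrib, monom_sum,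
      Finset.prod_pow, Int.cast_det]
    rfl
  rw [hdet, map_sum, Finset.sum_eq_single (fun _ => none)]
  · have : (Matrix.of fun j i => V j none i) = (1 : Matrix (Fin n) (Fin n) ℤ) := by
      ext j i; simp [V, Matrix.one_apply]
    rw [this, Matrix.det_one, Int.cast_one, mul_one, proj_monom]
    simp [optExp, c, monom_zero, Finset.prod_pow]
  · intro r _ hr
    rw [mul_comm, ← zsmul_eq_mul, map_zsmul, proj_monom]
    split_ifs with hdvd
    · suffices ((Matrix.det (Matrix.of fun j i => V j (r j) i) : ℤ) : L) = 0 by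
        rw [zsmul_eq_mul, this, zero_mul]
      rw [Int.cast_det, ← Matrix.exists_vecMul_eq_zero_iff]
      -- The monomial survives only if its total exponents are divisible by `p`. Then the rows with
      -- `r j ≠ none` add up to zero in `L`, a nontrivial relation since not all `r j` are `none`.
      refine ⟨fun j => (r j).elim 0 fun _ => 1, ?_, ?_⟩
      · intro h
        apply hr
        ext1 j
        have := congrFun h j
        cases hj : r j with
        | none => rfl
        | some I => simp [hj] at this
      · ext i
        have : ((∑ j, optExp (r j) i : ℕ) : L) = 0 := by
          have h := hdvd i
          rw [Finset.sum_apply] at h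
          rwa [CharP.cast_eq_zero_iff L p]
        rw [Nat.cast_sum] at this
        refine Eq.trans ?_ this
        rw [Matrix.vecMul, dotProduct]
        refine Finset.sum_congr (M := L) rfl fun j _ => ?_
        cases hj : r j <;> simp [V, optExp, hj]
    · simp
  · simp

/-- Exact top forms are killed by the projection. -/
theorem IsPBasis.proj_jacobian (hb : IsPBasis p t) (hn : n ≠ 0) (g : Fin n → L) :
    hb.proj (Matrix.det (Matrix.of fun j i => hb.theta i (g j))) = 0 := by
  have h := hb.proj_det 0 g
  have : NeZero n := ⟨hn⟩
  simpa [hp.out.ne_zero, hn] using h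

/-- Every element killed by the projection is a sum of exact top forms. -/
theorem IsPBasis.eq_sum_jacobian (hb : IsPBasis p t) (x : L) (hx : hb.proj x = 0) :
    ∃ (c : (Fin n → Fin p) → L) (g : (Fin n → Fin p) → Fin n → L), 
      x = ∑ I, c I ^ p * Matrix.det (Matrix.of fun j i => hb.theta i (g I j)) := by
  classical
  have key : ∀ (I : Fin n → Fin p) (a : L), ∃ (c : L) (g : Fin n → L),
      (a ^ p * monom t (fun i => (I i : ℕ))) - hb.proj (a ^ p * monom t (fun i => (I i : ℕ))) =
        c ^ p * Matrix.det (Matrix.of fun j i => hb.theta i (g j)) := by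
    intro I a
    rw [proj_monom]
    split_ifs with h
    · exact ⟨0, 0, by simp [hp.out.ne_zero]⟩
    · push Not at h
      obtain ⟨i₀, h₀⟩ := h
      have hI : ((I i₀ : ℕ) : L) ≠ 0 := by rwa [Ne, CharP.cast_eq_zero_iff L p]
      -- The monomial is integrated in the variable `t i₀`, whose exponent is invertible. Each of
      -- the other `d (t j)` contributes a factor `t j`; raising its exponent by `p - 1` turns this
      -- into `t j ^ p`, and dividing `a` by `P` removes these `p`-th powers.
      let m : Fin n → ℕ := fun j => if j = i₀ then I j else I j + (p - 1)
      let P : L := ∏ j ∈ Finset.univ.erase i₀, t j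
      have hP : P ≠ 0 := Finset.prod_ne_zero_iff.2 fun j _ => hb.ne_zero j
      refine ⟨a / P, fun j => if j = i₀ then (1 / (I i₀ : ℕ) : L) * monom t m else t j, ?_⟩
      have hnat : ∀ i (k : ℕ) (x : L), hb.theta i (1 / (k : L) * x) = 1 / (k : L) * hb.theta i x := by
        intro i k x
        have hk : (1 / (k : L)) = (1 / (k : L)) ^ p := by
          rw [div_pow, one_pow]
          congr 1
          rw [← frobenius_def, map_natCast]
        conv_lhs => rw [hk, theta_pow_mul, ← hk]
      have hth : ∀ j i, j ≠ i₀ → hb.theta i (t j) = if j = i then t j else 0 := by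
        intro j i hj
        have h1 := hb.theta_monom i 1 (Pi.single j 1)
        rw [monom_pi_single, one_pow, one_mul] at h1
        rw [h1, Pi.single_apply]
        by_cases hij : i = j
        · simp [hij]
        · rw [if_neg hij, if_neg (Ne.symm hij)]; simp
      have hdet : Matrix.det (Matrix.of fun j i => hb.theta i
          (if j = i₀ then (1 / (I i₀ : ℕ) : L) * monom t m else t j)) = monom t m * P := by
        have hrow : (Matrix.of fun j i => hb.theta i
            (if j = i₀ then (1 / (I i₀ : ℕ) : L) * monom t m else t j)) =
            Matrix.updateRow (Matrix.diagonal fun j => if j = i₀ then monom t m else t j) i₀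
              (fun i => hb.theta i ((1 / (I i₀ : ℕ) : L) * monom t m)) := by
          ext j i
          by_cases hj : j = i₀
          · subst hj; simp
          · rw [Matrix.updateRow_ne hj, Matrix.of_apply, if_neg hj, hth j i hj,
              Matrix.diagonal_apply, if_neg hj]
        -- Expressed through the rows of the diagonal matrix, the new row contributes only its `i₀`
        -- coefficient to the determinant.
        have hv : (fun i => hb.theta i ((1 / (I i₀ : ℕ) : L) * monom t m)) =
            ∑ i, ((hb.theta i ((1 / (I i₀ : ℕ) : L) * monom t m)) /
              (if i = i₀ then monom t m else t i)) •
              (Matrix.diagonal fun j => if j = i₀ then monom t m else t j) i := by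
          ext k
          rw [Finset.sum_apply, Finset.sum_eq_single k]
          · have : (if k = i₀ then monom t m else t k) ≠ 0 := by
              split_ifs
              · exact Finset.prod_ne_zero_iff.2 fun j _ => pow_ne_zero _ (hb.ne_zero j)
              · exact hb.ne_zero k
            rw [Pi.smul_apply, Matrix.diagonal_apply_eq, smul_eq_mul, div_mul_cancel₀ _ this]
          · intro b _ hb'
            rw [Pi.smul_apply, Matrix.diagonal_apply_ne _ hb', smul_zero]
          · simp
        rw [hrow, hv, Matrix.det_updateRow_sum, Matrix.det_diagonal, smul_eq_mul, if_pos rfl,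
          hnat, ← one_mul (monom t m), ← one_pow p, hb.theta_monom, one_pow, one_mul,
          ← Finset.mul_prod_erase _ _ (Finset.mem_univ i₀), if_pos rfl]
        have h2 : ∏ x ∈ Finset.univ.erase i₀, (if x = i₀ then monom t m else t x) = P :=
          Finset.prod_congr rfl fun j hj => if_neg (Finset.ne_of_mem_erase hj)
        have h3 : m i₀ = I i₀ := if_pos rfl
        have h4 : monom t m ≠ 0 := Finset.prod_ne_zero_iff.2 fun j _ => pow_ne_zero _ (hb.ne_zero j)
        rw [h2, h3]
        field_simp
      rw [hdet, sub_zero, div_pow]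
      have hm : monom t m * P = monom t (fun i => (I i : ℕ)) * P ^ p := by
        rw [← Finset.prod_pow, monom, monom, ← Finset.mul_prod_erase _ _ (Finset.mem_univ i₀),
          ← Finset.mul_prod_erase _ (fun i => t i ^ (I i : ℕ)) (Finset.mem_univ i₀), mul_assoc,
          mul_assoc, ← Finset.prod_mul_distrib, ← Finset.prod_mul_distrib]
        congr 1
        · simp [m]
        · refine Finset.prod_congr rfl fun j hj => ?_
          have : m j = I j + (p - 1) := if_neg (Finset.ne_of_mem_erase hj)
          rw [this, pow_add, mul_assoc, ← pow_succ, Nat.sub_add_cancel hp.out.one_le]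
      rw [hm]
      field_simp
  choose c g h using fun I => key I (hb.coord x I)
  refine ⟨c, g, ?_⟩
  rw [← Finset.sum_congr rfl fun I _ => h I, Finset.sum_sub_distrib, ← map_sum, ← hb.eq_sum x, hx,
    sub_zero]

end PBasis

/-! ### Derivations along a ring homomorphism -/

section TwistedDer

/-- An additive map `f : A → L` satisfying the Leibniz rule with respect to `σ : A → L`. -/
def IsTwistedDer {A L : Type*} [CommRing A] [CommRing L] (σ : A →+* L) (f : A →+ L) : Prop :=
  ∀ a b, f (a * b) = σ a * f b + σ b * f a

variable {A L : Type*} [CommRing A] [Field L] {σ : A →+* L} {f : A →+ L}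

theorem IsTwistedDer.map_one (hf : IsTwistedDer σ f) : f 1 = 0 := by
  have := hf 1 1
  simpa using this

theorem IsTwistedDer.map_pow (hf : IsTwistedDer σ f) (a : A) (k : ℕ) :
    f (a ^ (k + 1)) = (k + 1 : ℕ) * σ a ^ k * f a := by
  induction k with
  | zero => simp
  | succ k ih => rw [pow_succ, hf, ih, _root_.map_pow]; push_cast; ring

theorem IsTwistedDer.map_pow_char (hf : IsTwistedDer σ f) (p : ℕ) [hp : Fact p.Prime] [CharP L p]
    (a : A) : f (a ^ p) = 0 := by
  obtain ⟨k, hk⟩ : ∃ k, p = k + 1 := ⟨p - 1, (Nat.sub_add_cancel hp.out.one_le).symm⟩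
  have := hf.map_pow a k
  rw [← hk, CharP.cast_eq_zero] at this
  simpa using this

theorem IsTwistedDer.map_pow_char_mul (hf : IsTwistedDer σ f) (p : ℕ) [hp : Fact p.Prime]
    [CharP L p] (a b : A) : f (a ^ p * b) = σ a ^ p * f b := by
  rw [hf, hf.map_pow_char p]; simp

/-- The logarithmic derivative `f / σ` is additive on products. -/
theorem IsTwistedDer.map_monom (hf : IsTwistedDer σ f) {n : ℕ} (t : Fin n → A)
    (ht : ∀ i, σ (t i) ≠ 0) (m : Fin n → ℕ) :
    f (monom t m) = σ (monom t m) * ∑ i, (m i : L) * (f (t i) / σ (t i)) := by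
  classical
  unfold monom
  induction (Finset.univ : Finset (Fin n)) using Finset.induction_on with
  | empty => simpa using hf.map_one
  | insert i s hi ih =>
    rw [Finset.prod_insert hi, Finset.sum_insert hi, hf, ih, map_mul]
    rcases hm : m i with _ | k
    · simp [hf.map_one]
    · rw [hf.map_pow]
      have := ht i
      simp only [_root_.map_pow]
      field_simp
      ring

end TwistedDer

end

section

/-! ### Frobenius liftings of rings -/

/-- A flat lifting `S` of `A` modulo `p ^ 2`, together with a lifting `φ` of the Frobenius. -/
structure FrobLiftAlg (p : ℕ) (S A : Type*) [CommRing S] [CommRing A] where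
  /-- the reduction -/
  q : S →+* A
  surj : Function.Surjective q
  /-- the lifting of the Frobenius -/
  φ : S →+* S
  q_eq_zero : ∀ x, q x = 0 → ∃ y, x = p * y
  tors : ∀ x, (p : S) * x = 0 → q x = 0
  sq : (p : S) * p = 0
  q_φ : ∀ x, q (φ x) = q x ^ p

/-- The polynomial `((x + y) ^ p - x ^ p - y ^ p) / p`. -/
def addDefect (p : ℕ) {R : Type*} [CommRing R] (x y : R) : R :=
  x * y * ∑ k ∈ Finset.Ioo 0 p, x ^ (k - 1) * y ^ (p - k - 1) * (p.choose k / p : ℕ)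

theorem map_addDefect (p : ℕ) {R S : Type*} [CommRing R] [CommRing S] (f : R →+* S) (x y : R) :
    f (addDefect p x y) = addDefect p (f x) (f y) := by
  simp [addDefect, map_sum]

theorem add_pow_eq_addDefect {p : ℕ} [hp : Fact p.Prime] {R : Type*} [CommRing R] (x y : R) :
    (x + y) ^ p = x ^ p + y ^ p + p * addDefect p x y := by
  rw [add_pow_prime_eq hp.out, addDefect]; ring

theorem addDefect_eq {p : ℕ} {R : Type*} [CommRing R] (x y : R) :
    addDefect p x y = ∑ k ∈ Finset.Ioo 0 p, x ^ k * y ^ (p - k) * (p.choose k / p : ℕ) := by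
  rw [addDefect, Finset.mul_sum]
  refine Finset.sum_congr rfl fun k hk => ?_
  rw [Finset.mem_Ioo] at hk
  obtain ⟨a, rfl⟩ : ∃ a, k = a + 1 := ⟨k - 1, by omega⟩
  obtain ⟨b, hb⟩ : ∃ b, p - (a + 1) = b + 1 := ⟨p - (a + 1) - 1, by omega⟩
  rw [hb]; simp only [Nat.add_sub_cancel]; ring

namespace FrobLiftAlg

variable {p : ℕ} [hp : Fact p.Prime] {S A : Type*} [CommRing S] [CommRing A]
  (F : FrobLiftAlg p S A)

theorem q_p (F : FrobLiftAlg p S A) : (p : A) = 0 := by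
  have := F.tors p F.sq
  rwa [map_natCast] at this

theorem q_p_mul (x : S) : F.q (p * x) = 0 := by
  rw [map_mul, map_natCast, F.q_p, zero_mul]

/-- Together with `q_congr`: multiplication by `p` identifies `A` with `p S`. This makes division by
`p` a well-defined operation with values in `A`. -/
theorem p_mul_congr {x y : S} (h : F.q x = F.q y) : (p : S) * x = p * y := by
  obtain ⟨z, hz⟩ := F.q_eq_zero (x - y) (by rw [map_sub, h, sub_self])
  rw [← sub_eq_zero, ← mul_sub, hz, ← mul_assoc, F.sq, zero_mul]

theorem q_congr {x y : S} (h : (p : S) * x = p * y) : F.q x = F.q y := by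
  rw [← sub_eq_zero, ← map_sub]
  apply F.tors
  rw [mul_sub, h, sub_self]

theorem add_p_mul_pow (F : FrobLiftAlg p S A) (a b : S) : (a + p * b) ^ p = a ^ p := by
  have h2 : (p * b : S) ^ p = 0 := by
    obtain ⟨k, hk⟩ : ∃ k, p = 2 + k := ⟨p - 2, by have := hp.out.two_le; omega⟩
    conv_lhs => rw [mul_pow]; enter [1, 2]; rw [hk]
    rw [pow_add, pow_two, F.sq, zero_mul, zero_mul]
  have h3 : (p : S) * addDefect p a (p * b) = 0 := by
    rw [addDefect, show (p : S) * (a * (p * b) * ∑ k ∈ Finset.Ioo 0 p, a ^ (k - 1) *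
      (p * b) ^ (p - k - 1) * (p.choose k / p : ℕ)) = (p * p) * (a * b * ∑ k ∈ Finset.Ioo 0 p,
      a ^ (k - 1) * (p * b) ^ (p - k - 1) * (p.choose k / p : ℕ)) by ring, F.sq, zero_mul]
  rw [add_pow_eq_addDefect, h2, h3, add_zero, add_zero]

theorem exists_δ (x : S) : ∃ y, F.φ x = x ^ p + p * y := by
  obtain ⟨y, hy⟩ := F.q_eq_zero (F.φ x - x ^ p) (by rw [map_sub, F.q_φ, map_pow, sub_self])
  exact ⟨y, by rw [← hy]; ring⟩

/-- The map `δ` with `φ x = x ^ p + p δ x`. -/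
def δ (x : S) : A := F.q (F.exists_δ x).choose

theorem δ_eq {x y : S} (h : F.φ x = x ^ p + p * y) : F.δ x = F.q y :=
  F.q_congr (add_left_cancel ((F.exists_δ x).choose_spec.symm.trans h))

theorem δ_spec {x y : S} (h : F.q y = F.δ x) : F.φ x = x ^ p + p * y := by
  obtain ⟨z, hz⟩ := F.exists_δ x
  rw [hz, F.p_mul_congr (h.trans (F.δ_eq hz))]

/-- Multiplicativity of `φ`, with the cross term lost to `p ^ 2 = 0`. Thus `δ` obeys the Leibniz
rule along the Frobenius; it fails to be a derivation only through `addDefect`. -/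
theorem δ_mul (x y : S) : F.δ (x * y) = F.q x ^ p * F.δ y + F.q y ^ p * F.δ x := by
  obtain ⟨a, ha⟩ := F.exists_δ x
  obtain ⟨b, hb⟩ := F.exists_δ y
  rw [F.δ_eq ha, F.δ_eq hb, ← map_pow, ← map_pow, ← map_mul, ← map_mul, ← map_add]
  apply F.δ_eq
  rw [map_mul, ha, hb, show (x ^ p + p * a) * (y ^ p + p * b) =
    (x * y) ^ p + p * (x ^ p * b + y ^ p * a) + p * p * (a * b) by ring, F.sq, zero_mul, add_zero]

theorem δ_add (x y : S) : F.δ (x + y) = F.δ x + F.δ y - addDefect p (F.q x) (F.q y) := by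
  obtain ⟨a, ha⟩ := F.exists_δ x
  obtain ⟨b, hb⟩ := F.exists_δ y
  rw [F.δ_eq ha, F.δ_eq hb, ← map_addDefect, ← map_add, ← map_sub]
  apply F.δ_eq
  rw [map_add, ha, hb, add_pow_eq_addDefect]
  ring

/-- Here `φ (p * x) = p * φ x` while `(p * x) ^ p = 0`. So `δ` is not zero on the kernel of `q`, but
its values there are `p`-th powers: derivations kill them and Frobenius splittings detect them. -/
theorem δ_p_mul (x : S) : F.δ (p * x) = F.q x ^ p := by
  obtain ⟨a, ha⟩ := F.exists_δ x
  rw [← map_pow]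
  apply F.δ_eq
  have := F.add_p_mul_pow 0 x
  rw [zero_add, zero_pow hp.out.ne_zero] at this
  rw [map_mul, map_natCast, ha, this, mul_add, ← mul_assoc, F.sq]
  ring

/-- A `p`-th power in `S` depends only on the reduction of its base, so `φ (x ^ p) = (x ^ p) ^ p`
without error term. -/
theorem δ_pow (x : S) : F.δ (x ^ p) = 0 := by
  obtain ⟨a, ha⟩ := F.exists_δ x
  rw [← map_zero F.q]
  apply F.δ_eq
  rw [map_pow, ha, F.add_p_mul_pow]
  ring

theorem δ_one : F.δ 1 = 0 := by simpa using F.δ_pow 1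

theorem δ_zero : F.δ 0 = 0 := by simpa [hp.out.ne_zero] using F.δ_pow 0

theorem δ_of_q_eq_zero {x : S} (hx : F.q x = 0) : ∃ b, F.δ x = b ^ p := by
  obtain ⟨y, rfl⟩ := F.q_eq_zero x hx
  exact ⟨F.q y, F.δ_p_mul y⟩

end FrobLiftAlg

/-! ### The inverse Cartier operator of a Frobenius lifting. -/

section

variable {p : ℕ} [hp : Fact p.Prime] {L : Type*} [Field L] [CharP L p]

theorem IsTwistedDer.map_natCast_mul {A : Type*} [CommRing A] {σ : A →+* L} {f : A →+ L}
    (_ : IsTwistedDer σ f) (k : ℕ) (a : A) : f (a * k) = k * f a := by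
  rw [mul_comm, ← nsmul_eq_mul, map_nsmul, nsmul_eq_mul]

/-- Formally, `1 / p` times the derivative of `(x + y) ^ p - x ^ p - y ^ p`. It is the reason why `x
^ (p - 1) D x + D (δ x)` is additive in `x`. -/
theorem IsTwistedDer.map_addDefect {D : L →+ L} (hD : IsTwistedDer (RingHom.id L) D) (x y : L) :
    D (addDefect p x y) = (x + y) ^ (p - 1) * D (x + y) - x ^ (p - 1) * D x - y ^ (p - 1) * D y := by
  obtain ⟨q, hq⟩ : ∃ q, p = q + 1 := ⟨p - 1, (Nat.sub_add_cancel hp.out.one_le).symm⟩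
  have hIoo : Finset.Ioo 0 p = (Finset.range q).map ⟨(· + 1), add_left_injective 1⟩ := by
    ext k
    simp only [Finset.mem_Ioo, Finset.mem_map, Finset.mem_range, Function.Embedding.coeFn_mk]
    constructor
    · intro h; exact ⟨k - 1, by omega, by omega⟩
    · rintro ⟨a, h, rfl⟩; omega
  have hterm : ∀ k ∈ Finset.range q, D (x ^ (k + 1) * y ^ (p - (k + 1)) *
      (p.choose (k + 1) / p : ℕ)) = (x ^ k * y ^ (q - k) * (q.choose k : ℕ)) * D x +
        (x ^ (k + 1) * y ^ (q - (k + 1)) * (q.choose (k + 1) : ℕ)) * D y := by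
    intro k hk
    rw [Finset.mem_range] at hk
    obtain ⟨b, hb⟩ : ∃ b, q = k + 1 + b := ⟨q - (k + 1), by omega⟩
    obtain ⟨c, hc⟩ := hp.out.dvd_choose_self (Nat.succ_ne_zero k) (by omega)
    have hc1 : p.choose (k + 1) / p = c := by
      rw [hc, Nat.mul_div_cancel_left _ hp.out.pos]
    have h1 : (c * (k + 1) : ℕ) = q.choose k := by
      have := Nat.add_one_mul_choose_eq q k
      rw [← hq, hc, mul_assoc] at this
      exact (Nat.eq_of_mul_eq_mul_left hp.out.pos this).symm
    have h2 : (c * (b + 1) : ℕ) = q.choose (k + 1) := by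
      have := Nat.choose_mul_succ_eq q (k + 1)
      rw [← hq, hc, mul_comm, mul_assoc, show p - (k + 1) = b + 1 by omega] at this
      exact (Nat.eq_of_mul_eq_mul_left hp.out.pos this).symm
    rw [hc1, hD.map_natCast_mul, hD, show p - (k + 1) = b + 1 by omega, hD.map_pow, hD.map_pow,
      ← h1, ← h2, show q - k = b + 1 by omega, show q - (k + 1) = b by omega]
    simp only [RingHom.id_apply]
    push_cast
    ring
  have hs1 : ∑ k ∈ Finset.range q, x ^ k * y ^ (q - k) * (q.choose k : ℕ) =
      (x + y) ^ q - x ^ q := by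
    rw [add_pow, Finset.sum_range_succ]; simp
  have hs2 : ∑ k ∈ Finset.range q, x ^ (k + 1) * y ^ (q - (k + 1)) * (q.choose (k + 1) : ℕ) =
      (x + y) ^ q - y ^ q := by
    rw [add_pow, Finset.sum_range_succ']; simp
  rw [addDefect_eq, hIoo, Finset.sum_map, map_sum]
  simp only [Function.Embedding.coeFn_mk]
  rw [Finset.sum_congr rfl hterm, Finset.sum_add_distrib, ← Finset.sum_mul, ← Finset.sum_mul, hs1,
    hs2, map_add, hq, Nat.add_sub_cancel]
  ring

theorem IsPBasis.isTwistedDer_theta {n : ℕ} {t : Fin n → L} (hb : IsPBasis p t) (i : Fin n) :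
    IsTwistedDer (RingHom.id L) (hb.theta i) := hb.theta_mul i

theorem IsPBasis.theta_self {n : ℕ} {t : Fin n → L} (hb : IsPBasis p t) (i j : Fin n) :
    hb.theta i (t j) = if j = i then t j else 0 := by
  have h1 := hb.theta_monom i 1 (Pi.single j 1)
  rw [monom_pi_single, one_pow, one_mul] at h1
  rw [h1, Pi.single_apply]
  by_cases hij : i = j
  · simp [hij]
  · rw [if_neg hij, if_neg (Ne.symm hij)]; simp

/-- The chain rule for derivations of `L`. -/
theorem IsPBasis.derivation_eq {n : ℕ} {t : Fin n → L} (hb : IsPBasis p t) {D : L →+ L}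
    (hD : IsTwistedDer (RingHom.id L) D) (x : L) :
    D x = ∑ l, D (t l) / t l * hb.theta l x := by
  have : D = ∑ l, (AddMonoidHom.mulLeft (D (t l) / t l)).comp (hb.theta l) := by
    apply hb.addHom_ext
    intro c m
    rw [hD.map_pow_char_mul p, hD.map_monom t hb.ne_zero, AddMonoidHom.finsetSum_apply,
      Finset.mul_sum, Finset.mul_sum]
    refine Finset.sum_congr rfl fun l _ => ?_
    rw [AddMonoidHom.comp_apply, AddMonoidHom.coe_mulLeft, hb.theta_monom]
    simp only [RingHom.id_apply]
    ring
  conv_lhs => rw [this]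
  simp

variable {S A : Type*} [CommRing S] [CommRing A] (F : FrobLiftAlg p S A) [Algebra A L]

/-- The ring homomorphism `x ↦ x̄ ^ p`. -/
def FrobLiftAlg.frobHom (L : Type*) [Field L] [CharP L p] [Algebra A L] : S →+* L :=
  (frobenius L p).comp ((algebraMap A L).comp F.q)

theorem FrobLiftAlg.frobHom_apply (x : S) : F.frobHom L x = algebraMap A L (F.q x) ^ p := rfl

/-- The contraction with `D` of the inverse Cartier operator `d x ↦ x ^ (p - 1) d x + d (δ x)`. -/
def FrobLiftAlg.cartier {D : L →+ L} (hD : IsTwistedDer (RingHom.id L) D) : S →+ L where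
  toFun x := algebraMap A L (F.q x) ^ (p - 1) * D (algebraMap A L (F.q x)) +
    D (algebraMap A L (F.δ x))
  map_zero' := by simp [F.δ_zero]
  map_add' x y := by
    rw [F.δ_add, map_sub (algebraMap A L), map_add (algebraMap A L), FrobLift.map_addDefect,
      map_sub D, map_add D, hD.map_addDefect, map_add F.q, map_add (algebraMap A L)]
    ring

variable {F}

theorem FrobLiftAlg.cartier_apply {D : L →+ L} (hD : IsTwistedDer (RingHom.id L) D) (x : S) :
    F.cartier hD x = algebraMap A L (F.q x) ^ (p - 1) * D (algebraMap A L (F.q x)) +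
    D (algebraMap A L (F.δ x)) := rfl

theorem FrobLiftAlg.isTwistedDer_cartier {D : L →+ L} (hD : IsTwistedDer (RingHom.id L) D) :
    IsTwistedDer (F.frobHom L) (F.cartier hD) := by
  intro x y
  obtain ⟨q, hq⟩ : ∃ q, p = q + 1 := ⟨p - 1, (Nat.sub_add_cancel hp.out.one_le).symm⟩
  simp only [cartier_apply, F.δ_mul, map_mul, map_add, map_pow, hD.map_pow_char_mul p,
    frobHom_apply]
  rw [hD]
  simp only [RingHom.id_apply, hq, Nat.add_sub_cancel]
  ring

/-- On the kernel of `q` the values of `δ` are `p`-th powers, which `D` kills. Hence the operator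
depends only on reductions and is really defined on `A`. -/
theorem FrobLiftAlg.cartier_of_q_eq_zero {D : L →+ L} (hD : IsTwistedDer (RingHom.id L) D) {x : S}
    (hx : F.q x = 0) : F.cartier hD x = 0 := by
  obtain ⟨b, hb⟩ := F.δ_of_q_eq_zero hx
  rw [cartier_apply, hx, hb, map_pow, hD.map_pow_char p]
  simp

theorem FrobLiftAlg.cartier_congr {D : L →+ L} (hD : IsTwistedDer (RingHom.id L) D) {x y : S}
    (h : F.q x = F.q y) : F.cartier hD x = F.cartier hD y := by
  rw [← sub_eq_zero, ← map_sub]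
  exact cartier_of_q_eq_zero hD (by rw [map_sub, h, sub_self])

theorem FrobLiftAlg.cartier_congr_algebraMap (T : Submonoid A) [IsLocalization T L] {D : L →+ L}
    (hD : IsTwistedDer (RingHom.id L) D) {x y : S}
    (h : algebraMap A L (F.q x) = algebraMap A L (F.q y)) : F.cartier hD x = F.cartier hD y := by
  obtain ⟨s, hs⟩ := (IsLocalization.eq_iff_exists T L).1 h
  obtain ⟨s', hs'⟩ := F.surj s
  have h1 := cartier_congr hD (F := F) (x := s' * x) (y := s' * y) (by rw [map_mul, map_mul, hs', hs])
  have h0 : algebraMap A L (F.q s') ≠ 0 := hs' ▸ (IsLocalization.map_units L s).ne_zero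
  rw [F.isTwistedDer_cartier hD, F.isTwistedDer_cartier hD, frobHom_apply, frobHom_apply,
    frobHom_apply, h, add_left_inj] at h1
  exact mul_left_cancel₀ (pow_ne_zero p h0) h1

/-- The chain rule for `cartier`. -/
theorem FrobLiftAlg.cartier_eq (T : Submonoid A) [IsLocalization T L] {n : ℕ} {t : Fin n → S}
    (hb : IsPBasis p (fun i => algebraMap A L (F.q (t i))))
    {D : L →+ L} (hD : IsTwistedDer (RingHom.id L) D) (x : S) :
    F.cartier hD x = ∑ l, hb.theta l (algebraMap A L (F.q x)) ^ p *
      (F.cartier hD (t l) / algebraMap A L (F.q (t l)) ^ p) := by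
  have hE := F.isTwistedDer_cartier hD
  set E := F.cartier hD
  set xb := algebraMap A L (F.q x)
  -- A common denominator of the coordinates. After multiplication by a lift of `s ^ p` the
  -- expansion of `xb` has coefficients in `A` and lifts to `S`, while `E` merely acquires the
  -- factor `(s ^ p) ^ p`.
  obtain ⟨s, hs⟩ := IsLocalization.exist_integer_multiples_of_finite T
    (hb.coord xb)
  choose a ha using hs
  obtain ⟨s', hs'⟩ := F.surj s
  choose a' ha' using fun I => F.surj (a I)
  have hs0 : algebraMap A L s ≠ 0 := (IsLocalization.map_units L s).ne_zero
  have ha2 : ∀ I, algebraMap A L (a I) = algebraMap A L s * hb.coord xb I := by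
    intro I
    rw [ha, Algebra.smul_def]
  have hq : algebraMap A L (F.q (s' ^ p * x)) =
      algebraMap A L (F.q (∑ I, a' I ^ p * monom t (fun i => (I i : ℕ)))) := by
    rw [map_mul, map_mul, map_pow, map_pow, hs', map_sum, map_sum]
    change algebraMap A L s ^ p * xb = _
    conv_lhs => rw [hb.eq_sum xb]
    rw [Finset.mul_sum]
    refine Finset.sum_congr rfl fun I _ => ?_
    rw [map_mul, map_mul, map_pow, map_pow, ha', ha2, map_monom, map_monom, mul_pow, mul_assoc]
  have h1 := cartier_congr_algebraMap T hD hq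
  change E _ = E _ at h1
  rw [hE.map_pow_char_mul p, map_sum] at h1
  have hσt : ∀ i, F.frobHom L (t i) ≠ 0 := fun i => pow_ne_zero _ (hb.ne_zero i)
  have h2 : ∀ I : Fin n → Fin p, E (a' I ^ p * monom t (fun i => (I i : ℕ))) =
      ∑ l, (algebraMap A L s ^ p) ^ p * (((I l : ℕ) : L) * (hb.coord xb I ^ p *
        monom (fun i => algebraMap A L (F.q (t i))) (fun i => (I i : ℕ)))) ^ p *
        (E (t l) / algebraMap A L (F.q (t l)) ^ p) := by
    intro I
    rw [hE.map_pow_char_mul p, hE.map_monom t hσt, Finset.mul_sum, Finset.mul_sum]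
    refine Finset.sum_congr rfl fun l _ => ?_
    have hI : ((I l : ℕ) : L) ^ p = (I l : ℕ) := by rw [← frobenius_def, map_natCast]
    rw [frobHom_apply, frobHom_apply, frobHom_apply, ha', ha2, map_monom, map_monom]
    simp only [mul_pow, hI]
    ring
  rw [Finset.sum_congr rfl fun I _ => h2 I, Finset.sum_comm, frobHom_apply, hs'] at h1
  have hs1 : (algebraMap A L s ^ p) ^ p ≠ 0 := pow_ne_zero _ (pow_ne_zero _ hs0)
  apply mul_left_cancel₀ hs1
  rw [h1, Finset.mul_sum]
  refine Finset.sum_congr rfl fun l _ => ?_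
  rw [IsPBasis.theta, IsPBasis.diag_apply, sum_pow_char, Finset.sum_mul, Finset.mul_sum]
  exact Finset.sum_congr rfl fun I _ => by rw [mul_assoc]

/-! ### The Frobenius trace -/

/-- The determinant of the inverse Cartier operator in the basis `dlog tᵢ`. -/
def FrobLiftAlg.cartierDet {n : ℕ} {t : Fin n → S} (F : FrobLiftAlg p S A)
    (hb : IsPBasis p (fun i => algebraMap A L (F.q (t i)))) : L :=
  Matrix.det (Matrix.of fun j i => F.cartier (hb.isTwistedDer_theta i) (t j) /
    algebraMap A L (F.q (t j)) ^ p)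

/-- The `p`-th power of the Frobenius splitting of `L` defined by the Frobenius lifting. -/
def FrobLiftAlg.trace {n : ℕ} {t : Fin n → S} (F : FrobLiftAlg p S A)
    (hb : IsPBasis p (fun i => algebraMap A L (F.q (t i)))) : L →+ L :=
  hb.proj.comp (AddMonoidHom.mulRight (F.cartierDet hb))

theorem FrobLiftAlg.trace_apply {n : ℕ} {t : Fin n → S}
    (hb : IsPBasis p (fun i => algebraMap A L (F.q (t i)))) (x : L) :
    F.trace hb x = hb.proj (x * F.cartierDet hb) := rfl

theorem FrobLiftAlg.trace_pow_mul {n : ℕ} {t : Fin n → S}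
    (hb : IsPBasis p (fun i => algebraMap A L (F.q (t i)))) (a x : L) :
    F.trace hb (a ^ p * x) = a ^ p * F.trace hb x := by
  rw [trace_apply, mul_assoc, hb.proj_pow_mul, trace_apply]

/-- The inverse Cartier operator sends `dlog (t j)` to `dlog (t j)` plus the differential of `δ (t
j) / t j ^ p`, so `proj_det` applies with all `e j = 1`. -/
theorem FrobLiftAlg.trace_one {n : ℕ} {t : Fin n → S}
    (hb : IsPBasis p (fun i => algebraMap A L (F.q (t i)))) : F.trace hb 1 = 1 := by
  rw [trace_apply, one_mul, cartierDet]
  obtain ⟨q, hq⟩ : ∃ q, p = q + 1 := ⟨p - 1, (Nat.sub_add_cancel hp.out.one_le).symm⟩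
  have : ∀ j i, F.cartier (hb.isTwistedDer_theta i) (t j) / algebraMap A L (F.q (t j)) ^ p =
      (if j = i then 1 ^ p else 0) + hb.theta i ((algebraMap A L (F.q (t j)))⁻¹ ^ p *
        algebraMap A L (F.δ (t j))) := by
    intro j i
    have h0 : algebraMap A L (F.q (t j)) ≠ 0 := hb.ne_zero j
    rw [cartier_apply, hb.theta_self, hb.theta_pow_mul, inv_pow, add_div]
    congr 1
    · split_ifs
      · rw [← pow_succ, Nat.sub_add_cancel hp.out.one_le, div_self (pow_ne_zero _ h0), one_pow]
      · simp
    · rw [div_eq_inv_mul]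
  simp only [this]
  rw [hb.proj_det]
  simp

theorem FrobLiftAlg.trace_pow {n : ℕ} {t : Fin n → S}
    (hb : IsPBasis p (fun i => algebraMap A L (F.q (t i)))) (a : L) :
    F.trace hb (a ^ p) = a ^ p := by
  rw [← mul_one (a ^ p), trace_pow_mul, trace_one]

theorem FrobLiftAlg.exists_trace_eq_pow {n : ℕ} {t : Fin n → S}
    (hb : IsPBasis p (fun i => algebraMap A L (F.q (t i)))) (x : L) :
    ∃ y, F.trace hb x = y ^ p :=
  ⟨_, hb.proj_eq _⟩

/-- The trace does not depend on the `p`-basis. -/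
theorem FrobLiftAlg.trace_eq (T : Submonoid A) [IsLocalization T L] {n : ℕ} {t t' : Fin n → S}
    (hb : IsPBasis p (fun i => algebraMap A L (F.q (t i))))
    (hb' : IsPBasis p (fun i => algebraMap A L (F.q (t' i)))) : F.trace hb = F.trace hb' := by
  -- Both traces take values in `p`-th powers and are the identity there, so it is enough to compare
  -- kernels.
  suffices h : ∀ x, F.trace hb x = 0 → F.trace hb' x = 0 by
    ext x
    obtain ⟨y, hy⟩ := exists_trace_eq_pow hb x
    have := h (x - y ^ p) (by rw [map_sub, hy, trace_pow, sub_self])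
    rw [map_sub, trace_pow, sub_eq_zero] at this
    rw [this, hy]
  intro x hx
  -- For an empty `p`-basis there are no exact forms, but then every element is a `p`-th power and
  -- `proj` is injective.
  rcases eq_or_ne n 0 with rfl | hn
  · have : x = 0 := by
      rw [trace_apply, cartierDet, Matrix.det_fin_zero, mul_one, hb.proj_eq] at hx
      rw [hb.eq_sum x, Fintype.sum_eq_single (redExp p 0) (fun I hI => (hI (Subsingleton.elim _ _)).elim),
        hx, zero_mul]
    rw [this, map_zero]
  -- `N` expresses `dlog t'` through `dlog t`, and `M` does the reverse. The source of the inverse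
  -- Cartier operator changes Frobenius-linearly by `N` and its target linearly by `M`, whence the
  -- formula for `cartierDet` below.
  let M : Matrix (Fin n) (Fin n) L := Matrix.of fun i l =>
    hb'.theta i (algebraMap A L (F.q (t l))) / algebraMap A L (F.q (t l))
  let N : Matrix (Fin n) (Fin n) L := Matrix.of fun j l =>
    hb.theta l (algebraMap A L (F.q (t' j))) / algebraMap A L (F.q (t' j))
  have hθ : ∀ i y, hb'.theta i y = ∑ l, M i l * hb.theta l y := fun i y =>
    hb.derivation_eq (hb'.isTwistedDer_theta i) y
  have hjac : ∀ g : Fin n → L, Matrix.det (Matrix.of fun j i => hb'.theta i (g j)) =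
      M.det * Matrix.det (Matrix.of fun j i => hb.theta i (g j)) := by
    intro g
    rw [← Matrix.det_transpose M, mul_comm, ← Matrix.det_mul]
    congr 1
    ext j i
    rw [Matrix.of_apply, hθ, Matrix.mul_apply]
    exact Finset.sum_congr rfl fun l _ => by rw [Matrix.of_apply, Matrix.transpose_apply, mul_comm]
  have hE : ∀ i y, F.cartier (hb'.isTwistedDer_theta i) y =
      ∑ l, M i l * F.cartier (hb.isTwistedDer_theta l) y := by
    intro i y
    simp only [cartier_apply, hθ i, Finset.mul_sum, ← Finset.sum_add_distrib]
    exact Finset.sum_congr rfl fun l _ => by ring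
  have hdet : F.cartierDet hb' = N.det ^ p * (M.det * F.cartierDet hb) := by
    have h1 : (Matrix.of fun j i => F.cartier (hb'.isTwistedDer_theta i) (t' j) /
        algebraMap A L (F.q (t' j)) ^ p) = N.map (frobenius L p) *
        ((Matrix.of fun j i => F.cartier (hb.isTwistedDer_theta i) (t j) /
        algebraMap A L (F.q (t j)) ^ p) * M.transpose) := by
      ext j i
      rw [Matrix.of_apply, F.cartier_eq T hb, Matrix.mul_apply, Finset.sum_div]
      refine Finset.sum_congr rfl fun l _ => ?_
      rw [Matrix.mul_apply, hE, Matrix.map_apply, frobenius_def, Finset.sum_div]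
      simp only [N, Matrix.of_apply, Matrix.transpose_apply, div_pow, Finset.mul_sum,
        Finset.sum_div]
      exact Finset.sum_congr rfl fun m _ => by ring
    have h2 : (N.map (frobenius L p)).det = N.det ^ p := by
      rw [← frobenius_def, RingHom.map_det]; rfl
    rw [cartierDet, h1, Matrix.det_mul, Matrix.det_mul, Matrix.det_transpose, h2, cartierDet]
    ring
  rw [trace_apply] at hx
  -- The kernel of `proj` consists of exact forms. The factor `M.det` rewrites their Jacobians in
  -- the other frame, where they are exact again.
  obtain ⟨c, g, hcg⟩ := hb.eq_sum_jacobian _ hx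
  rw [trace_apply, hdet, show x * (N.det ^ p * (M.det * F.cartierDet hb)) =
    N.det ^ p * (M.det * (x * F.cartierDet hb)) by ring, hb'.proj_pow_mul, hcg, Finset.mul_sum,
    map_sum, Finset.sum_eq_zero, mul_zero]
  intro I _
  rw [mul_left_comm, hb'.proj_pow_mul, ← hjac, hb'.proj_jacobian hn, mul_zero]

end

end

section

/-! ### Integrality of the trace -/

section Integrality

variable {p : ℕ} [hp : Fact p.Prime]

theorem eq_of_pow_char_eq {R : Type*} [CommRing R] [IsDomain R] [CharP R p] {x y : R}
    (h : x ^ p = y ^ p) : x = y :=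
  frobenius_inj R p h

theorem isPBasis_of_eq_zero {R : Type*} [CommRing R] [CharP R p] {n : ℕ} {t : Fin n → R}
    (h1 : ∀ x : R, ∃ c : (Fin n → Fin p) → R, x = ∑ I, c I ^ p * monom t (fun i => (I i : ℕ)))
    (h2 : ∀ c : (Fin n → Fin p) → R, ∑ I, c I ^ p * monom t (fun i => (I i : ℕ)) = 0 → c = 0) :
    IsPBasis p t := by
  intro x
  obtain ⟨c, hc⟩ := h1 x
  refine ⟨c, hc, fun c' hc' => ?_⟩
  rw [← sub_eq_zero]
  apply h2
  rw [← sub_eq_zero.2 (hc'.symm.trans hc), ← Finset.sum_sub_distrib]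
  exact Finset.sum_congr rfl fun I _ => by rw [Pi.sub_apply, sub_pow_char, sub_mul]

theorem IsPBasis.coord_zero {R : Type*} [CommRing R] {n : ℕ} {t : Fin n → R} (hb : IsPBasis p t) :
    hb.coord 0 = 0 := by
  apply hb.coord_unique
  simp [hp.out.ne_zero]

/-- A `p`-basis of a domain is a `p`-basis of the fraction field. -/
theorem IsPBasis.map_algebraMap {R : Type*} [CommRing R] [IsDomain R] {n : ℕ}
    {t : Fin n → R} (hb : IsPBasis p t) (L : Type*) [Field L] [CharP L p] [Algebra R L]
    [IsFractionRing R L] : IsPBasis p (fun i => algebraMap R L (t i)) := by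
  have hinj := IsFractionRing.injective R L
  apply isPBasis_of_eq_zero
  · intro x
    obtain ⟨a, s, hs, rfl⟩ := IsFractionRing.div_surjective (A := R) x
    have hs0 : algebraMap R L s ≠ 0 := (map_ne_zero_iff _ hinj).2 (nonZeroDivisors.ne_zero hs)
    -- As `a / s = (a * s ^ (p - 1)) / s ^ p`, the coordinates of the numerator just get divided by
    -- `s`.
    refine ⟨fun I => algebraMap R L (hb.coord (a * s ^ (p - 1)) I) / algebraMap R L s, ?_⟩
    have h1 := congrArg (algebraMap R L) (hb.eq_sum (a * s ^ (p - 1)))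
    rw [map_mul, map_pow, map_sum] at h1
    rw [div_eq_mul_inv, show algebraMap R L a * (algebraMap R L s)⁻¹ =
      (algebraMap R L a * algebraMap R L s ^ (p - 1)) * ((algebraMap R L s)⁻¹) ^ p by
      obtain ⟨q, hq⟩ : ∃ q, p = q + 1 := ⟨p - 1, (Nat.sub_add_cancel hp.out.one_le).symm⟩
      rw [hq, Nat.add_sub_cancel, mul_assoc, inv_pow, pow_succ, mul_inv, ← mul_assoc (_ ^ q),
        mul_inv_cancel₀ (pow_ne_zero _ hs0), one_mul], h1, Finset.sum_mul]
    refine Finset.sum_congr rfl fun I _ => ?_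
    rw [map_mul, map_pow, map_monom, div_pow, inv_pow]
    ring
  · intro c hc
    obtain ⟨s, hs⟩ := IsLocalization.exist_integer_multiples_of_finite (nonZeroDivisors R) c
    choose a ha using hs
    have hs0 : algebraMap R L s ≠ 0 :=
      (map_ne_zero_iff _ hinj).2 (nonZeroDivisors.coe_ne_zero s)
    have ha2 : ∀ I, algebraMap R L (a I) = algebraMap R L s * c I := by
      intro I
      rw [ha, Algebra.smul_def]
    have h0 : hb.coord 0 = a := by
      apply hb.coord_unique
      apply hinj
      rw [map_zero, map_sum, ← mul_zero (algebraMap R L s ^ p), ← hc, Finset.mul_sum]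
      exact Finset.sum_congr rfl fun I _ => by
        rw [map_mul, map_pow, ha2, map_monom, mul_pow, mul_assoc]
    rw [hb.coord_zero] at h0
    ext I
    have := ha2 I
    rw [← h0, Pi.zero_apply, map_zero] at this
    simpa [hs0] using this.symm

theorem IsPBasis.coord_map {R L : Type*} [CommRing R] [CommRing L] (f : R →+* L) {n : ℕ}
    {t : Fin n → R} (hb : IsPBasis p t) (hL : IsPBasis p (fun i => f (t i))) (x : R)
    (I : Fin n → Fin p) : hL.coord (f x) I = f (hb.coord x I) := by
  have : hL.coord (f x) = fun I => f (hb.coord x I) := by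
    apply hL.coord_unique
    conv_lhs => rw [hb.eq_sum x]
    rw [map_sum]
    exact Finset.sum_congr rfl fun I _ => by rw [map_mul, map_pow, map_monom]
  rw [this]

theorem IsPBasis.theta_map {R L : Type*} [CommRing R] [CharP R p] [CommRing L] [CharP L p]
    (f : R →+* L) {n : ℕ} {t : Fin n → R} (hb : IsPBasis p t)
    (hL : IsPBasis p (fun i => f (t i))) (i : Fin n) (x : R) :
    hL.theta i (f x) = f (hb.theta i x) := by
  rw [theta, theta, diag_apply, diag_apply, map_sum]
  refine Finset.sum_congr rfl fun I _ => ?_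
  rw [hb.coord_map f hL, map_mul, map_mul, map_pow, map_monom, map_natCast]

theorem IsPBasis.proj_map {R L : Type*} [CommRing R] [CharP R p] [CommRing L] [CharP L p]
    (f : R →+* L) {n : ℕ} {t : Fin n → R} (hb : IsPBasis p t)
    (hL : IsPBasis p (fun i => f (t i))) (x : R) :
    hL.proj (f x) = f (hb.proj x) := by
  rw [proj_eq, proj_eq, hb.coord_map f hL, map_pow]

/-- The eigenvalue `I i` is zero unless `t i` occurs in the monomial. This integrality of `∂/∂tᵢ =
θᵢ / tᵢ` controls the poles of the frame `dlog tᵢ`. -/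
theorem IsPBasis.dvd_theta {R : Type*} [CommRing R] [CharP R p] {n : ℕ} {t : Fin n → R}
    (hb : IsPBasis p t) (i : Fin n) (x : R) : t i ∣ hb.theta i x := by
  rw [theta, diag_apply]
  refine Finset.dvd_sum fun I _ => ?_
  rcases hI : (I i : ℕ) with _ | k
  · simp
  · refine Dvd.dvd.mul_left (Dvd.dvd.mul_left ?_ _) _
    exact (dvd_pow_self (t i) (by rw [hI]; exact Nat.succ_ne_zero k)).trans
      (Finset.dvd_prod_of_mem (fun i => t i ^ (I i : ℕ)) (Finset.mem_univ i))

/-- Multiplying a monomial with exponents below `p` by `∏ tᵢ` makes all exponents divisible by `p`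
only if they were all `p - 1`, and then a factor `(∏ tᵢ) ^ p` appears. It cancels the poles in
`trace_integral`. -/
theorem IsPBasis.proj_prod_mul {R : Type*} [CommRing R] [CharP R p] {n : ℕ} {t : Fin n → R}
    (hb : IsPBasis p t) (x : R) : ∃ w, hb.proj ((∏ i, t i) * x) = ((∏ i, t i) * w) ^ p := by
  have hprod : ∏ i, t i = monom t 1 := by simp [monom]
  conv in (_ * x) => rw [hb.eq_sum x]
  rw [Finset.mul_sum, map_sum]
  have hterm : ∀ I : Fin n → Fin p, ∃ w : R,
      hb.proj ((∏ i, t i) * (hb.coord x I ^ p * monom t (fun i => (I i : ℕ)))) =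
        ((∏ i, t i) * w) ^ p := by
    intro I
    rw [mul_left_comm, hprod, ← monom_add, proj_monom]
    split_ifs with h
    · refine ⟨hb.coord x I, ?_⟩
      have : (1 : Fin n → ℕ) + (fun i => (I i : ℕ)) = p • (1 : Fin n → ℕ) := by
        ext i
        have h1 := h i
        have h2 := (I i).2
        simp only [Pi.add_apply, Pi.one_apply, Pi.smul_apply, smul_eq_mul, mul_one] at h1 ⊢
        exact (Nat.le_of_dvd (by omega) h1).antisymm' (by omega)
      rw [this, monom_smul, mul_pow]
      ring
    · exact ⟨0, by simp [hp.out.ne_zero]⟩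
  choose w hw using hterm
  refine ⟨∑ I, w I, ?_⟩
  rw [Finset.mul_sum, sum_pow_char]
  exact Finset.sum_congr rfl fun I _ => hw I

variable {S A R L : Type*} [CommRing S] [CommRing A] [CommRing R] [IsDomain R] [CharP R p]
  [Field L] [CharP L p] [Algebra A R] [Algebra A L] [Algebra R L] [IsScalarTower A R L]
  [IsFractionRing R L]

/-- At a point with a `p`-basis of the local ring, the trace is integral. -/
theorem FrobLiftAlg.trace_integral (F : FrobLiftAlg p S A) {n : ℕ} {t : Fin n → S}
    (hR : IsPBasis p (fun i => algebraMap A R (F.q (t i))))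
    (hb : IsPBasis p (fun i => algebraMap A L (F.q (t i)))) (x : R) :
    ∃ z : R, F.trace hb (algebraMap R L x) = algebraMap R L z ^ p := by
  set tR : Fin n → R := fun i => algebraMap A R (F.q (t i)) with htR
  have htL : ∀ i, algebraMap A L (F.q (t i)) = algebraMap R L (tR i) := fun i =>
    IsScalarTower.algebraMap_apply A R L _
  have hL : IsPBasis p (fun i => algebraMap R L (tR i)) := by
    simpa only [htL] using hb
  have hθ : ∀ i y, hb.theta i (algebraMap R L y) = algebraMap R L (hR.theta i y) := by
    intro i y
    rw [← hR.theta_map (algebraMap R L) hL]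
    congr 2
    simp only [htL]
  have hpr : ∀ y, hb.proj (algebraMap R L y) = algebraMap R L (hR.proj y) := by
    intro y
    rw [← hR.proj_map (algebraMap R L) hL]
    congr 2
    simp only [htL]
  have hz : ∀ j i, ∃ z : R, tR j ^ (p - 1) * hR.theta i (tR j) +
      hR.theta i (algebraMap A R (F.δ (t j))) = tR i * z := fun j i =>
    dvd_add (Dvd.dvd.mul_left (hR.dvd_theta i _) _) (hR.dvd_theta i _)
  choose z hz using hz
  -- Each entry is a multiple of `tR i` divided by `tR j ^ p`; these factors come out of the
  -- determinant along columns and rows.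
  have hdet : F.cartierDet hb = (algebraMap R L (∏ j, tR j))⁻¹ ^ p *
      (algebraMap R L ((∏ i, tR i) * (Matrix.of z).det)) := by
    have h1 : (Matrix.of fun j i => F.cartier (hb.isTwistedDer_theta i) (t j) /
        algebraMap A L (F.q (t j)) ^ p) = Matrix.of fun j i =>
        (algebraMap R L (tR j))⁻¹ ^ p * (Matrix.of (fun j i => algebraMap R L (tR i) *
          ((Matrix.of z).map (algebraMap R L)) j i) j i) := by
      ext j i
      rw [Matrix.of_apply, Matrix.of_apply, Matrix.of_apply, Matrix.map_apply, Matrix.of_apply,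
        cartier_apply, htL, hθ, IsScalarTower.algebraMap_apply A R L, hθ, ← map_pow, ← map_mul,
        ← map_add, hz, map_mul, inv_pow, div_eq_inv_mul]
    rw [cartierDet, h1, Matrix.det_mul_column, Matrix.det_mul_row, Finset.prod_pow,
      Finset.prod_inv_distrib, ← map_prod, map_mul, RingHom.map_det]
    rfl
  obtain ⟨w, hw⟩ := hR.proj_prod_mul ((Matrix.of z).det * x)
  refine ⟨w, ?_⟩
  have h0 : algebraMap R L (∏ j, tR j) ≠ 0 := by
    rw [map_prod]
    exact Finset.prod_ne_zero_iff.2 fun i _ => hL.ne_zero i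
  rw [trace_apply, hdet, mul_left_comm, hb.proj_pow_mul, ← map_mul, hpr,
    show x * ((∏ i, tR i) * (Matrix.of z).det) = (∏ i, tR i) * ((Matrix.of z).det * x) by ring, hw,
    map_pow, map_mul, ← mul_pow, inv_mul_cancel_left₀ h0]

end Integrality

/-! ### Existence of `p`-bases -/

section Existence

/-- A ring is `F`-finite if it is finite over its subring of `p`-th powers. -/
def IsFFinite (p : ℕ) (A : Type*) [CommRing A] : Prop :=
  ∃ (m : ℕ) (g : Fin m → A), ∀ x, ∃ c : Fin m → A, x = ∑ i, c i ^ p * g i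

theorem IsFFinite.of_surjective {p : ℕ} {A B : Type*} [CommRing A] [CommRing B]
    (h : IsFFinite p A) (f : A →+* B) (hf : Function.Surjective f) : IsFFinite p B := by
  obtain ⟨m, g, hg⟩ := h
  refine ⟨m, fun i => f (g i), fun x => ?_⟩
  obtain ⟨x, rfl⟩ := hf x
  obtain ⟨c, hc⟩ := hg x
  exact ⟨fun i => f (c i), by conv_lhs => rw [hc]
                              simp⟩

theorem IsFFinite.of_isLocalization {p : ℕ} [hp : Fact p.Prime] {A : Type*} [CommRing A]
    (h : IsFFinite p A) (M : Submonoid A) (B : Type*) [CommRing B] [Algebra A B]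
    [IsLocalization M B] : IsFFinite p B := by
  obtain ⟨m, g, hg⟩ := h
  refine ⟨m, fun i => algebraMap A B (g i), fun x => ?_⟩
  obtain ⟨a, s, rfl⟩ := IsLocalization.exists_mk'_eq M x
  obtain ⟨c, hc⟩ := hg (a * s ^ (p - 1))
  refine ⟨fun i => IsLocalization.mk' B (c i) s, ?_⟩
  have hs := IsLocalization.map_units B s
  apply (hs.pow p).mul_left_cancel
  have hp1 : p = (p - 1) + 1 := (Nat.sub_add_cancel hp.out.one_le).symm
  have h1 : algebraMap A B s ^ p * IsLocalization.mk' B a s =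
      algebraMap A B (a * s ^ (p - 1)) := by
    conv_lhs => rw [hp1]
    rw [pow_succ, mul_assoc, mul_comm (algebraMap A B s), IsLocalization.mk'_spec, map_mul, map_pow]
    ring
  rw [h1, hc, map_sum, Finset.mul_sum]
  refine Finset.sum_congr rfl fun i _ => ?_
  rw [← mul_assoc, ← mul_pow, mul_comm (algebraMap A B s), IsLocalization.mk'_spec, map_mul,
    map_pow]

variable {p : ℕ} [hp : Fact p.Prime]

section Field

variable {K : Type*} [Field K] [CharP K p]

/-- The subfield of `p`-th powers. -/
abbrev powSubfield (p : ℕ) [Fact p.Prime] (K : Type*) [Field K] [CharP K p] : Subfield K :=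
  (frobenius K p).fieldRange

theorem isPBasis_iff {n : ℕ} (t : Fin n → K) : IsPBasis p t ↔
    LinearIndependent (powSubfield p K) (fun I : Fin n → Fin p => monom t (fun i => (I i : ℕ))) ∧
      ⊤ ≤ Submodule.span (powSubfield p K)
        (Set.range fun I : Fin n → Fin p => monom t (fun i => (I i : ℕ))) := by
  constructor
  · intro hb
    constructor
    · rw [Fintype.linearIndependent_iff]
      intro g hg
      choose c hc using fun I => (g I).2
      have : hb.coord 0 = c := by
        apply hb.coord_unique
        rw [← hg]
        exact Finset.sum_congr rfl fun I _ => by rw [Subfield.smul_def, smul_eq_mul, ← hc]; rfl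
      intro I
      ext
      rw [← hc, ← this, hb.coord_zero]
      simp
    · intro x _
      rw [hb.eq_sum x]
      refine Submodule.sum_mem _ fun I _ => ?_
      exact Submodule.smul_mem _ (⟨hb.coord x I ^ p, hb.coord x I, rfl⟩ : powSubfield p K)
        (Submodule.subset_span ⟨I, rfl⟩)
  · rintro ⟨h1, h2⟩
    apply isPBasis_of_eq_zero
    · intro x
      obtain ⟨g, hg⟩ := (Submodule.mem_span_range_iff_exists_fun _).1 (h2 (Submodule.mem_top (x := x)))
      choose c hc using fun I => (g I).2
      refine ⟨c, ?_⟩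
      rw [← hg]
      exact Finset.sum_congr rfl fun I _ => by rw [Subfield.smul_def, smul_eq_mul, ← hc]; rfl
    · intro c hc
      rw [Fintype.linearIndependent_iff] at h1
      have := h1 (fun I => (⟨c I ^ p, c I, rfl⟩ : powSubfield p K)) hc
      ext I
      have h3 := congrArg Subtype.val (this I)
      exact pow_eq_zero_iff hp.out.ne_zero |>.1 h3

theorem IsPBasis.card_eq {n n' : ℕ} {t : Fin n → K} {t' : Fin n' → K} (hb : IsPBasis p t)
    (hb' : IsPBasis p t') : n = n' := by
  obtain ⟨h1, h2⟩ := (isPBasis_iff t).1 hb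
  obtain ⟨h1', h2'⟩ := (isPBasis_iff t').1 hb'
  have h3 := Module.finrank_eq_card_basis (Module.Basis.mk h1 h2)
  rw [Module.finrank_eq_card_basis (Module.Basis.mk h1' h2')] at h3
  simp only [Fintype.card_pi, Fintype.card_fin, Finset.prod_const, Finset.card_univ] at h3
  exact (Nat.pow_right_injective hp.out.two_le h3).symm

/-- Since `x ^ p ∈ E` but `x ∉ E`, the polynomial `X ^ p - x ^ p` is irreducible over `E`, so the
powers of `x` below `p` are independent over `E`. They are multiplied with the monomials in `t`,
which lie in `E` and are independent over the `p`-th powers. -/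
theorem linearIndependent_monom_cons {n : ℕ} {t : Fin n → K}
    (h : LinearIndependent (powSubfield p K)
      (fun I : Fin n → Fin p => monom t (fun i => (I i : ℕ)))) {x : K}
    (hx : x ∉ IntermediateField.adjoin (powSubfield p K) (Set.range t)) :
    LinearIndependent (powSubfield p K)
      (fun I : Fin (n + 1) → Fin p => monom (Fin.cons x t : Fin (n + 1) → K)
        (fun i => (I i : ℕ))) := by
  set E := IntermediateField.adjoin (powSubfield p K) (Set.range t)
  have hxp : x ^ p ∈ E := E.algebraMap_mem (⟨x ^ p, x, rfl⟩ : powSubfield p K)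
  have hirr : Irreducible (Polynomial.X ^ p - Polynomial.C (⟨x ^ p, hxp⟩ : E)) := by
    apply X_pow_sub_C_irreducible_of_prime hp.out
    intro b hb
    apply hx
    have : (b : K) ^ p = x ^ p := congrArg Subtype.val hb
    rw [← eq_of_pow_char_eq this]
    exact b.2
  have hmin : minpoly E x = Polynomial.X ^ p - Polynomial.C (⟨x ^ p, hxp⟩ : E) := by
    symm
    apply minpoly.eq_of_irreducible_of_monic hirr
    · simp only [map_sub, map_pow, Polynomial.aeval_X, Polynomial.aeval_C]
      exact sub_self _
    · exact Polynomial.monic_X_pow_sub_C _ hp.out.ne_zero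
  have hdeg : (minpoly E x).natDegree = p := by
    rw [hmin, Polynomial.natDegree_X_pow_sub_C]
  have h1 : LinearIndependent E (fun j : Fin p => x ^ (j : ℕ)) := by
    have := linearIndependent_pow (K := E) x
    rwa [hdeg] at this
  let s : Fin n → E := fun i => ⟨t i, IntermediateField.subset_adjoin _ _ ⟨i, rfl⟩⟩
  have h2 : LinearIndependent (powSubfield p K)
      (fun I : Fin n → Fin p => monom s (fun i => (I i : ℕ))) := by
    refine LinearIndependent.of_comp E.val.toLinearMap ?_
    convert! h using 1
    ext I
    exact map_monom (algebraMap E K) s _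
  have h3 := _root_.linearIndependent_smul h2 h1
  let f : (Fin (n + 1) → Fin p) → (Fin n → Fin p) × Fin p := fun I => (Fin.tail I, I 0)
  have hf : Function.Injective f := by
    intro I J hIJ
    rw [← Fin.cons_self_tail I, ← Fin.cons_self_tail J]
    rw [Prod.ext_iff] at hIJ
    rw [show I 0 = J 0 from hIJ.2, show Fin.tail I = Fin.tail J from hIJ.1]
  convert! h3.comp f hf using 1
  ext I
  simp only [Function.comp_apply, monom, Fin.prod_univ_succ, Fin.cons_zero, Fin.cons_succ, f]
  rw [mul_comm, IntermediateField.smul_def, smul_eq_mul]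
  congr 1
  simp [s, Fin.tail]

/-- Take a longest family with independent monomials: lengths are bounded because `p ^ n` cannot
exceed the degree of `K` over its `p`-th powers. An element outside the field generated by the
family would lengthen it, and that field is spanned by the monomials. -/
theorem exists_isPBasis_field (h : IsFFinite p K) : ∃ (n : ℕ) (t : Fin n → K), IsPBasis p t := by
  obtain ⟨m, g, hg⟩ := h
  classical
  have hfin : Module.Finite (powSubfield p K) K := by
    refine ⟨⟨Finset.univ.image g, ?_⟩⟩
    rw [eq_top_iff]
    intro x _
    obtain ⟨c, hc⟩ := hg x
    rw [hc]
    refine Submodule.sum_mem _ fun i _ => ?_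
    exact Submodule.smul_mem _ (⟨c i ^ p, c i, rfl⟩ : powSubfield p K)
      (Submodule.subset_span (by simp))
  let P : ℕ → Prop := fun n => ∃ t : Fin n → K, LinearIndependent (powSubfield p K)
    (fun I : Fin n → Fin p => monom t (fun i => (I i : ℕ)))
  have hbound : ∀ n, P n → n ≤ Module.finrank (powSubfield p K) K := by
    rintro n ⟨t, ht⟩
    have := ht.fintype_card_le_finrank
    simp only [Fintype.card_pi, Fintype.card_fin, Finset.prod_const, Finset.card_univ] at this
    exact (Nat.lt_pow_self hp.out.one_lt).le.trans this
  have h0 : P 0 := by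
    refine ⟨Fin.elim0, ?_⟩
    rw [linearIndependent_unique_iff]
    simp [monom]
  obtain ⟨t, ht⟩ := Nat.findGreatest_spec (P := P) (Nat.zero_le _) h0
  refine ⟨_, t, (isPBasis_iff t).2 ⟨ht, ?_⟩⟩
  by_contra hspan
  have hne : ∃ x, x ∉ IntermediateField.adjoin (powSubfield p K) (Set.range t) := by
    by_contra! hall
    apply hspan
    intro x _
    have hx := hall x
    rw [← IntermediateField.mem_toSubalgebra, IntermediateField.adjoin_toSubalgebra,
      ← Subalgebra.mem_toSubmodule, Algebra.adjoin_eq_span] at hx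
    refine Submodule.span_le.2 ?_ hx
    intro y hy
    have hm : ∃ m : _ → ℕ, y = monom t m := by
      induction hy using Submonoid.closure_induction with
      | mem x hx => obtain ⟨i, rfl⟩ := hx; exact ⟨_, (monom_pi_single t i).symm⟩
      | one => exact ⟨0, (monom_zero t).symm⟩
      | mul x y _ _ hx hy =>
        obtain ⟨a, rfl⟩ := hx
        obtain ⟨b, rfl⟩ := hy
        exact ⟨a + b, (monom_add t a b).symm⟩
    obtain ⟨m, rfl⟩ := hm
    rw [monom_eq_redExp (p := p)]
    exact Submodule.smul_mem _ (⟨_ ^ p, _, rfl⟩ : powSubfield p K)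
      (Submodule.subset_span ⟨_, rfl⟩)
  obtain ⟨x, hx⟩ := hne
  have h1 : P (Nat.findGreatest P (Module.finrank (powSubfield p K) K) + 1) :=
    ⟨_, linearIndependent_monom_cons ht hx⟩
  have := Nat.le_findGreatest (hbound _ h1) h1
  omega

end Field

end Existence

end

/-! ### `p`-bases of local rings with principal maximal ideal. -/

section

section LocalPBasis

variable {p : ℕ} [hp : Fact p.Prime]

open IsLocalRing

/-- Serves to clear the denominators of a `p`-basis of a localization: `s ^ p * (a / s) = a * s ^ (p
- 1)`. -/
theorem IsPBasis.smul_units {R : Type*} [CommRing R] {n : ℕ} {t : Fin n → R} (hb : IsPBasis p t)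
    (u : Fin n → Rˣ) : IsPBasis p (fun i => (u i : R) ^ p * t i) := by
  have hm : ∀ m : Fin n → ℕ, monom (fun i => (u i : R) ^ p * t i) m =
      ((∏ i, u i ^ m i : Rˣ) : R) ^ p * monom t m := by
    intro m
    simp only [monom, mul_pow, Finset.prod_mul_distrib, Units.coe_prod, Units.val_pow_eq_pow_val,
      ← Finset.prod_pow, ← pow_mul, mul_comm p]
  intro x
  refine ⟨fun I => ((∏ i, u i ^ (I i : ℕ) : Rˣ)⁻¹ : Rˣ) * hb.coord x I, ?_, ?_⟩
  · refine (hb.eq_sum x).trans (Finset.sum_congr rfl fun I _ => ?_)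
    rw [hm, mul_pow, ← mul_assoc, mul_right_comm (_ ^ p) (_ ^ p), ← mul_pow, Units.inv_mul, one_pow,
      one_mul]
  · intro c hc
    have : hb.coord x = fun I => c I * (∏ i, u i ^ (I i : ℕ) : Rˣ) := by
      apply hb.coord_unique
      rw [hc]
      exact Finset.sum_congr rfl fun I _ => by rw [hm, mul_pow, mul_assoc]
    ext I
    simp only [this]
    rw [mul_comm (c I), Units.inv_mul_cancel_left]

variable {R : Type*} [CommRing R] [IsDomain R] [CharP R p]

theorem sum_monom_cons {m : ℕ} (π : R) (s : Fin m → R) (c : (Fin (m + 1) → Fin p) → R) :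
    ∑ I, c I ^ p * monom (Fin.cons π s : Fin (m + 1) → R) (fun i => (I i : ℕ)) =
      ∑ j : Fin p, π ^ (j : ℕ) * ∑ I : Fin m → Fin p,
        c (Fin.cons j I) ^ p * monom s (fun i => (I i : ℕ)) := by
  rw [← (Fin.consEquiv fun _ => Fin p).sum_comp, Fintype.sum_prod_type]
  refine Finset.sum_congr rfl fun j _ => ?_
  rw [Finset.mul_sum]
  refine Finset.sum_congr rfl fun I _ => ?_
  change c (Fin.cons j I) ^ p * _ = _
  simp only [Fin.consEquiv_apply, monom, Fin.prod_univ_succ, Fin.cons_zero, Fin.cons_succ]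
  ring

variable [IsLocalRing R]

/-- Induction on the exponent `k < p` of `π`, working modulo `π ^ (k + 1)`. Terms with smaller
exponent have coefficients divisible by `π`, so contribute multiples of `π ^ p`; terms with larger
exponent vanish. Dividing the rest by `π ^ k` leaves a relation in the residue field. -/
theorem dvd_coeff_of_sum_eq_zero [CharP (ResidueField R) p] {π : R} (hπ : maximalIdeal R = Ideal.span {π}) (hπ0 : π ≠ 0)
    {m : ℕ} {s : Fin m → R} (hs : IsPBasis p (fun i => IsLocalRing.residue R (s i)))
    (c : (Fin (m + 1) → Fin p) → R)
    (hc : ∑ I, c I ^ p * monom (Fin.cons π s : Fin (m + 1) → R) (fun i => (I i : ℕ)) = 0)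
    (I : Fin (m + 1) → Fin p) : π ∣ c I := by
  rw [sum_monom_cons] at hc
  have hdvd : ∀ x : R, IsLocalRing.residue R x = 0 ↔ π ∣ x := fun x => by
    rw [residue_eq_zero_iff, hπ, Ideal.mem_span_singleton]
  have key : ∀ (k : ℕ) (hk : k < p) (I : Fin m → Fin p), π ∣ c (Fin.cons ⟨k, hk⟩ I) := by
    intro k
    induction k using Nat.strong_induction_on with
    | _ k ih =>
      intro hk I
      have h1 : π ^ (k + 1) ∣ π ^ k * ∑ I : Fin m → Fin p,
          c (Fin.cons ⟨k, hk⟩ I) ^ p * monom s (fun i => (I i : ℕ)) := by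
        rw [← Finset.add_sum_erase _ _ (Finset.mem_univ (⟨k, hk⟩ : Fin p))] at hc
        rw [eq_neg_of_add_eq_zero_left hc]
        rw [dvd_neg]
        refine Finset.dvd_sum fun j hj => ?_
        rcases lt_trichotomy (j : ℕ) k with hjk | hjk | hjk
        · refine Dvd.dvd.mul_left (Finset.dvd_sum fun I _ => Dvd.dvd.mul_right ?_ _) _
          exact (pow_dvd_pow _ (by omega)).trans (pow_dvd_pow_of_dvd (ih j hjk j.2 I) p)
        · exact absurd (Fin.ext hjk) (Finset.ne_of_mem_erase hj)
        · exact Dvd.dvd.mul_right (pow_dvd_pow _ hjk) _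
      rw [pow_succ] at h1
      have h2 := (hdvd _).2 ((mul_dvd_mul_iff_left (pow_ne_zero _ hπ0)).1 h1)
      rw [map_sum] at h2
      rw [← hdvd]
      have h3 : hs.coord 0 = fun I => IsLocalRing.residue R (c (Fin.cons ⟨k, hk⟩ I)) := by
        apply hs.coord_unique
        rw [← h2]
        exact Finset.sum_congr rfl fun I _ => by rw [map_mul, map_pow, map_monom]
      rw [hs.coord_zero] at h3
      exact (congrFun h3 I).symm
  have := key (I 0) (I 0).2 (Fin.tail I)
  rwa [Fin.eta, Fin.cons_self_tail] at this

/-- A `π`-adic expansion whose digits are combinations of the monomials in `s`. For `k = p` the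
remainder is a multiple of `π ^ p`, as needed for Nakayama over the ring of `p`-th powers. -/
theorem exists_sum_add_pow_mul {π : R} (hπ : maximalIdeal R = Ideal.span {π}) {m : ℕ}
    {s : Fin m → R} (hs : IsPBasis p (fun i => IsLocalRing.residue R (s i))) (x : R) (k : ℕ) :
    ∃ (c : ℕ → (Fin m → Fin p) → R) (y : R),
      x = ∑ j ∈ Finset.range k, π ^ j * ∑ I, c j I ^ p * monom s (fun i => (I i : ℕ)) +
        π ^ k * y := by
  induction k with
  | zero => exact ⟨0, x, by simp⟩
  | succ k ih =>
    obtain ⟨c, y, h⟩ := ih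
    choose d hd using fun I => residue_surjective (hs.coord (IsLocalRing.residue R y) I)
    have h1  : IsLocalRing.residue R (y - ∑ I, d I ^ p * monom s (fun i => (I i : ℕ))) = 0 := by
      rw [map_sub, sub_eq_zero]
      conv_lhs => rw [hs.eq_sum (IsLocalRing.residue R y)]
      rw [map_sum]
      exact Finset.sum_congr rfl fun I _ => by rw [map_mul, map_pow, map_monom, hd]
    rw [residue_eq_zero_iff, hπ, Ideal.mem_span_singleton] at h1
    obtain ⟨z, hz⟩ := h1
    refine ⟨fun j => if j = k then d else c j, z, ?_⟩
    simp only [Finset.sum_range_succ, if_true]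
    rw [pow_succ, mul_assoc, ← hz, add_assoc, ← mul_add, add_sub_cancel, h]
    congr 1
    refine Finset.sum_congr rfl fun j hj => ?_
    rw [if_neg (Finset.mem_range.1 hj).ne]

/-- A noetherian local domain with principal maximal ideal has a `p`-basis if it is `F`-finite. -/
theorem exists_isPBasis_of_principal [IsNoetherianRing R] (hF : IsFFinite p R) {π : R}
    (hπ : maximalIdeal R = Ideal.span {π}) (hπ0 : π ≠ 0) :
    ∃ (n : ℕ) (t : Fin n → R), IsPBasis p t := by
  have : CharP (ResidueField R) p := by
    refine (CharP.charP_iff_prime_eq_zero hp.out).2 ?_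
    rw [← map_natCast (IsLocalRing.residue R), CharP.cast_eq_zero, map_zero]
  obtain ⟨m, sb, hs⟩ := exists_isPBasis_field (hF.of_surjective _ residue_surjective)
  choose s hs' using fun i => residue_surjective (sb i)
  obtain rfl : (fun i => IsLocalRing.residue R (s i)) = sb := funext hs'
  have hπm : π ∈ maximalIdeal R := hπ ▸ Ideal.mem_span_singleton_self π
  refine ⟨m + 1, Fin.cons π s, isPBasis_of_eq_zero ?_ ?_⟩
  · let R' := (frobenius R p).range
    have hloc : IsLocalRing R' := IsLocalRing.of_surjective' (frobenius R p).rangeRestrict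
      (frobenius R p).rangeRestrict_surjective
    let W : Submodule R' R := Submodule.span R'
      (Set.range fun I : Fin (m + 1) → Fin p =>
        monom (Fin.cons π s : Fin (m + 1) → R) (fun i => (I i : ℕ)))
    have hmem : ∀ c : (Fin (m + 1) → Fin p) → R,
        ∑ I, c I ^ p * monom (Fin.cons π s : Fin (m + 1) → R) (fun i => (I i : ℕ)) ∈ W := by
      intro c
      refine Submodule.sum_mem _ fun I _ => ?_
      exact Submodule.smul_mem _ (⟨c I ^ p, c I, rfl⟩ : R') (Submodule.subset_span ⟨I, rfl⟩)
    have hW : (⊤ : Submodule R' R) ≤ W := by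
      obtain ⟨N, g, hg⟩ := hF
      let πp : R' := ⟨π ^ p, π, rfl⟩
      -- Nakayama over the local ring `R'` of `p`-th powers, over which `R` is finite, with the
      -- ideal generated by `π ^ p`.
      refine Submodule.le_of_le_smul_of_le_jacobson_bot (I := Ideal.span {πp}) ?_ ?_ ?_
      · classical
        refine ⟨Finset.univ.image g, ?_⟩
        rw [eq_top_iff]
        intro x _
        obtain ⟨c, hc⟩ := hg x
        rw [hc]
        refine Submodule.sum_mem _ fun i _ => ?_
        exact Submodule.smul_mem _ (⟨c i ^ p, c i, rfl⟩ : R') (Submodule.subset_span (by simp))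
      · rw [IsLocalRing.jacobson_eq_maximalIdeal _ bot_ne_top, Ideal.span_singleton_le_iff_mem,
          mem_maximalIdeal, mem_nonunits_iff]
        intro h
        have h1 := (h.map R'.subtype)
        change IsUnit (π ^ p) at h1
        exact (mem_maximalIdeal _).1 hπm ((isUnit_pow_iff hp.out.ne_zero).1 h1)
      · intro x _
        obtain ⟨c, y, h⟩ := exists_sum_add_pow_mul hπ hs x p
        rw [h]
        refine Submodule.add_mem_sup ?_ ?_
        · have := hmem fun I => c (I 0) (Fin.tail I)
          rw [sum_monom_cons] at this
          simpa only [Fin.cons_zero, Fin.tail_cons, Finset.sum_range] using this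
        · exact Submodule.smul_mem_smul (Ideal.mem_span_singleton_self πp) (Submodule.mem_top (x := y))
    intro x
    obtain ⟨g, hg⟩ := (Submodule.mem_span_range_iff_exists_fun _).1 (hW (Submodule.mem_top (x := x)))
    choose c hc using fun I => (g I).2
    refine ⟨c, ?_⟩
    rw [← hg]
    exact Finset.sum_congr rfl fun I _ => by rw [Subring.smul_def, smul_eq_mul, ← hc]; rfl
  -- The coefficients of a relation are divisible by `π`, and the quotients satisfy the same
  -- relation. Repeating this makes every coefficient infinitely divisible by `π`, hence zero.
  · have key : ∀ (k : ℕ) (c : (Fin (m + 1) → Fin p) → R),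
        ∑ I, c I ^ p * monom (Fin.cons π s : Fin (m + 1) → R) (fun i => (I i : ℕ)) = 0 →
        ∀ I, π ^ k ∣ c I := by
      intro k
      induction k with
      | zero => simp
      | succ k ih =>
        intro c hc I
        choose d hd using dvd_coeff_of_sum_eq_zero hπ hπ0 hs c hc
        rw [hd, pow_succ']
        refine mul_dvd_mul_left π (ih d ?_ I)
        refine (mul_eq_zero_iff_left (pow_ne_zero p hπ0)).1 ?_
        rw [← hc, Finset.mul_sum]
        exact Finset.sum_congr rfl fun J _ => by rw [hd J, mul_pow, mul_assoc]
    intro c hc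
    ext I
    by_contra hne
    obtain ⟨k, hk⟩ := FiniteMultiplicity.of_not_isUnit (a := π) (b := c I)
      ((mem_maximalIdeal _).1 hπm) hne
    exact hk (key (k + 1) c hc I)

end LocalPBasis

/-! ### The Frobenius splitting of a normal domain -/

section Splitting

variable {p : ℕ} [hp : Fact p.Prime]

/-- In a noetherian normal local domain, the maximal ideal is principal if it is carried into the
ring by a non-integral element of the fraction field. -/
theorem exists_maximalIdeal_eq_span {R L : Type*} [CommRing R] [IsDomain R] [IsNoetherianRing R]
    [IsLocalRing R] [IsIntegrallyClosed R] [Field L] [Algebra R L] [IsFractionRing R L] (z : L)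
    (hz : ∀ a, algebraMap R L a ≠ z) (hmax : IsLocalRing.maximalIdeal R ≠ ⊥)
    (hmz : ∀ r ∈ IsLocalRing.maximalIdeal R, ∃ b, algebraMap R L b = algebraMap R L r * z) :
    ∃ π : R, π ≠ 0 ∧ IsLocalRing.maximalIdeal R = Ideal.span {π} := by
  have hinj := IsFractionRing.injective R L
  -- Were `r * z` never a unit, `z` would map the finitely generated nonzero maximal ideal into
  -- itself, so it would be integral and lie in `R`. Once `r * z` is a unit, `r` generates the
  -- maximal ideal.
  obtain ⟨r, hr, u, hu, hur⟩ : ∃ r ∈ IsLocalRing.maximalIdeal R, ∃ u : R, IsUnit u ∧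
      algebraMap R L u = algebraMap R L r * z := by
    by_contra! hcon
    have hint : IsIntegral R z := by
      refine isIntegral_of_smul_mem_submodule (M := L)
        (Submodule.map (Algebra.linearMap R L) (IsLocalRing.maximalIdeal R)) ?_ ?_ z ?_
      · obtain ⟨r, hr, hr0⟩ := (Submodule.ne_bot_iff _).1 hmax
        exact (Submodule.ne_bot_iff _).2
          ⟨algebraMap R L r, ⟨r, hr, rfl⟩, (map_ne_zero_iff _ hinj).2 hr0⟩
      · exact (IsNoetherian.noetherian (IsLocalRing.maximalIdeal R)).map _
      · rintro _ ⟨r, hr, rfl⟩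
        obtain ⟨b, hb⟩ := hmz r hr
        refine ⟨b, ?_, ?_⟩
        · by_contra hb'
          refine hcon r hr b ?_ hb
          by_contra hb2
          exact hb' ((IsLocalRing.mem_maximalIdeal _).2 hb2)
        · rw [smul_eq_mul, mul_comm]
          exact hb
    obtain ⟨a, ha⟩ := (IsIntegrallyClosed.isIntegral_iff (R := R)).1 hint
    exact hz a ha
  have hu0 : algebraMap R L u ≠ 0 := (map_ne_zero_iff _ hinj).2 hu.ne_zero
  have hr0 : r ≠ 0 := by
    rintro rfl
    rw [map_zero, zero_mul] at hur
    exact hu0 hur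
  refine ⟨r, hr0, le_antisymm (fun s hs => ?_) ((Ideal.span_singleton_le_iff_mem _).2 hr)⟩
  obtain ⟨b, hb⟩ := hmz s hs
  rw [Ideal.mem_span_singleton, ← hu.dvd_mul_right]
  refine ⟨b, hinj ?_⟩
  rw [map_mul, map_mul, hb, hur]
  ring

/-- An element of the fraction field of a noetherian normal domain which is not integral
is not integral at some prime with principal nonzero maximal ideal. -/
theorem exists_prime_principal {A L : Type*} [CommRing A] [IsDomain A] [IsNoetherianRing A]
    [IsIntegrallyClosed A] [Field L] [Algebra A L] [IsFractionRing A L] (y : L)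
    (hy : ∀ a, algebraMap A L a ≠ y) :
    ∃ (P : Ideal A) (_ : P.IsPrime), (∀ a s : A, algebraMap A L a = algebraMap A L s * y → s ∈ P) ∧
      ∃ π : Localization.AtPrime P, π ≠ 0 ∧
        IsLocalRing.maximalIdeal (Localization.AtPrime P) = Ideal.span {π} := by
  have hinj := IsFractionRing.injective A L
  -- Non-integrality of `y` is a nonzero class in `L ⧸ A`. An associated prime `P` containing its
  -- annihilator is itself the annihilator of a class `z`, so `P z ⊆ A` while `z` is not in the
  -- local ring at `P`.
  let N : Submodule A L := LinearMap.range (Algebra.linearMap A L)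
  have hy0 : N.mkQ y ≠ 0 := by
    rw [Ne, Submodule.mkQ_apply, Submodule.Quotient.mk_eq_zero]
    rintro ⟨a, ha⟩
    exact hy a ha
  obtain ⟨P, hP, hle⟩ := exists_le_isAssociatedPrime_of_isNoetherianRing A _ hy0
  obtain ⟨hprime, z', hz'⟩ := isAssociatedPrime_iff.1 hP
  obtain ⟨z, rfl⟩ := N.mkQ_surjective z'
  have hmemN : ∀ (s : A) (w : L), s ∈ (⊥ : Submodule A (L ⧸ N)).colon {N.mkQ w} ↔
      ∃ a, algebraMap A L a = algebraMap A L s * w := by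
    intro s w
    rw [Submodule.mem_colon_singleton, Submodule.mem_bot, ← map_smul, Submodule.mkQ_apply,
      Submodule.Quotient.mk_eq_zero, Algebra.smul_def]
    rfl
  have hsy : ∀ a s : A, algebraMap A L a = algebraMap A L s * y → s ∈ P := fun a s h =>
    hle ((hmemN s y).2 ⟨a, h⟩)
  refine ⟨P, hprime, hsy, ?_⟩
  have hle0 : P.primeCompl ≤ nonZeroDivisors A := by
    intro a ha
    rw [mem_nonZeroDivisors_iff_ne_zero]
    exact fun h => ha (h.symm ▸ P.zero_mem)
  let := IsLocalization.localizationAlgebraOfSubmonoidLe (Localization.AtPrime P) L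
    P.primeCompl (nonZeroDivisors A) hle0
  have := IsLocalization.localization_isScalarTower_of_submonoid_le (Localization.AtPrime P) L
    P.primeCompl (nonZeroDivisors A) hle0
  have : IsDomain (Localization.AtPrime P) := IsLocalization.isDomain_localization hle0
  have : IsFractionRing (Localization.AtPrime P) L :=
    IsFractionRing.isFractionRing_of_isDomain_of_isLocalization P.primeCompl _ _
  have : IsIntegrallyClosed (Localization.AtPrime P) :=
    isIntegrallyClosed_of_isLocalization _ P.primeCompl hle0
  have : IsNoetherianRing (Localization.AtPrime P) :=
    IsLocalization.isNoetherianRing P.primeCompl _ inferInstance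
  have hsurj : ∀ r : Localization.AtPrime P, ∃ a s : A, s ∉ P ∧
      algebraMap A L s * algebraMap (Localization.AtPrime P) L r = algebraMap A L a ∧
      (r ∈ IsLocalRing.maximalIdeal (Localization.AtPrime P) → a ∈ P) := by
    intro r
    obtain ⟨a, s, rfl⟩ := IsLocalization.exists_mk'_eq P.primeCompl r
    refine ⟨a, s, s.2, ?_, ?_⟩
    · rw [IsScalarTower.algebraMap_apply A (Localization.AtPrime P) L, ← map_mul, mul_comm,
        IsLocalization.mk'_spec, ← IsScalarTower.algebraMap_apply]
    · intro h
      exact (IsLocalization.AtPrime.mk'_mem_maximal_iff _ P a s).1 h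
  have hunit : ∀ s ∉ P, IsUnit (algebraMap A (Localization.AtPrime P) s) := fun s hs =>
    IsLocalization.map_units (M := P.primeCompl) _ ⟨s, hs⟩
  refine exists_maximalIdeal_eq_span z ?_ ?_ ?_
  · intro r hr
    obtain ⟨a, s, hs, h, -⟩ := hsurj r
    refine hs ?_
    rw [hz', hmemN]
    exact ⟨a, by rw [← hr, h]⟩
  · intro hbot
    have hfield := IsLocalRing.isField_iff_maximalIdeal_eq.2 hbot
    have hP : ∀ s : A, s ≠ 0 → s ∉ P := by
      intro s hs hsP
      have h1 := (IsLocalization.AtPrime.to_map_mem_maximal_iff (Localization.AtPrime P) P s).2 hsP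
      rw [hbot, Submodule.mem_bot] at h1
      exact hs (IsLocalization.injective _ hle0 (h1.trans (map_zero _).symm))
    obtain ⟨a, s, hs, rfl⟩ := IsFractionRing.div_surjective (A := A) y
    have hs0 := nonZeroDivisors.ne_zero hs
    refine hP s hs0 (hsy a s ?_)
    rw [mul_div_cancel₀]
    exact (map_ne_zero_iff _ hinj).2 hs0
  · intro r hr
    obtain ⟨a, s, hs, h, ha⟩ := hsurj r
    have haP := ha hr
    rw [hz', hmemN] at haP
    obtain ⟨b, hb⟩ := haP
    obtain ⟨u, hu⟩ := hunit s hs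
    refine ⟨(u⁻¹ : (Localization.AtPrime P)ˣ) * algebraMap A _ b, ?_⟩
    have h0 : algebraMap A L s ≠ 0 := by
      rw [IsScalarTower.algebraMap_apply A (Localization.AtPrime P) L]
      exact ((hunit s hs).map (algebraMap _ L)).ne_zero
    apply mul_left_cancel₀ h0
    rw [← mul_assoc, h, ← hb]
    conv_lhs => rw [IsScalarTower.algebraMap_apply A (Localization.AtPrime P) L, ← map_mul, ← hu,
      Units.mul_inv_cancel_left, ← IsScalarTower.algebraMap_apply]

variable {S A : Type*} [CommRing S] [CommRing A] (F : FrobLiftAlg p S A)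

/-- A `p`-basis of a localization can be chosen to consist of elements of the ring. -/
theorem FrobLiftAlg.exists_isPBasis_of_isLocalization (M : Submonoid A) (R : Type*) [CommRing R]
    [Algebra A R] [IsLocalization M R] (h : ∃ (n : ℕ) (t : Fin n → R), IsPBasis p t) :
    ∃ (n : ℕ) (t : Fin n → S), IsPBasis p (fun i => algebraMap A R (F.q (t i))) := by
  obtain ⟨n, t, hb⟩ := h
  choose a s hs using fun i => IsLocalization.exists_mk'_eq M (t i)
  choose t' ht' using fun i => F.surj (a i * (s i : A) ^ (p - 1))
  refine ⟨n, t', ?_⟩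
  convert hb.smul_units (fun i => (IsLocalization.map_units R (s i)).unit) using 2 with i
  have hp1 : p = (p - 1) + 1 := (Nat.sub_add_cancel hp.out.one_le).symm
  rw [ht', ← hs i, IsUnit.unit_spec, map_mul, map_pow]
  conv_rhs => rw [hp1]
  rw [pow_succ, mul_assoc, mul_comm (algebraMap A R (s i)), IsLocalization.mk'_spec]
  ring

theorem FrobLiftAlg.exists_isPBasis (M : Submonoid A) (L : Type*) [Field L]
    [CharP L p] [Algebra A L] [IsLocalization M L] (hF : IsFFinite p L) :
    ∃ (n : ℕ) (t : Fin n → S), IsPBasis p (fun i => algebraMap A L (F.q (t i))) :=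
  F.exists_isPBasis_of_isLocalization M L (exists_isPBasis_field hF)

/-- The trace of a Frobenius lifting is integral at a normal local ring. -/
theorem FrobLiftAlg.exists_trace_eq_algebraMap_pow (Q : Ideal A) [Q.IsPrime]
    (R : Type*) [CommRing R] [Algebra A R] [IsLocalization.AtPrime R Q] [IsDomain R]
    [IsNoetherianRing R] [IsIntegrallyClosed R] (hF : IsFFinite p R) (T : Submonoid A) (L : Type*) [Field L]
    [CharP L p] [Algebra A L] [IsLocalization T L] [Algebra R L] [IsScalarTower A R L]
    [IsFractionRing R L] {n : ℕ} {t : Fin n → S}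
    (hb : IsPBasis p (fun i => algebraMap A L (F.q (t i)))) (x : R) :
    ∃ z : R, F.trace hb (algebraMap R L x) = algebraMap R L z ^ p := by
  obtain ⟨y, hy⟩ := exists_trace_eq_pow hb (algebraMap R L x)
  by_contra! hcon
  -- At `P` the maximal ideal is principal, so a `p`-basis exists there and the trace computed with
  -- it is integral. By `trace_eq` it is the same trace, which places `y` in the local ring at `P`,
  -- a contradiction.
  obtain ⟨P, hprime, hsy, π, hπ0, hπ⟩ := exists_prime_principal (A := R) y
    (fun a ha => hcon a (by rw [hy, ha]))
  have hle0 : P.primeCompl ≤ nonZeroDivisors R := by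
    intro a ha
    rw [mem_nonZeroDivisors_iff_ne_zero]
    exact fun h => ha (h.symm ▸ P.zero_mem)
  let := IsLocalization.localizationAlgebraOfSubmonoidLe (Localization.AtPrime P) L
    P.primeCompl (nonZeroDivisors R) hle0
  have := IsLocalization.localization_isScalarTower_of_submonoid_le (Localization.AtPrime P) L
    P.primeCompl (nonZeroDivisors R) hle0
  have : IsDomain (Localization.AtPrime P) := IsLocalization.isDomain_localization hle0
  have : IsFractionRing (Localization.AtPrime P) L :=
    IsFractionRing.isFractionRing_of_isDomain_of_isLocalization P.primeCompl _ _
  have : IsNoetherianRing (Localization.AtPrime P) :=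
    IsLocalization.isNoetherianRing P.primeCompl _ inferInstance
  have : CharP (Localization.AtPrime P) p :=
    (RingHom.charP_iff (algebraMap _ L) (IsFractionRing.injective _ L) p).2 inferInstance
  have : IsScalarTower A (Localization.AtPrime P) L := by
    refine IsScalarTower.of_algebraMap_eq fun a => ?_
    rw [IsScalarTower.algebraMap_apply A R L, IsScalarTower.algebraMap_apply A R
      (Localization.AtPrime P), ← IsScalarTower.algebraMap_apply R (Localization.AtPrime P) L]
  have : IsLocalization.AtPrime (Localization.AtPrime P) (P.comap (algebraMap A R)) :=
    IsLocalization.isLocalization_isLocalization_atPrime_isLocalization Q.primeCompl _ P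
  obtain ⟨n', t', hbR⟩ := F.exists_isPBasis_of_isLocalization (P.comap (algebraMap A R)).primeCompl
    (Localization.AtPrime P)
    (exists_isPBasis_of_principal (hF.of_isLocalization P.primeCompl _)
      hπ hπ0)
  have hb' : IsPBasis p (fun i => algebraMap A L (F.q (t' i))) := by
    simpa only [← IsScalarTower.algebraMap_apply] using hbR.map_algebraMap L
  obtain rfl := hb'.card_eq hb
  obtain ⟨z, hz⟩ := F.trace_integral hbR hb' (algebraMap R _ x)
  rw [← IsScalarTower.algebraMap_apply, F.trace_eq T hb' hb, hy] at hz
  have hyz := eq_of_pow_char_eq hz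
  obtain ⟨a, s, rfl⟩ := IsLocalization.exists_mk'_eq P.primeCompl z
  refine s.2 (hsy a s ?_)
  rw [hyz, IsScalarTower.algebraMap_apply R (Localization.AtPrime P) L,
    IsScalarTower.algebraMap_apply R (Localization.AtPrime P) L, ← map_mul, mul_comm,
    IsLocalization.mk'_spec]

end Splitting

end

section

open IsLocalRing

variable {p : ℕ} [hp : Fact p.Prime]

/-! ### Functoriality of the trace -/

section Functoriality

variable {S A S' A' : Type*} [CommRing S] [CommRing A] [CommRing S'] [CommRing A']

/-- A pair of ring homomorphisms compatible with two Frobenius liftings. -/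
structure FrobLiftAlg.IsHom (F : FrobLiftAlg p S A) (F' : FrobLiftAlg p S' A') (r : S →+* S')
    (rb : A →+* A') : Prop where
  q : ∀ x, F'.q (r x) = rb (F.q x)
  φ : ∀ x, F'.φ (r x) = r (F.φ x)

variable {F : FrobLiftAlg p S A} {F' : FrobLiftAlg p S' A'} {r : S →+* S'} {rb : A →+* A'}

theorem FrobLiftAlg.IsHom.δ (h : F.IsHom F' r rb) (x : S) : F'.δ (r x) = rb (F.δ x) := by
  obtain ⟨y, hy⟩ := F.surj (F.δ x)
  rw [← hy, ← h.q]
  apply F'.δ_eq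
  rw [h.φ, F.δ_spec hy, map_add, map_pow, map_mul, map_natCast]

theorem FrobLiftAlg.IsHom.map_trace (h : F.IsHom F' r rb) {L L' : Type*} [Field L] [Field L']
    [CharP L p] [CharP L' p] [Algebra A L] [Algebra A' L'] (e : L →+* L')
    (he : ∀ a, e (algebraMap A L a) = algebraMap A' L' (rb a)) {n : ℕ} {t : Fin n → S}
    (hb : IsPBasis p (fun i => algebraMap A L (F.q (t i))))
    (hb' : IsPBasis p (fun i => algebraMap A' L' (F'.q (r (t i))))) (x : L) :
    F'.trace hb' (e x) = e (F.trace hb x) := by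
  have htL : ∀ i, algebraMap A' L' (F'.q (r (t i))) = e (algebraMap A L (F.q (t i))) := fun i => by
    rw [he, h.q]
  have hL : IsPBasis p (fun i => e (algebraMap A L (F.q (t i)))) := by
    simpa only [htL] using hb'
  have hθ : ∀ i y, hb'.theta i (e y) = e (hb.theta i y) := by
    intro i y
    rw [← hb.theta_map e hL]
    congr 2
    simp only [htL]
  have hpr : ∀ y, hb'.proj (e y) = e (hb.proj y) := by
    intro y
    rw [← hb.proj_map e hL]
    congr 2
    simp only [htL]
  have hdet : F'.cartierDet hb' = e (F.cartierDet hb) := by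
    rw [cartierDet, cartierDet, RingHom.map_det]
    congr 1
    ext j i
    rw [Matrix.of_apply, RingHom.mapMatrix_apply, Matrix.map_apply, Matrix.of_apply, cartier_apply,
      cartier_apply, h.δ, htL, ← he, hθ, hθ, map_div₀, map_add, map_mul, map_pow, map_pow]
  rw [trace_apply, trace_apply, hdet, ← map_mul, hpr]

theorem FrobLiftAlg.isHom_id (F : FrobLiftAlg p S A) :
    F.IsHom F (RingHom.id S) (RingHom.id A) := ⟨fun _ => rfl, fun _ => rfl⟩

end Functoriality

theorem IsPBasis.map_ringEquiv {R L : Type*} [CommRing R] [CommRing L] {n : ℕ} {t : Fin n → R}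
    (hb : IsPBasis p t) (e : R ≃+* L) : IsPBasis p (fun i => e (t i)) := by
  intro x
  have key : ∀ c : (Fin n → Fin p) → L,
      e (∑ I, e.symm (c I) ^ p * monom t (fun i => (I i : ℕ))) =
      ∑ I, c I ^ p * monom (fun i => e (t i)) (fun i => (I i : ℕ)) := by
    intro c
    rw [map_sum]
    refine Finset.sum_congr rfl fun I _ => ?_
    rw [map_mul, map_pow, e.apply_symm_apply]
    exact congrArg _ (map_monom (e : R →+* L) t _)
  refine ⟨fun I => e (hb.coord (e.symm x) I), ?_, ?_⟩
  · beta_reduce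
    rw [← key]
    simp only [e.symm_apply_apply]
    rw [← hb.eq_sum, e.apply_symm_apply]
  · intro c hc
    ext I
    rw [hb.coord_unique (c := fun I => e.symm (c I)), e.apply_symm_apply]
    rw [RingEquiv.symm_apply_eq, key]
    exact hc

/-! ### The splitting of a normal ring -/

section Normal

variable {S A : Type u} [CommRing S] [CommRing A]

/-- A ring is normal if its local rings are integrally closed domains. -/
def IsNormalRing (A : Type u) [CommRing A] : Prop :=
  ∀ (Q : Ideal A) [Q.IsPrime],
    IsDomain (Localization.AtPrime Q) ∧ IsIntegrallyClosed (Localization.AtPrime Q)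

/-- A ring is locally `F`-finite if its local rings are `F`-finite. -/
def IsLocallyFFinite (p : ℕ) (A : Type u) [CommRing A] : Prop :=
  ∀ (Q : Ideal A) [Q.IsPrime], IsFFinite p (Localization.AtPrime Q)

theorem IsLocallyFFinite.of_isLocalization (h : IsLocallyFFinite p A) (Q : Ideal A) [Q.IsPrime]
    (L : Type*) [CommRing L] [Algebra A L] [IsLocalization.AtPrime L Q] : IsFFinite p L := by
  let e : Localization.AtPrime Q ≃ₐ[A] L := IsLocalization.algEquiv Q.primeCompl _ _
  exact (h Q).of_surjective (e : Localization.AtPrime Q →+* L) e.surjective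

theorem isLocalization_fractionRing_atPrime (Q : Ideal A) [Q.IsPrime]
    [IsDomain (Localization.AtPrime Q)] :
    IsLocalization.AtPrime (FractionRing (Localization.AtPrime Q))
      ((⊥ : Ideal (Localization.AtPrime Q)).comap (algebraMap A (Localization.AtPrime Q))) := by
  have : IsLocalization.AtPrime (FractionRing (Localization.AtPrime Q))
      (⊥ : Ideal (Localization.AtPrime Q)) := by
    have h : (⊥ : Ideal (Localization.AtPrime Q)).primeCompl =
        nonZeroDivisors (Localization.AtPrime Q) := by
      ext x
      rw [mem_nonZeroDivisors_iff_ne_zero]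
      exact Iff.rfl
    rw [IsLocalization.AtPrime, h]
    infer_instance
  exact IsLocalization.isLocalization_isLocalization_atPrime_isLocalization Q.primeCompl _ _

theorem charP_of_natCast_eq_zero (h : (p : A) = 0) (L : Type*) [Field L] [Algebra A L] :
    CharP L p := by
  refine (CharP.charP_iff_prime_eq_zero hp.out).2 ?_
  rw [← map_natCast (algebraMap A L), h, map_zero]

/-- Two elements of a normal ring coincide if they do so at the generic points. -/
theorem IsNormalRing.eq_of_field (hA : IsNormalRing A) {x y : A}
    (h : ∀ (P : Ideal A) [P.IsPrime] (L : Type u) [Field L] [Algebra A L]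
      [IsLocalization.AtPrime L P], algebraMap A L x = algebraMap A L y) : x = y := by
  rw [← sub_eq_zero]
  refine eq_zero_of_localization _ fun Q hQ => ?_
  have := hQ.isPrime
  have := (hA Q).1
  have := isLocalization_fractionRing_atPrime Q
  apply IsFractionRing.injective (Localization.AtPrime Q) (FractionRing (Localization.AtPrime Q))
  rw [← IsScalarTower.algebraMap_apply, map_sub, map_zero, sub_eq_zero]
  exact h ((⊥ : Ideal (Localization.AtPrime Q)).comap (algebraMap A _)) _

/-- A map is the splitting defined by a Frobenius lifting if it is given by the trace at all
generic points. -/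
def FrobLiftAlg.IsSplitting (F : FrobLiftAlg p S A) (τ : A → A) : Prop :=
  ∀ (P : Ideal A) [P.IsPrime] (L : Type u) [Field L] [CharP L p] [Algebra A L]
    [IsLocalization.AtPrime L P] (n : ℕ) (t : Fin n → S)
    (hb : IsPBasis p (fun i => algebraMap A L (F.q (t i)))) (x : A),
    F.trace hb (algebraMap A L x) = algebraMap A L (τ x) ^ p

variable (F : FrobLiftAlg p S A)

/-- The splitting near `Q`, up to a denominator valid at all generic points simultaneously.
Integrality at `Q` supplies `s`; the factor `f`, annihilating the prime `P₀` of the component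
through `Q`, makes both sides vanish at the other generic points. -/
theorem FrobLiftAlg.exists_trace_mul_eq [IsNoetherianRing A] (hF : IsLocallyFFinite p A)
    (hA : IsNormalRing A) (Q : Ideal A) [Q.IsPrime] (x : A) :
    ∃ s ∉ Q, ∃ a, ∀ (P : Ideal A) [P.IsPrime] (L : Type u) [Field L] [CharP L p] [Algebra A L]
      [IsLocalization.AtPrime L P] (n : ℕ) (t : Fin n → S)
      (hb : IsPBasis p (fun i => algebraMap A L (F.q (t i)))),
      F.trace hb (algebraMap A L x) * algebraMap A L s ^ p = algebraMap A L a ^ p := by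
  let R := Localization.AtPrime Q
  have : IsDomain R := (hA Q).1
  have : IsIntegrallyClosed R := (hA Q).2
  have : IsNoetherianRing R := IsLocalization.isNoetherianRing Q.primeCompl _ inferInstance
  let P₀ := (⊥ : Ideal R).comap (algebraMap A R)
  have : IsLocalization.AtPrime (FractionRing R) P₀ := isLocalization_fractionRing_atPrime Q
  have : CharP (FractionRing R) p := charP_of_natCast_eq_zero F.q_p _
  obtain ⟨n₀, t₀, hb₀⟩ := F.exists_isPBasis P₀.primeCompl (FractionRing R)
    (hF.of_isLocalization P₀ _)
  obtain ⟨z, hz⟩ := F.exists_trace_eq_algebraMap_pow Q R (hF Q) P₀.primeCompl (FractionRing R) hb₀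
    (algebraMap A R x)
  obtain ⟨a, s, rfl⟩ := IsLocalization.exists_mk'_eq Q.primeCompl z
  -- `P₀` is finitely generated and becomes zero in the local ring at `Q`, so one element outside
  -- `Q` annihilates all of it.
  obtain ⟨f, hf, hfP⟩ : ∃ f ∉ Q, ∀ c ∈ P₀, f * c = 0 := by
    classical
    obtain ⟨G, hG⟩ := IsNoetherian.noetherian P₀
    have h1 : ∀ c ∈ P₀, ∃ f ∉ Q, f * c = 0 := by
      intro c hc
      obtain ⟨m, hm⟩ := (IsLocalization.map_eq_zero_iff Q.primeCompl R c).1 hc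
      exact ⟨m, m.2, hm⟩
    choose! f hfQ hf using h1
    have hGP : ∀ c ∈ G, c ∈ P₀ := fun c hc => hG ▸ Submodule.subset_span hc
    refine ⟨∏ c ∈ G, f c, ?_, ?_⟩
    · rw [Ideal.IsPrime.prod_mem_iff]
      push Not
      exact fun c hc => hfQ c (hGP c hc)
    · intro c hc
      rw [← hG] at hc
      induction hc using Submodule.span_induction with
      | mem c hc =>
        rw [← Finset.mul_prod_erase G f hc, mul_right_comm, hf c (hGP c hc), zero_mul]
      | zero => rw [mul_zero]
      | add c d _ _ hc hd => rw [mul_add, hc, hd, add_zero]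
      | smul b c _ hc => rw [smul_eq_mul, mul_left_comm, hc, mul_zero]
  refine ⟨s * f, fun h => (‹Q.IsPrime›.mem_or_mem h).elim s.2 hf, a * f, ?_⟩
  intro P _ L _ _ _ _ n t hb
  by_cases hfL : algebraMap A L f = 0
  · rw [map_mul, map_mul, hfL, mul_zero, mul_zero, zero_pow hp.out.ne_zero, mul_zero]
  have h0 : ∀ c ∈ P₀, algebraMap A L c = 0 := by
    intro c hc
    have := congrArg (algebraMap A L) (hfP c hc)
    rw [map_mul, map_zero] at this
    exact (mul_eq_zero.1 this).resolve_left hfL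
  have hPP : P = P₀ := by
    ext c
    refine ⟨fun hc => ?_, fun hc => ?_⟩
    · by_contra hc'
      have hcL : algebraMap A L c = 0 := by
        by_contra hne
        exact (IsLocalization.AtPrime.isUnit_to_map_iff L P c).1 (isUnit_iff_ne_zero.2 hne) hc
      obtain ⟨u, hu⟩ := (IsLocalization.map_eq_zero_iff P.primeCompl L c).1 hcL
      have hu0 : (u : A) ∈ P₀ := by
        have : (u : A) * c ∈ P₀ := hu ▸ P₀.zero_mem
        exact ((inferInstance : P₀.IsPrime).mem_or_mem this).resolve_right hc'
      exact (IsLocalization.map_units L u).ne_zero (h0 _ hu0)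
    · by_contra hc'
      exact (IsLocalization.map_units (M := P.primeCompl) L ⟨c, hc'⟩).ne_zero (h0 c hc)
  subst hPP
  let e : FractionRing R ≃ₐ[A] L := IsLocalization.algEquiv P₀.primeCompl _ _
  have he : ∀ c, (e : FractionRing R →+* L) (algebraMap A _ c) = algebraMap A L c := e.commutes
  have hb₁ : IsPBasis p (fun i => algebraMap A L (F.q (t₀ i))) := by
    simpa only [AlgEquiv.coe_ringEquiv, e.commutes] using hb₀.map_ringEquiv e.toRingEquiv
  obtain rfl := hb.card_eq hb₁
  rw [F.trace_eq P₀.primeCompl hb hb₁, ← he, F.isHom_id.map_trace _ he hb₀ hb₁,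
    IsScalarTower.algebraMap_apply A R (FractionRing R), hz, ← map_pow, ← map_pow,
    ← map_pow, ← he, ← he, ← map_mul]
  congr 1
  rw [map_pow, map_pow, map_pow, ← mul_pow]
  congr 1
  rw [IsScalarTower.algebraMap_apply A R (FractionRing R), IsScalarTower.algebraMap_apply A R
    (FractionRing R), ← map_mul, map_mul (algebraMap A R), ← mul_assoc, IsLocalization.mk'_spec,
    map_mul (algebraMap A R)]

/-- The splitting defined by a Frobenius lifting of a normal ring. -/
theorem FrobLiftAlg.exists_isSplitting [IsNoetherianRing A] (hF : IsLocallyFFinite p A)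
    (hA : IsNormalRing A) : ∃ τ : A → A, F.IsSplitting τ := by
  suffices h : ∀ x, ∃ y, ∀ (P : Ideal A) [P.IsPrime] (L : Type u) [Field L] [CharP L p]
      [Algebra A L] [IsLocalization.AtPrime L P] (n : ℕ) (t : Fin n → S)
      (hb : IsPBasis p (fun i => algebraMap A L (F.q (t i)))),
      F.trace hb (algebraMap A L x) = algebraMap A L y ^ p by
    choose τ hτ using h
    exact ⟨τ, fun P _ L _ _ _ _ n t hb x => hτ x P L n t hb⟩
  intro x
  -- The admissible denominators for `x` form an ideal, by additivity of `p`-th powers. The local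
  -- result shows that no maximal ideal contains it.
  let I : Ideal A :=
    { carrier := {s | ∃ a, ∀ (P : Ideal A) [P.IsPrime] (L : Type u) [Field L] [CharP L p]
        [Algebra A L] [IsLocalization.AtPrime L P] (n : ℕ) (t : Fin n → S)
        (hb : IsPBasis p (fun i => algebraMap A L (F.q (t i)))),
        F.trace hb (algebraMap A L x) * algebraMap A L s ^ p = algebraMap A L a ^ p}
      add_mem' := by
        rintro s s' ⟨a, ha⟩ ⟨a', ha'⟩
        refine ⟨a + a', fun P _ L _ _ _ _ n t hb => ?_⟩
        rw [map_add, map_add, add_pow_char, add_pow_char, mul_add, ha P, ha' P]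
      zero_mem' := ⟨0, fun P _ L _ _ _ _ n t hb => by
        rw [map_zero, zero_pow hp.out.ne_zero, mul_zero]⟩
      smul_mem' := by
        rintro c s ⟨a, ha⟩
        refine ⟨c * a, fun P _ L _ _ _ _ n t hb => ?_⟩
        rw [smul_eq_mul, map_mul, map_mul, mul_pow, mul_pow, mul_left_comm, ha P] }
  have hI : I = ⊤ := by
    by_contra hne
    obtain ⟨Q, hQ, hle⟩ := Ideal.exists_le_maximal I hne
    have := hQ.isPrime
    obtain ⟨s, hs, a, ha⟩ := F.exists_trace_mul_eq hF hA Q x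
    exact hs (hle ⟨a, ha⟩)
  obtain ⟨y, hy⟩ := (Ideal.eq_top_iff_one I).1 hI
  refine ⟨y, fun P _ L _ _ _ _ n t hb => ?_⟩
  rw [← hy P L n t hb, map_one, one_pow, mul_one]

variable {F}

/-- Elements of a normal ring are determined at its generic points, where `p`-th roots are unique.
All identities for `τ` thereby become identities for traces. -/
theorem FrobLiftAlg.IsSplitting.eq_of_pow {τ : A → A} (hτ : F.IsSplitting τ) (hF : IsLocallyFFinite p A)
    (hA : IsNormalRing A) {x y : A}
    (h : ∀ (P : Ideal A) [P.IsPrime] (L : Type u) [Field L] [CharP L p] [Algebra A L]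
      [IsLocalization.AtPrime L P] (n : ℕ) (t : Fin n → S)
      (hb : IsPBasis p (fun i => algebraMap A L (F.q (t i)))),
      F.trace hb (algebraMap A L x) = algebraMap A L y ^ p) : τ x = y := by
  refine hA.eq_of_field fun P _ L _ _ _ => ?_
  have : CharP L p := charP_of_natCast_eq_zero F.q_p L
  obtain ⟨n, t, hb⟩ := F.exists_isPBasis P.primeCompl L (hF.of_isLocalization P L)
  exact eq_of_pow_char_eq (p := p) (by rw [← hτ P L n t hb, h P L n t hb])

theorem FrobLiftAlg.IsSplitting.map_add {τ : A → A} (hτ : F.IsSplitting τ) (hF : IsLocallyFFinite p A)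
    (hA : IsNormalRing A) (x y : A) : τ (x + y) = τ x + τ y :=
  hτ.eq_of_pow hF hA fun P _ L _ _ _ _ n t hb => by
    rw [_root_.map_add, _root_.map_add, _root_.map_add, add_pow_char, hτ P, hτ P]

theorem FrobLiftAlg.IsSplitting.map_pow_mul {τ : A → A} (hτ : F.IsSplitting τ)
    (hF : IsLocallyFFinite p A) (hA : IsNormalRing A) (x y : A) : τ (x ^ p * y) = x * τ y :=
  hτ.eq_of_pow hF hA fun P _ L _ _ _ _ n t hb => by
    rw [map_mul, map_pow, F.trace_pow_mul, hτ P, map_mul, mul_pow]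

theorem FrobLiftAlg.IsSplitting.map_one {τ : A → A} (hτ : F.IsSplitting τ)
    (hF : IsLocallyFFinite p A) (hA : IsNormalRing A) : τ 1 = 1 :=
  hτ.eq_of_pow hF hA fun P _ L _ _ _ _ n t hb => by
    rw [_root_.map_one, F.trace_one, one_pow]

/-- The splittings are compatible with maps of Frobenius liftings that are local isomorphisms at
generic points. -/
theorem FrobLiftAlg.IsHom.map_splitting {S' A' : Type u} [CommRing S'] [CommRing A']
    {F' : FrobLiftAlg p S' A'} {r : S →+* S'} {rb : A →+* A'} (h : F.IsHom F' r rb)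
    {τ : A → A} (hτ : F.IsSplitting τ) {τ' : A' → A'} (hτ' : F'.IsSplitting τ')
    (hF : IsLocallyFFinite p A) (hA' : IsNormalRing A')
    (hloc : ∀ (P : Ideal A') [P.IsPrime] (L : Type u) [Field L] [Algebra A' L] [Algebra A L]
      [IsLocalization.AtPrime L P], (∀ a, algebraMap A L a = algebraMap A' L (rb a)) →
      IsLocalization.AtPrime L (P.comap rb)) (x : A) : τ' (rb x) = rb (τ x) := by
  refine hA'.eq_of_field fun P _ L _ _ _ => ?_
  -- With `L` regarded as an `A`-algebra through `rb`, one `p`-basis coming from `S` computes both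
  -- traces.
  let := ((algebraMap A' L).comp rb).toAlgebra
  have : IsLocalization.AtPrime L (P.comap rb) := hloc P L fun _ => rfl
  have : CharP L p := charP_of_natCast_eq_zero F.q_p L
  obtain ⟨n, t, hb⟩ := F.exists_isPBasis (P.comap rb).primeCompl L
    (hF.of_isLocalization (P.comap rb) L)
  have hb' : IsPBasis p (fun i => algebraMap A' L (F'.q (r (t i)))) := by
    simp only [h.q]
    exact hb
  have h1 := h.map_trace (RingHom.id L) (fun a => rfl) hb hb' (algebraMap A L x)
  rw [hτ (P.comap rb)] at h1
  refine eq_of_pow_char_eq (p := p) (R := L) ?_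
  rw [← hτ' P L n _ hb']
  exact h1

end Normal

end

section

variable {p : ℕ} [hp : Fact p.Prime]

/-! ### Descent of Frobenius liftings to rings of invariants -/

/-- A Reynolds operator onto a subring in characteristic `p`, commuting with the Frobenius. -/
structure IsReynolds (p : ℕ) {A : Type*} [CommRing A] (B : Subring A) (R : A →+ A) : Prop where
  mem : ∀ a, R a ∈ B
  map_mul : ∀ b ∈ B, ∀ a, R (b * a) = b * R a
  map_one : R 1 = 1
  map_pow : ∀ a, R (a ^ p) = R a ^ p

/-- A splitting of the Frobenius of a ring. -/
structure IsFrobeniusSplitting (p : ℕ) {A : Type*} [CommRing A] (τ : A →+ A) : Prop where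
  map_pow_mul : ∀ a b, τ (a ^ p * b) = a * τ b
  map_one : τ 1 = 1

theorem IsReynolds.apply_of_mem {A : Type*} [CommRing A] {B : Subring A} {R : A →+ A}
    (hR : IsReynolds p B R) {b : A} (hb : b ∈ B) : R b = b := by
  rw [← mul_one b, hR.map_mul b hb, hR.map_one]

/-- The projection away from the ring of invariants. -/
def complProj {A : Type*} [CommRing A] (R : A →+ A) : A →+ A := AddMonoidHom.id A - R

theorem complProj_apply {A : Type*} [CommRing A] (R : A →+ A) (a : A) :
    complProj R a = a - R a := rfl

section Descent

variable {S A : Type*} [CommRing S] [CommRing A] {B : Subring A} {R τ : A →+ A}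

theorem IsReynolds.complProj_mul (hR : IsReynolds p B R) {b : A} (hb : b ∈ B) (a : A) :
    complProj R (b * a) = b * complProj R a := by
  rw [complProj_apply, complProj_apply, hR.map_mul b hb, mul_sub]

theorem IsReynolds.complProj_eq_zero_iff (hR : IsReynolds p B R) {b : A} :
    complProj R b = 0 ↔ b ∈ B := by
  rw [complProj_apply, sub_eq_zero]
  exact ⟨fun h => h ▸ hR.mem b, fun h => (hR.apply_of_mem h).symm⟩

theorem IsReynolds.complProj_complProj (hR : IsReynolds p B R) (a : A) :
    complProj R (complProj R a) = complProj R a := by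
  rw [complProj_apply R (complProj R a), complProj_apply, map_sub, hR.apply_of_mem (hR.mem a),
    sub_self, sub_zero]

theorem addDefect_mem {B : Subring A} {x y : A} (hx : x ∈ B) (hy : y ∈ B) :
    addDefect p x y ∈ B := by
  refine B.mul_mem (B.mul_mem hx hy) (B.sum_mem fun k _ => ?_)
  exact B.mul_mem (B.mul_mem (B.pow_mem hx _) (B.pow_mem hy _)) (natCast_mem B _)

variable (F : FrobLiftAlg p S A)

/-- The obstruction to an element of the lifting being invariant. -/
def FrobLiftAlg.obstr (R τ : A →+ A) (x : S) : A := complProj R (τ (complProj R (F.δ x)))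

/-- For reductions in `B` the additivity defect of `δ` is again in `B`, and the projection away from
`B` removes it. -/
theorem FrobLiftAlg.obstr_add (hR : IsReynolds p B R) {x y : S} (hx : F.q x ∈ B)
    (hy : F.q y ∈ B) : F.obstr R τ (x + y) = F.obstr R τ x + F.obstr R τ y := by
  rw [obstr, F.δ_add, map_sub, hR.complProj_eq_zero_iff.2 (addDefect_mem hx hy), sub_zero,
    map_add, map_add, map_add, obstr, obstr]

/-- The coefficients `q x ^ p` in the Leibniz rule for `δ` lie in `B` and pass through the
projection; `τ` then extracts their `p`-th roots, turning the twisted rule into an ordinary one. -/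
theorem FrobLiftAlg.obstr_mul (hR : IsReynolds p B R) (hτ : IsFrobeniusSplitting p τ) {x y : S}
    (hx : F.q x ∈ B) (hy : F.q y ∈ B) :
    F.obstr R τ (x * y) = F.q x * F.obstr R τ y + F.q y * F.obstr R τ x := by
  rw [obstr, F.δ_mul, map_add, hR.complProj_mul (B.pow_mem hx p),
    hR.complProj_mul (B.pow_mem hy p), map_add, hτ.map_pow_mul, hτ.map_pow_mul, map_add,
    hR.complProj_mul hx, hR.complProj_mul hy, obstr, obstr]

theorem FrobLiftAlg.obstr_one : F.obstr R τ 1 = 0 := by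
  rw [obstr, F.δ_one, map_zero, map_zero, map_zero]

theorem FrobLiftAlg.obstr_zero : F.obstr R τ 0 = 0 := by
  rw [obstr, F.δ_zero, map_zero, map_zero, map_zero]

theorem FrobLiftAlg.sub_pow_char (F : FrobLiftAlg p S A) (a b : A) :
    (a - b) ^ p = a ^ p - b ^ p := by
  rcases subsingleton_or_nontrivial A with h | h
  · exact Subsingleton.elim _ _
  have : CharP A p := (CharP.charP_iff_prime_eq_zero hp.out).2 F.q_p
  exact _root_.sub_pow_char a b

/-- Since `R` commutes with the Frobenius, `(1 - R)` of `q x ^ p` is the `p`-th power of `(1 - R) (q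
x)`, and `τ` takes its root. So changing `x` by `p * a` changes the obstruction exactly by the part
of the reduction of `a` outside `B`. -/
theorem FrobLiftAlg.obstr_p_mul (hR : IsReynolds p B R) (hτ : IsFrobeniusSplitting p τ) (x : S) :
    F.obstr R τ (p * x) = complProj R (F.q x) := by
  rw [obstr, F.δ_p_mul, complProj_apply R (F.q x ^ p), hR.map_pow, ← F.sub_pow_char,
    ← complProj_apply, ← mul_one (complProj R (F.q x) ^ p), hτ.map_pow_mul, hτ.map_one, mul_one,
    hR.complProj_complProj]

theorem FrobLiftAlg.obstr_neg (hR : IsReynolds p B R) {x : S} (hx : F.q x ∈ B) :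
    F.obstr R τ (-x) = -F.obstr R τ x := by
  have h : F.q (-x) ∈ B := by
    rw [map_neg]
    exact B.neg_mem hx
  rw [eq_neg_iff_add_eq_zero, ← F.obstr_add hR h hx, neg_add_cancel, F.obstr_zero]

/-- The invariant part of a Frobenius lifting. -/
def FrobLiftAlg.invariants (hR : IsReynolds p B R) (hτ : IsFrobeniusSplitting p τ) :
    Subring S where
  carrier := {x | F.q x ∈ B ∧ F.obstr R τ x = 0}
  mul_mem' := by
    rintro x y ⟨hx, hx'⟩ ⟨hy, hy'⟩
    refine ⟨?_, ?_⟩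
    · rw [map_mul]
      exact B.mul_mem hx hy
    · rw [F.obstr_mul hR hτ hx hy, hx', hy', mul_zero, mul_zero, add_zero]
  one_mem' := ⟨by rw [map_one]; exact B.one_mem, F.obstr_one⟩
  add_mem' := by
    rintro x y ⟨hx, hx'⟩ ⟨hy, hy'⟩
    refine ⟨?_, ?_⟩
    · rw [map_add]
      exact B.add_mem hx hy
    · rw [F.obstr_add hR hx hy, hx', hy', add_zero]
  zero_mem' := ⟨by rw [map_zero]; exact B.zero_mem, F.obstr_zero⟩
  neg_mem' := by
    rintro x ⟨hx, hx'⟩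
    refine ⟨?_, ?_⟩
    · rw [map_neg]
      exact B.neg_mem hx
    · rw [F.obstr_neg hR hx, hx', neg_zero]

variable {F}
variable (hR : IsReynolds p B R) (hτ : IsFrobeniusSplitting p τ)

theorem FrobLiftAlg.mem_invariants {x : S} :
    x ∈ F.invariants hR hτ ↔ F.q x ∈ B ∧ F.obstr R τ x = 0 := Iff.rfl

/-- Subtract from any lift `p` times a lift of its own obstruction, which the projection away from
`B` leaves fixed. -/
theorem FrobLiftAlg.exists_mem_invariants {b : A} (hb : b ∈ B) :
    ∃ x ∈ F.invariants hR hτ, F.q x = b := by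
  obtain ⟨x, rfl⟩ := F.surj b
  obtain ⟨a, ha⟩ := F.surj (F.obstr R τ x)
  have hpa : F.q (p * -a) ∈ B := by
    rw [F.q_p_mul]
    exact B.zero_mem
  have hq : F.q (x + p * -a) = F.q x := by
    rw [map_add, F.q_p_mul, add_zero]
  refine ⟨x + p * -a, ⟨hq ▸ hb, ?_⟩, hq⟩
  rw [F.obstr_add hR hb hpa, F.obstr_p_mul hR hτ, map_neg, map_neg, ha, obstr,
    hR.complProj_complProj, add_neg_cancel]

theorem FrobLiftAlg.p_mul_mem_invariants {x : S} :
    (p : S) * x ∈ F.invariants hR hτ ↔ F.q x ∈ B := by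
  rw [mem_invariants, F.obstr_p_mul hR hτ, hR.complProj_eq_zero_iff, F.q_p_mul]
  exact ⟨fun h => h.2, fun h => ⟨B.zero_mem, h⟩⟩

theorem FrobLiftAlg.exists_eq_p_mul {x : S} (hx : x ∈ F.invariants hR hτ) (h : F.q x = 0) :
    ∃ y ∈ F.invariants hR hτ, x = p * y := by
  obtain ⟨y, rfl⟩ := F.q_eq_zero x h
  obtain ⟨z, hz, hzy⟩ := exists_mem_invariants hR hτ (F := F) ((p_mul_mem_invariants hR hτ).1 hx)
  exact ⟨z, hz, F.p_mul_congr hzy.symm⟩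

/-- An element `a ^ p + p * b` with invariant reductions is invariant. -/
theorem FrobLiftAlg.pow_add_p_mul_mem_invariants {a b : S} (ha : F.q a ∈ B) (hb : F.q b ∈ B) :
    a ^ p + p * b ∈ F.invariants hR hτ := by
  refine (F.invariants hR hτ).add_mem ?_ ((p_mul_mem_invariants hR hτ).2 hb)
  refine ⟨by rw [map_pow]; exact B.pow_mem ha p, ?_⟩
  rw [obstr, F.δ_pow, map_zero, map_zero, map_zero]

/-- The lifting of the Frobenius on the invariants. -/
theorem FrobLiftAlg.exists_invariants_φ (x : F.invariants hR hτ) :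
    ∃ y : F.invariants hR hτ, ∀ z : S, F.q z = R (F.δ x) → (y : S) = (x : S) ^ p + p * z := by
  -- Any lift `z` of `R (F.δ x)` gives the same value, since `p * z` depends only on its reduction;
  -- later computations can choose `z` freely.
  obtain ⟨w, hw, hw'⟩ := exists_mem_invariants hR hτ (F := F) (hR.mem (F.δ x))
  refine ⟨x ^ p + p * ⟨w, hw⟩, fun z hz => ?_⟩
  change (x : S) ^ p + (p : F.invariants hR hτ) * w = _
  rw [Subring.coe_natCast, F.p_mul_congr (hw'.trans hz.symm)]

variable (F) in
/-- The lifting of the Frobenius on the invariants, as a map. -/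
def FrobLiftAlg.invariantsφ (x : F.invariants hR hτ) : F.invariants hR hτ :=
  (exists_invariants_φ hR hτ x).choose

theorem FrobLiftAlg.coe_invariantsφ (x : F.invariants hR hτ) {z : S} (hz : F.q z = R (F.δ x)) :
    (F.invariantsφ hR hτ x : S) = (x : S) ^ p + p * z :=
  (exists_invariants_φ hR hτ x).choose_spec z hz

theorem FrobLiftAlg.δ_add_lift {x y z z' : S} (hR : IsReynolds p B R) (hx : F.q x ∈ B)
    (hy : F.q y ∈ B) (hz : F.q z = R (F.δ x)) (hz' : F.q z' = R (F.δ y)) :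
    F.q (z + z' - addDefect p x y) = R (F.δ (x + y)) := by
  rw [F.δ_add, map_sub, map_add, map_sub, map_add, hz, hz', FrobLift.map_addDefect,
    hR.apply_of_mem (addDefect_mem hx hy)]

theorem FrobLiftAlg.δ_mul_lift {x y z z' : S} (hR : IsReynolds p B R) (hx : F.q x ∈ B)
    (hy : F.q y ∈ B) (hz : F.q z = R (F.δ x)) (hz' : F.q z' = R (F.δ y)) :
    F.q (x ^ p * z' + y ^ p * z) = R (F.δ (x * y)) := by
  rw [F.δ_mul, map_add, map_add, map_mul, map_mul, map_pow, map_pow, hz, hz',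
    hR.map_mul _ (B.pow_mem hx p), hR.map_mul _ (B.pow_mem hy p)]

variable (F)

/-- The Frobenius lifting on the invariants. -/
def FrobLiftAlg.descend : FrobLiftAlg p (F.invariants hR hτ) B where
  q := (F.q.comp (F.invariants hR hτ).subtype).codRestrict B fun x => x.2.1
  surj b := by
    obtain ⟨x, hx, h⟩ := exists_mem_invariants hR hτ (F := F) b.2
    exact ⟨⟨x, hx⟩, Subtype.ext h⟩
  φ :=
    { toFun := F.invariantsφ hR hτ
      map_one' := by
        apply Subtype.ext
        rw [coe_invariantsφ hR hτ 1 (z := 0)]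
        · simp
        · simp [F.δ_one]
      map_zero' := by
        apply Subtype.ext
        rw [coe_invariantsφ hR hτ 0 (z := 0)]
        · simp [hp.out.ne_zero]
        · simp [F.δ_zero]
      map_add' := fun x y => by
        apply Subtype.ext
        obtain ⟨z, hz⟩ := F.surj (R (F.δ x))
        obtain ⟨z', hz'⟩ := F.surj (R (F.δ y))
        refine (coe_invariantsφ hR hτ (x + y)
          (δ_add_lift hR x.2.1 y.2.1 hz hz')).trans ?_
        rw [Subring.coe_add, Subring.coe_add, coe_invariantsφ hR hτ x hz,
          coe_invariantsφ hR hτ y hz',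
          add_pow_eq_addDefect]
        ring
      map_mul' := fun x y => by
        apply Subtype.ext
        obtain ⟨z, hz⟩ := F.surj (R (F.δ x))
        obtain ⟨z', hz'⟩ := F.surj (R (F.δ y))
        refine (coe_invariantsφ hR hτ (x * y)
          (δ_mul_lift hR x.2.1 y.2.1 hz hz')).trans ?_
        rw [Subring.coe_mul, Subring.coe_mul, coe_invariantsφ hR hτ x hz,
          coe_invariantsφ hR hτ y hz']
        linear_combination (-(z * z')) * F.sq }
  q_eq_zero x hx := by
    obtain ⟨y, hy, h⟩ := exists_eq_p_mul hR hτ x.2 (congrArg Subtype.val hx)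
    exact ⟨⟨y, hy⟩, Subtype.ext (by simpa using h)⟩
  tors x hx := Subtype.ext (F.tors x (by simpa using congrArg Subtype.val hx))
  sq := Subtype.ext (by simpa using F.sq)
  q_φ x := by
    apply Subtype.ext
    obtain ⟨z, hz⟩ := F.surj (R (F.δ x))
    change F.q (F.invariantsφ hR hτ x : S) = F.q x ^ p
    rw [coe_invariantsφ hR hτ x hz, map_add, map_pow, F.q_p_mul, add_zero]

theorem FrobLiftAlg.coe_descend_φ (x : F.invariants hR hτ) {z : S} (hz : F.q z = R (F.δ x)) :
    ((F.descend hR hτ).φ x : S) = (x : S) ^ p + p * z :=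
  coe_invariantsφ hR hτ x hz

variable {F}

section Naturality

variable {S' A' : Type*} [CommRing S'] [CommRing A'] {F' : FrobLiftAlg p S' A'} {r : S →+* S'}
  {rb : A →+* A'} {B' : Subring A'} {R' τ' : A' →+ A'}

theorem FrobLiftAlg.IsHom.obstr (h : F.IsHom F' r rb) (hRR : ∀ a, R' (rb a) = rb (R a))
    (hττ : ∀ a, τ' (rb a) = rb (τ a)) (x : S) : F'.obstr R' τ' (r x) = rb (F.obstr R τ x) := by
  simp only [FrobLiftAlg.obstr, h.δ, complProj_apply, map_sub, hRR, hττ]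

theorem FrobLiftAlg.IsHom.map_mem_invariants (h : F.IsHom F' r rb)
    (hRR : ∀ a, R' (rb a) = rb (R a)) (hττ : ∀ a, τ' (rb a) = rb (τ a))
    (hR' : IsReynolds p B' R') (hτ' : IsFrobeniusSplitting p τ') (hB : ∀ b ∈ B, rb b ∈ B')
    {x : S} (hx : x ∈ F.invariants hR hτ) : r x ∈ F'.invariants hR' hτ' := by
  refine ⟨?_, ?_⟩
  · rw [h.q]
    exact hB _ hx.1
  · rw [h.obstr hRR hττ, hx.2, map_zero]

theorem FrobLiftAlg.IsHom.map_descend_φ (h : F.IsHom F' r rb)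
    (hRR : ∀ a, R' (rb a) = rb (R a))
    (hR' : IsReynolds p B' R') (hτ' : IsFrobeniusSplitting p τ')
    (x : F.invariants hR hτ) (y : F'.invariants hR' hτ') (hy : (y : S') = r x) :
    ((F'.descend hR' hτ').φ y : S') = r ((F.descend hR hτ).φ x) := by
  obtain ⟨z, hz⟩ := F.surj (R (F.δ x))
  rw [F.coe_descend_φ hR hτ x hz, F'.coe_descend_φ hR' hτ' y (z := r z), hy, map_add, map_pow,
    map_mul, map_natCast]
  rw [h.q, hz, hy, h.δ, hRR]

end Naturality

end Descent

end

section

variable {p : ℕ} [hp : Fact p.Prime]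

/-! ### Algebras essentially of finite type over perfect fields -/

section EssFiniteType

theorem isFFinite_mvPolynomial (k : Type*) [Field k] [CharP k p] [PerfectField k] (n : ℕ) :
    IsFFinite p (MvPolynomial (Fin n) k) := by
  have : ExpChar k p := .prime hp.out
  have hperf : PerfectRing k p := PerfectField.toPerfectRing p
  let e := Fintype.equivFin (Fin n → Fin p)
  have key : ∀ x : MvPolynomial (Fin n) k, ∃ c : (Fin n → Fin p) → MvPolynomial (Fin n) k,
      x = ∑ I, c I ^ p * monom MvPolynomial.X (fun i => (I i : ℕ)) := by
    intro x
    induction x using MvPolynomial.induction_on' with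
    | monomial u a =>
      obtain ⟨b, rfl⟩ := (PerfectRing.bijective_frobenius (R := k) (p := p)).2 a
      refine ⟨Pi.single (redExp p u) (MvPolynomial.C b * monom MvPolynomial.X fun i => u i / p), ?_⟩
      rw [Fintype.sum_eq_single (redExp p u), Pi.single_eq_same, mul_pow, mul_assoc, ← map_pow,
        MvPolynomial.monomial_eq, Finsupp.prod_fintype _ _ (fun i => pow_zero _)]
      · congr 1
        exact monom_eq_redExp MvPolynomial.X u
      · intro J hJ
        rw [Pi.single_eq_of_ne hJ, zero_pow hp.out.ne_zero, zero_mul]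
    | add x y hx hy =>
      obtain ⟨c, hc⟩ := hx
      obtain ⟨d, hd⟩ := hy
      refine ⟨c + d, ?_⟩
      conv_lhs => rw [hc, hd]
      rw [← Finset.sum_add_distrib]
      exact Finset.sum_congr rfl fun I _ => by rw [Pi.add_apply, add_pow_char, add_mul]
  refine ⟨_, fun i => monom MvPolynomial.X (fun j => (e.symm i j : ℕ)), fun x => ?_⟩
  obtain ⟨c, hc⟩ := key x
  refine ⟨fun i => c (e.symm i), ?_⟩
  conv_lhs => rw [hc]
  exact (e.symm.sum_comp _).symm

theorem isFFinite_of_essFiniteType (k A : Type*) [Field k] [CharP k p] [PerfectField k]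
    [CommRing A] [Algebra k A] [Algebra.EssFiniteType k A] : IsFFinite p A := by
  obtain ⟨n, f, hf⟩ := Algebra.FiniteType.iff_quotient_mvPolynomial''.1
    (inferInstance : Algebra.FiniteType k (Algebra.EssFiniteType.subalgebra k A))
  exact ((isFFinite_mvPolynomial k n).of_surjective f.toRingHom hf).of_isLocalization
    (Algebra.EssFiniteType.submonoid k A) A

end EssFiniteType

/-! ### Local rings of schemes essentially of finite type. -/

section Scheme

variable {k : Type u} [Field k]

theorem isLocallyNoetherian_of_isEssFiniteType {Y : Over (Spec (.of k))}
    (h : IsEssFiniteType Y) : IsLocallyNoetherian Y.left := by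
  choose U hxU hU hfin using h.2
  refine isLocallyNoetherian_of_affine_cover (S := fun x => ⟨U x, hU x⟩) ?_ fun x => ?_
  · exact top_le_iff.1 fun x _ => TopologicalSpace.Opens.mem_iSup.2 ⟨x, hxU x⟩
  · let := ((Scheme.ΓSpecIso (.of k)).inv ≫ Y.hom.appLE ⊤ (U x) le_top).hom.toAlgebra
    have : Algebra.EssFiniteType k Γ(Y.left, U x) := hfin x
    exact Algebra.EssFiniteType.isNoetherianRing k _

theorem isFFinite_stalk_of_isEssFiniteType [CharP k p] [PerfectField k] {Y : Over (Spec (.of k))}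
    (h : IsEssFiniteType Y) (x : Y.left) : IsFFinite p (Y.left.presheaf.stalk x) := by
  obtain ⟨U, hxU, hU, hfin⟩ := h.2 x
  let := ((Scheme.ΓSpecIso (.of k)).inv ≫ Y.hom.appLE ⊤ U le_top).hom.toAlgebra
  have : Algebra.EssFiniteType k Γ(Y.left, U) := hfin
  let := Y.left.presheaf.algebra_section_stalk ⟨x, hxU⟩
  have := hU.isLocalization_stalk ⟨x, hxU⟩
  exact (isFFinite_of_essFiniteType k Γ(Y.left, U)).of_isLocalization
    (hU.primeIdealOf ⟨x, hxU⟩).asIdeal.primeCompl _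

/-- The local rings of an affine open are the stalks. -/
theorem exists_stalk_isLocalization {Y : Scheme.{u}} {U : Y.Opens} (hU : IsAffineOpen U)
    (Q : Ideal Γ(Y, U)) [hQ : Q.IsPrime] :
    ∃ x : U, IsLocalization.AtPrime (Y.presheaf.stalk (x : Y)) Q :=
  ⟨⟨hU.fromSpec ⟨Q, hQ⟩, (hU.isoSpec.inv _).2⟩,
    hU.isLocalization_stalk' ⟨Q, hQ⟩ (hU.isoSpec.inv _).2⟩

theorem exists_ringEquiv_stalk {Y : Scheme.{u}} {U : Y.Opens} (hU : IsAffineOpen U)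
    (Q : Ideal Γ(Y, U)) [Q.IsPrime] :
    ∃ x : Y, Nonempty (Y.presheaf.stalk x ≃+* Localization.AtPrime Q) := by
  obtain ⟨x, hx⟩ := exists_stalk_isLocalization hU Q
  exact ⟨x, ⟨(IsLocalization.algEquiv Q.primeCompl
    (Y.presheaf.stalk (x : Y)) (Localization.AtPrime Q)).toRingEquiv⟩⟩

theorem isLocallyFFinite_of_isEssFiniteType [CharP k p] [PerfectField k]
    {Y : Over (Spec (.of k))} (h : IsEssFiniteType Y) {U : Y.left.Opens} (hU : IsAffineOpen U) :
    IsLocallyFFinite p Γ(Y.left, U) := by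
  intro Q hQ
  obtain ⟨x, ⟨e⟩⟩ := exists_ringEquiv_stalk hU Q
  exact (isFFinite_stalk_of_isEssFiniteType h x).of_surjective (e : _ →+* _) e.surjective

theorem IsNormal.isNormalRing {Y : Scheme.{u}} (h : IsNormal Y) {U : Y.Opens}
    (hU : IsAffineOpen U) : IsNormalRing Γ(Y, U) := by
  intro Q hQ
  obtain ⟨x, ⟨e⟩⟩ := exists_ringEquiv_stalk hU Q
  have := (h x).1
  have := (h x).2
  exact ⟨e.toMulEquiv.symm.isDomain _, IsIntegrallyClosed.of_equiv e⟩

/-- The local rings of an affine open are local rings of every larger affine open. -/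
theorem isLocalization_comap_of_le {Y : Scheme.{u}} {U V : Y.Opens} (hU : IsAffineOpen U)
    (hV : IsAffineOpen V) (hVU : V ≤ U) (P : Ideal Γ(Y, V)) [P.IsPrime] (L : Type u) [Field L]
    [Algebra Γ(Y, V) L] [Algebra Γ(Y, U) L] [IsLocalization.AtPrime L P]
    (hL : ∀ a, algebraMap Γ(Y, U) L a =
      algebraMap Γ(Y, V) L (Y.presheaf.map (homOfLE hVU).op a)) :
    IsLocalization.AtPrime L (P.comap (Y.presheaf.map (homOfLE hVU).op).hom) := by
  obtain ⟨x, hx⟩ := exists_stalk_isLocalization hV P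
  let x' : U := ⟨x, hVU x.2⟩
  have hcomp : ∀ a, algebraMap Γ(Y, U) (Y.presheaf.stalk (x' : Y)) a =
      algebraMap Γ(Y, V) (Y.presheaf.stalk (x : Y)) (Y.presheaf.map (homOfLE hVU).op a) :=
    fun a => (Y.presheaf.germ_res_apply (homOfLE hVU) x x.2 a).symm
  have hx' := hU.isLocalization_stalk x'
  let e : Y.presheaf.stalk (x : Y) ≃ₐ[Γ(Y, V)] L := IsLocalization.algEquiv P.primeCompl _ _
  let e' : Y.presheaf.stalk (x' : Y) ≃ₐ[Γ(Y, U)] L :=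
    AlgEquiv.ofRingEquiv (f := e.toRingEquiv) fun a => by
      rw [hL, hcomp]
      exact e.commutes _
  have hP : (hU.primeIdealOf x').asIdeal = P.comap (Y.presheaf.map (homOfLE hVU).op).hom := by
    ext a
    rw [Ideal.mem_comap, ← not_iff_not]
    change a ∈ (hU.primeIdealOf x').asIdeal.primeCompl ↔ _ ∈ P.primeCompl
    rw [← IsLocalization.AtPrime.isUnit_to_map_iff (Y.presheaf.stalk (x' : Y)), hcomp,
      ← IsLocalization.AtPrime.isUnit_to_map_iff (Y.presheaf.stalk (x : Y)) P]
  have hP' : (P.comap (Y.presheaf.map (homOfLE hVU).op).hom).primeCompl =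
      (hU.primeIdealOf x').asIdeal.primeCompl := by
    ext a
    exact not_congr (Ideal.ext_iff.1 hP.symm a)
  rw [IsLocalization.AtPrime, hP']
  exact IsLocalization.isLocalization_of_algEquiv _ e'

end Scheme

end

section

/-! ### Smooth algebras over fields are reduced -/

/-- Integral closure commutes with smooth base change, and `k` is integrally closed in `k[X]`. If
`h` is nilpotent, `h ⊗ X` is integral over `H`, hence comes from `H ⊗ k`; its coefficient at `X`,
which is `h`, must vanish. -/
theorem isReduced_of_smooth (k H : Type*) [Field k] [CommRing H] [Algebra k H]
    [Algebra.Smooth k H] : IsReduced H := by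
  refine ⟨fun h hh => ?_⟩
  let Q := Polynomial k
  have hint : IsIntegral H (h ⊗ₜ[k] (Polynomial.X : Q)) := by
    obtain ⟨n, hn⟩ := hh
    refine IsIntegral.of_pow (n := n + 1) n.succ_pos ?_
    rw [Algebra.TensorProduct.tmul_pow, pow_succ, hn, zero_mul, TensorProduct.zero_tmul]
    exact isIntegral_zero
  obtain ⟨z, hz⟩ := (TensorProduct.toIntegralClosure_bijective_of_smooth (R := k) (S := H)
    (B := Q)).2 ⟨_, hint⟩
  let c : H ⊗[k] Q →ₗ[k] H :=
    (TensorProduct.rid k H).toLinearMap ∘ₗ (Polynomial.lcoeff k 1).lTensor H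
  have hc : ∀ z : H ⊗[k] integralClosure k Q,
      c (TensorProduct.toIntegralClosure k H Q z : H ⊗[k] Q) = 0 := by
    intro z
    induction z using TensorProduct.induction_on with
    | zero => simp
    | add x y hx hy => rw [map_add, AddMemClass.coe_add, map_add, hx, hy, add_zero]
    | tmul a b =>
      obtain ⟨b, q, hq, hb⟩ := b
      have : b = Polynomial.C (b.coeff 0) := by
        have h0 : q.comp b = 0 := hb
        rcases Polynomial.comp_eq_zero_iff.1 h0 with h0 | h0
        · exact (hq.ne_zero h0).elim
        · exact h0.2
      have h1 : b.coeff 1 = 0 := by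
        rw [this, Polynomial.coeff_C_of_ne_zero one_ne_zero]
      change c (a ⊗ₜ b) = 0
      simp [c, h1]
  have := hc z
  rw [hz] at this
  simpa [c] using this

/-! ### Invariant functionals on representations -/

section Representations

variable {k : Type u} [Field k] {H : Type u} [CommRing H] [HopfAlgebra k H]
  {V : Type u} [AddCommGroup V] [Module k V]

/-- The contraction of a tensor with a functional on the first factor. -/
def contractLeft {k : Type*} [Field k] {V : Type*} [AddCommGroup V] [Module k V] (H : Type*)
    [AddCommGroup H] [Module k H] (μ : V →ₗ[k] k) : V ⊗[k] H →ₗ[k] H :=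
  (TensorProduct.lid k H).toLinearMap ∘ₗ μ.rTensor H

@[simp]
theorem contractLeft_tmul {k : Type*} [Field k] {V : Type*} [AddCommGroup V] [Module k V]
    {H : Type*} [AddCommGroup H] [Module k H] (μ : V →ₗ[k] k) (v : V) (h : H) :
    contractLeft H μ (v ⊗ₜ h) = μ v • h := by
  simp [contractLeft]

theorem contractLeft_rTensor {k : Type*} [Field k] {V V' : Type*} [AddCommGroup V] [Module k V]
    [AddCommGroup V'] [Module k V'] {H : Type*} [AddCommGroup H] [Module k H] (μ : V →ₗ[k] k)
    (f : V' →ₗ[k] V) (x : V' ⊗[k] H) :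
    contractLeft H μ (f.rTensor H x) = contractLeft H (μ ∘ₗ f) x := by
  rw [contractLeft, contractLeft, LinearMap.comp_apply, LinearMap.comp_apply,
    LinearMap.rTensor_comp_apply]

theorem contractLeft_eq_zero_of_mem_range {V' : Type*} [AddCommGroup V'] [Module k V']
    {μ : V →ₗ[k] k} {f : V' →ₗ[k] V} (h : μ ∘ₗ f = 0) {x : V ⊗[k] H}
    (hx : x ∈ LinearMap.range (f.rTensor H)) : contractLeft H μ x = 0 := by
  obtain ⟨y, rfl⟩ := hx
  rw [contractLeft_rTensor, h, contractLeft]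
  simp

/-- A functional on a representation is invariant. -/
def GroupRep.IsInvariant (ρ : GroupRep k H V) (μ : V →ₗ[k] k) : Prop :=
  ∀ v, contractLeft H μ (ρ.coact v) = algebraMap k H (μ v)

/-- A nonzero invariant vector is detected by an invariant functional. -/
theorem IsLinearlyReductive.exists_isInvariant (hG : IsLinearlyReductive k H) [Module.Finite k V]
    (ρ : GroupRep k H V) {v : V} (hv : v ≠ 0) (hinv : ρ.coact v = v ⊗ₜ 1) :
    ∃ μ : V →ₗ[k] k, ρ.IsInvariant μ ∧ μ v = 1 := by
  obtain ⟨W, hW, hc⟩ := hG V ρ (k ∙ v) (by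
    intro w hw
    obtain ⟨c, rfl⟩ := Submodule.mem_span_singleton.1 hw
    refine ⟨⟨c • v, hw⟩ ⊗ₜ 1, ?_⟩
    simp [hinv, TensorProduct.smul_tmul'])
  let e := LinearEquiv.toSpanNonzeroSingleton k V v hv
  let μ : V →ₗ[k] k := e.symm.toLinearMap ∘ₗ Submodule.projectionOnto (k ∙ v) W hc
  have hμv : μ v = 1 := by
    have h1 : Submodule.projectionOnto (k ∙ v) W hc v = e 1 := by
      have := Submodule.projectionOnto_apply_left hc (e 1)
      rwa [show ((e 1 : k ∙ v) : V) = v by simp [e]] at this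
    simp [μ, h1]
  have hμW : μ ∘ₗ W.subtype = 0 := by
    ext w
    simp [μ]
  refine ⟨μ, fun x => ?_, hμv⟩
  obtain ⟨y, hy, w, hw, rfl⟩ := Submodule.mem_sup.1 (hc.sup_eq_top ▸ Submodule.mem_top (x := x))
  obtain ⟨c, rfl⟩ := Submodule.mem_span_singleton.1 hy
  have hw0 : μ w = 0 := LinearMap.congr_fun hμW ⟨w, hw⟩
  rw [map_add, map_add, contractLeft_eq_zero_of_mem_range hμW (hW w hw), map_add, hw0, map_smul,
    map_smul, hinv, contractLeft_tmul, hμv, map_smul, hμv]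
  simp [Algebra.algebraMap_eq_smul_one]

/-- A nonzero invariant functional takes the value `1` at an invariant vector. -/
theorem IsLinearlyReductive.exists_coact_eq (hG : IsLinearlyReductive k H) [Module.Finite k V]
    (ρ : GroupRep k H V) {μ : V →ₗ[k] k} (hμ : ρ.IsInvariant μ) (h0 : μ ≠ 0) :
    ∃ w, ρ.coact w = w ⊗ₜ 1 ∧ μ w = 1 := by
  have hsurj : Function.Surjective μ := LinearMap.surjective h0
  have hex : Function.Exact (LinearMap.ker μ).subtype μ := by
    intro x
    simp
  -- An invariant complement of the hyperplane `ker μ` is embedded by `μ` into the trivial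
  -- representation, so the group acts trivially on it.
  obtain ⟨W, hW, hc⟩ := hG V ρ (LinearMap.ker μ) (by
    intro w hw
    refine (rTensor_exact H hex hsurj _).1 ?_
    have := hμ w
    rw [LinearMap.mem_ker.1 hw, map_zero, contractLeft, LinearMap.comp_apply] at this
    exact (TensorProduct.lid k H).map_eq_zero_iff.1 this)
  obtain ⟨x, hx⟩ := hsurj 1
  obtain ⟨y, hy, w, hw, rfl⟩ := Submodule.mem_sup.1 (hc.sup_eq_top ▸ Submodule.mem_top (x := x))
  rw [map_add, LinearMap.mem_ker.1 hy, zero_add] at hx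
  refine ⟨w, ?_, hx⟩
  obtain ⟨z, hz⟩ := hW w hw
  have hinj : Function.Injective (μ ∘ₗ W.subtype) := by
    rw [← LinearMap.ker_eq_bot, LinearMap.ker_eq_bot']
    intro m hm
    exact Subtype.ext ((Submodule.disjoint_def.1 hc.disjoint) m (LinearMap.mem_ker.2 hm) m.2)
  have hinj' : Function.Injective ((μ ∘ₗ W.subtype).rTensor H) :=
    Module.Flat.rTensor_preserves_injective_linearMap _ hinj
  have : z = ⟨w, hw⟩ ⊗ₜ 1 := by
    apply hinj'
    apply (TensorProduct.lid k H).injective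
    have h1 := hμ w
    rw [← hz, hx, map_one, contractLeft_rTensor] at h1
    exact h1.trans (by simp [hx])
  rw [← hz, this]
  simp

end Representations

/-! ### Finite-dimensional subcomodules and the Haar integral -/

section Haar

open Coalgebra

variable {k : Type u} [Field k] {H : Type u} [CommRing H] [HopfAlgebra k H]

/-- The contraction of a tensor with a functional on the second factor. -/
def contractRight {k : Type*} [Field k] (V : Type*) [AddCommGroup V] [Module k V] {H : Type*}
    [AddCommGroup H] [Module k H] (f : H →ₗ[k] k) : V ⊗[k] H →ₗ[k] V :=
  (TensorProduct.rid k V).toLinearMap ∘ₗ f.lTensor V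

@[simp]
theorem contractRight_tmul {k : Type*} [Field k] {V : Type*} [AddCommGroup V] [Module k V]
    {H : Type*} [AddCommGroup H] [Module k H] (f : H →ₗ[k] k) (v : V) (h : H) :
    contractRight V f (v ⊗ₜ h) = f h • v := by
  simp [contractRight]

/-- In `(V ⧸ W) ⊗ H` the coefficients with respect to a basis of `H` are contractions with the
coordinate functionals. -/
theorem mem_range_rTensor_of_contractRight_mem {k : Type*} [Field k] {V : Type*} [AddCommGroup V]
    [Module k V] {H : Type*} [AddCommGroup H] [Module k H] (W : Submodule k V) (x : V ⊗[k] H)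
    (h : ∀ f : H →ₗ[k] k, contractRight V f x ∈ W) :
    x ∈ LinearMap.range (W.subtype.rTensor H) := by
  have hex : Function.Exact W.subtype W.mkQ := LinearMap.exact_subtype_mkQ W
  refine (rTensor_exact H hex W.mkQ_surjective x).1 ?_
  set y := W.mkQ.rTensor H x with hy
  have hf : ∀ f : H →ₗ[k] k, contractRight (V ⧸ W) f y = 0 := by
    intro f
    have : contractRight (V ⧸ W) f y = W.mkQ (contractRight V f x) := by
      rw [hy]
      clear hy y h
      induction x using TensorProduct.induction_on with
      | zero => simp
      | add a b ha hb => rw [map_add, map_add, ha, hb, map_add, map_add]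
      | tmul a b => simp
    rw [this, Submodule.mkQ_apply, Submodule.Quotient.mk_eq_zero]
    exact h f
  clear_value y
  let b := Module.Basis.ofVectorSpace k H
  obtain ⟨c, rfl⟩ := TensorProduct.eq_repr_basis_right b y
  refine Finset.sum_eq_zero fun i _ => ?_
  have := hf (b.coord i)
  rw [map_finsuppSum] at this
  simp only [contractRight_tmul, Module.Basis.coord_apply, Module.Basis.repr_self] at this
  have h1 : c i = 0 := by
    rw [← this]
    classical
    rw [Finsupp.sum, Finset.sum_eq_single i]
    · simp
    · intro j _ hj
      rw [Finsupp.single_eq_of_ne hj.symm, zero_smul]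
    · intro hi
      simpa using hi
  beta_reduce
  rw [h1, TensorProduct.zero_tmul]

/-- A subspace of a Hopf algebra is a (right) subcomodule. -/
def IsSubcomodule (C : Submodule k H) : Prop :=
  ∀ c ∈ C, comul (R := k) c ∈ LinearMap.range (C.subtype.rTensor H)

theorem contractRight_mem_of_finite {V : Type*} [AddCommGroup V] [Module k V] (x : V ⊗[k] H) :
    ∃ W : Submodule k V, Module.Finite k W ∧ ∀ f : H →ₗ[k] k, contractRight V f x ∈ W := by
  induction x using TensorProduct.induction_on with
  | zero => exact ⟨⊥, inferInstance, fun f => by rw [map_zero]; exact Submodule.zero_mem _⟩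
  | add a b ha hb =>
    obtain ⟨W, _, hW⟩ := ha
    obtain ⟨W', _, hW'⟩ := hb
    refine ⟨W ⊔ W', Submodule.finite_sup W W', fun f => ?_⟩
    rw [map_add]
    exact Submodule.add_mem_sup (hW f) (hW' f)
  | tmul a b =>
    refine ⟨k ∙ a, inferInstance, fun f => ?_⟩
    rw [contractRight_tmul]
    exact Submodule.smul_mem _ _ (Submodule.mem_span_singleton_self a)

/-- Every element of a Hopf algebra is contained in a finite-dimensional subcomodule. -/
theorem exists_isSubcomodule (h : H) :
    ∃ C : Submodule k H, Module.Finite k C ∧ h ∈ C ∧ IsSubcomodule C := by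
  -- All contractions of the comultiplication of `h` in its second factor. The counit shows that `h`
  -- is among them, coassociativity that they form a subcomodule.
  let C : Submodule k H := LinearMap.range
    (({ toFun := fun f => contractRight H f (comul (R := k) h)
        map_add' := fun f g => by simp [contractRight, LinearMap.lTensor_add]
        map_smul' := fun c f => by simp [contractRight, LinearMap.lTensor_smul] } :
      (H →ₗ[k] k) →ₗ[k] H))
  have hC : ∀ c, c ∈ C ↔ ∃ f : H →ₗ[k] k, contractRight H f (comul (R := k) h) = c :=
    fun c => Iff.rfl
  refine ⟨C, ?_, (hC _).2 ⟨counit, ?_⟩, ?_⟩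
  · obtain ⟨W, _, hW⟩ := contractRight_mem_of_finite (comul (R := k) h)
    refine Submodule.finiteDimensional_of_le (S₂ := W) fun c hc => ?_
    obtain ⟨f, rfl⟩ := (hC c).1 hc
    exact hW f
  · rw [contractRight, LinearMap.comp_apply, Coalgebra.lTensor_counit_comul]
    simp
  · intro c hc
    obtain ⟨f, rfl⟩ := (hC c).1 hc
    refine mem_range_rTensor_of_contractRight_mem C _ fun g => ?_
    let φ : H ⊗[k] H →ₗ[k] k := (TensorProduct.lid k k).toLinearMap ∘ₗ (TensorProduct.map g f)
    refine (hC _).2 ⟨φ ∘ₗ comul (R := k), ?_⟩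
    have h1 : ∀ x : H ⊗[k] H, comul (R := k) (contractRight H f x) =
        contractRight (H ⊗[k] H) f ((comul (R := k)).rTensor H x) := by
      intro x
      induction x using TensorProduct.induction_on with
      | zero => simp
      | add a b ha hb => simp only [map_add, ha, hb]
      | tmul a b => simp
    have h2 : ∀ y : H ⊗[k] (H ⊗[k] H), contractRight H g (contractRight (H ⊗[k] H) f
        ((TensorProduct.assoc k H H H).symm y)) = contractRight H φ y := by
      intro y
      induction y using TensorProduct.induction_on with
      | zero => simp
      | add a b ha hb => simp only [map_add, ha, hb]
      | tmul a b =>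
        induction b using TensorProduct.induction_on with
        | zero => simp
        | add b c hb hc => simp only [map_add, TensorProduct.tmul_add, hb, hc]
        | tmul b c => simp [φ, smul_smul, mul_comm]
    have h3 : ∀ x : H ⊗[k] H, contractRight H φ ((comul (R := k)).lTensor H x) =
        contractRight H (φ ∘ₗ comul (R := k)) x := by
      intro x
      rw [contractRight, contractRight, LinearMap.comp_apply, LinearMap.comp_apply,
        LinearMap.lTensor_comp_apply H φ]
    rw [h1, ← Coalgebra.coassoc_symm_apply, h2, h3]

theorem range_rTensor_mono {C D : Submodule k H} (h : C ≤ D) :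
    LinearMap.range (C.subtype.rTensor H) ≤ LinearMap.range (D.subtype.rTensor H) := by
  have : C.subtype.rTensor H = D.subtype.rTensor H ∘ₗ (Submodule.inclusion h).rTensor H := by
    rw [← LinearMap.rTensor_comp]
    rfl
  rw [this]
  exact LinearMap.range_comp_le_range _ _

theorem IsSubcomodule.sup {C D : Submodule k H} (hC : IsSubcomodule C) (hD : IsSubcomodule D) :
    IsSubcomodule (C ⊔ D) := by
  intro x hx
  obtain ⟨c, hc, d, hd, rfl⟩ := Submodule.mem_sup.1 hx
  rw [map_add]
  exact Submodule.add_mem _ (range_rTensor_mono le_sup_left (hC c hc))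
    (range_rTensor_mono le_sup_right (hD d hd))

theorem rTensor_subtype_injective (C : Submodule k H) (M : Type*) [AddCommGroup M] [Module k M] :
    Function.Injective (C.subtype.rTensor M) :=
  Module.Flat.rTensor_preserves_injective_linearMap _ C.subtype_injective

/-- The coaction on a subcomodule. -/
def IsSubcomodule.coact {C : Submodule k H} (hC : IsSubcomodule C) : C →ₗ[k] C ⊗[k] H :=
  (LinearEquiv.ofInjective _ (rTensor_subtype_injective C H)).symm.toLinearMap ∘ₗ
    LinearMap.codRestrict _ (comul (R := k) ∘ₗ C.subtype) fun c => hC c c.2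

theorem IsSubcomodule.rTensor_coact {C : Submodule k H} (hC : IsSubcomodule C) (c : C) :
    C.subtype.rTensor H (hC.coact c) = comul (R := k) (c : H) :=
  congrArg Subtype.val ((LinearEquiv.ofInjective _ (rTensor_subtype_injective C H)).apply_symm_apply
    (LinearMap.codRestrict _ (comul (R := k) ∘ₗ C.subtype) (fun c => hC c c.2) c))

/-- A subcomodule as a representation. -/
def IsSubcomodule.groupRep {C : Submodule k H} (hC : IsSubcomodule C) : GroupRep k H C where
  coact := hC.coact
  coassoc := by
    ext c
    apply rTensor_subtype_injective C (H ⊗[k] H)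
    have h1 : ∀ x : (C ⊗[k] H) ⊗[k] H, C.subtype.rTensor (H ⊗[k] H)
        (TensorProduct.assoc k C H H x) =
        TensorProduct.assoc k H H H ((C.subtype.rTensor H).rTensor H x) := by
      intro x
      induction x using TensorProduct.induction_on with
      | zero => simp
      | add a b ha hb => simp only [map_add, ha, hb]
      | tmul a b =>
        induction a using TensorProduct.induction_on with
        | zero => simp
        | add a c ha hc => simp only [map_add, TensorProduct.add_tmul, ha, hc]
        | tmul a c => simp
    have h2 : C.subtype.rTensor H ∘ₗ hC.coact = comul (R := k) ∘ₗ C.subtype :=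
      LinearMap.ext hC.rTensor_coact
    have h3 : ∀ x : C ⊗[k] H, C.subtype.rTensor (H ⊗[k] H) ((comul (R := k)).lTensor C x) =
        (comul (R := k)).lTensor H (C.subtype.rTensor H x) := by
      intro x
      induction x using TensorProduct.induction_on with
      | zero => simp
      | add a b ha hb => simp only [map_add, ha, hb]
      | tmul a b => simp
    change C.subtype.rTensor (H ⊗[k] H) (TensorProduct.assoc k C H H
      (hC.coact.rTensor H (hC.coact c))) = C.subtype.rTensor (H ⊗[k] H)
      ((comul (R := k)).lTensor C (hC.coact c))
    rw [h1, h3, hC.rTensor_coact, ← LinearMap.rTensor_comp_apply, h2, LinearMap.rTensor_comp_apply,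
      hC.rTensor_coact, Coalgebra.coassoc_apply]
  counit := by
    ext c
    apply (TensorProduct.rid k C).injective
    have h1 : ∀ x : C ⊗[k] H, ((TensorProduct.rid k C) ((counit (R := k)).lTensor C x) : H) =
        TensorProduct.rid k H ((counit (R := k)).lTensor H (C.subtype.rTensor H x)) := by
      intro x
      induction x using TensorProduct.induction_on with
      | zero => simp
      | add a b ha hb => simp only [map_add, Submodule.coe_add, ha, hb]
      | tmul a b => simp
    apply Subtype.ext
    refine (h1 _).trans ?_
    rw [hC.rTensor_coact, Coalgebra.lTensor_counit_comul]
    simp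

/-- A functional on a subspace of a Hopf algebra is a normalized invariant integral. -/
theorem IsSubcomodule.exists_integral (hG : IsLinearlyReductive k H) {C : Submodule k H}
    [Module.Finite k C] (hC : IsSubcomodule C) (h1 : (1 : H) ∈ C) :
    ∃ μ : C →ₗ[k] k, hC.groupRep.IsInvariant μ ∧ μ ⟨1, h1⟩ = 1 := by
  have : Nontrivial H := by
    refine nontrivial_of_ne (0 : H) 1 fun h => ?_
    have := congrArg (counit (R := k)) h
    simp at this
  refine hG.exists_isInvariant hC.groupRep (v := ⟨1, h1⟩) ?_ ?_
  · exact fun h => one_ne_zero (congrArg Subtype.val h)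
  · apply rTensor_subtype_injective C H
    refine (hC.rTensor_coact _).trans ?_
    simp [Algebra.TensorProduct.one_def]

/-- A nonzero `μ` would take the value `1` at some `w` with comultiplication `w ⊗ 1`. By the counit
such a `w` is a multiple of `1`, where `μ` vanishes. -/
theorem IsSubcomodule.integral_eq_zero (hG : IsLinearlyReductive k H) {C : Submodule k H}
    [Module.Finite k C] (hC : IsSubcomodule C) (h1 : (1 : H) ∈ C) {μ : C →ₗ[k] k}
    (hμ : hC.groupRep.IsInvariant μ) (hμ1 : μ ⟨1, h1⟩ = 0) : μ = 0 := by
  by_contra h0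
  obtain ⟨w, hw, hw1⟩ := hG.exists_coact_eq hC.groupRep hμ h0
  have h2 := congrArg (C.subtype.rTensor H) hw
  have h3 : comul (R := k) (w : H) = (w : H) ⊗ₜ 1 := by
    refine (hC.rTensor_coact w).symm.trans (h2.trans ?_)
    simp
  have h4 := Coalgebra.rTensor_counit_comul (R := k) (w : H)
  rw [h3] at h4
  have h5 := congrArg (TensorProduct.lid k H) h4
  simp only [LinearMap.rTensor_tmul, TensorProduct.lid_tmul, one_smul] at h5
  have h6 : w = counit (R := k) (w : H) • (⟨1, h1⟩ : C) := Subtype.ext h5.symm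
  rw [h6, map_smul, hμ1, smul_zero] at hw1
  exact zero_ne_one hw1

theorem IsSubcomodule.integral_unique (hG : IsLinearlyReductive k H) {C : Submodule k H}
    [Module.Finite k C] (hC : IsSubcomodule C) (h1 : (1 : H) ∈ C) {μ ν : C →ₗ[k] k}
    (hμ : hC.groupRep.IsInvariant μ) (hν : hC.groupRep.IsInvariant ν)
    (h : μ ⟨1, h1⟩ = ν ⟨1, h1⟩) : μ = ν := by
  rw [← sub_eq_zero]
  refine hC.integral_eq_zero hG h1 (fun v => ?_) (by rw [LinearMap.sub_apply, h, sub_self])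
  rw [LinearMap.sub_apply, map_sub, ← hμ, ← hν, contractLeft, contractLeft, contractLeft,
    LinearMap.rTensor_sub]
  simp

theorem IsSubcomodule.isInvariant_comp_inclusion {C D : Submodule k H} (hC : IsSubcomodule C)
    (hD : IsSubcomodule D) (h : C ≤ D) {μ : D →ₗ[k] k} (hμ : hD.groupRep.IsInvariant μ) :
    hC.groupRep.IsInvariant (μ ∘ₗ Submodule.inclusion h) := by
  intro v
  rw [← contractLeft_rTensor]
  refine Eq.trans ?_ (hμ (Submodule.inclusion h v))
  congr 1
  apply rTensor_subtype_injective D H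
  rw [← LinearMap.rTensor_comp_apply]
  exact (hC.rTensor_coact v).trans (hD.rTensor_coact (Submodule.inclusion h v)).symm

/-- A linearly reductive group has a normalized invariant integral. -/
theorem IsLinearlyReductive.exists_integral (hG : IsLinearlyReductive k H) :
    ∃ l : H →ₗ[k] k, l 1 = 1 ∧
      ∀ h, contractLeft H l (comul (R := k) h) = algebraMap k H (l h) := by
  have hex : ∀ h : H, ∃ C : Submodule k H, Module.Finite k C ∧ h ∈ C ∧ 1 ∈ C ∧
      IsSubcomodule C := by
    intro h
    obtain ⟨C, _, hC, hC'⟩ := exists_isSubcomodule (k := k) h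
    obtain ⟨D, _, hD, hD'⟩ := exists_isSubcomodule (k := k) (1 : H)
    exact ⟨C ⊔ D, Submodule.finite_sup C D, le_sup_left (a := C) hC, le_sup_right (a := C) hD,
      hC'.sup hD'⟩
  choose C hfin hmem h1 hC using hex
  choose μ hμ hμ1 using fun h => (hC h).exists_integral hG (h1 h)
  -- At each `h`, use the normalized integral on a chosen finite-dimensional subcomodule containing
  -- `h` and `1`. Uniqueness on the sum of two subcomodules shows that the choice is irrelevant.
  let l : H → k := fun h => μ h ⟨h, hmem h⟩
  have hl : ∀ (D : Submodule k H) [Module.Finite k D] (hD : IsSubcomodule D) (hD1 : (1 : H) ∈ D)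
      (ν : D →ₗ[k] k), hD.groupRep.IsInvariant ν → ν ⟨1, hD1⟩ = 1 → ∀ x : D, l x = ν x := by
    intro D _ hD hD1 ν hν hν1 x
    have hE := (hC x).sup hD
    have hE1 : (1 : H) ∈ C x ⊔ D := le_sup_right (a := C x) hD1
    have := Submodule.finite_sup (C x) D
    obtain ⟨ξ, hξ, hξ1⟩ := hE.exists_integral hG hE1
    have e1 := (hC x).integral_unique hG (h1 x) (hμ x)
      ((hC x).isInvariant_comp_inclusion hE le_sup_left hξ) ((hμ1 x).trans hξ1.symm)
    have e2 := hD.integral_unique hG hD1 hν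
      (hD.isInvariant_comp_inclusion hE le_sup_right hξ) (hν1.trans hξ1.symm)
    change μ x ⟨x, hmem x⟩ = ν x
    rw [e1, e2]
    rfl
  let L : H →ₗ[k] k :=
    { toFun := l
      map_add' := fun x y => by
        have hE := (hC x).sup (hC y)
        have hE1 : (1 : H) ∈ C x ⊔ C y := le_sup_left (a := C x) (h1 x)
        have := Submodule.finite_sup (C x) (C y)
        obtain ⟨ξ, hξ, hξ1⟩ := hE.exists_integral hG hE1
        have hx : x ∈ C x ⊔ C y := le_sup_left (a := C x) (hmem x)
        have hy : y ∈ C x ⊔ C y := le_sup_right (a := C x) (hmem y)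
        have e := hl _ hE hE1 ξ hξ hξ1
        rw [e ⟨x, hx⟩, e ⟨y, hy⟩, ← map_add]
        exact e (⟨x, hx⟩ + ⟨y, hy⟩)
      map_smul' := fun c x => by
        have e := hl _ (hC x) (h1 x) (μ x) (hμ x) (hμ1 x)
        exact (e (c • ⟨x, hmem x⟩)).trans (map_smul _ _ _) }
  refine ⟨L, hl _ (hC 1) (h1 1) (μ 1) (hμ 1) (hμ1 1) ⟨1, h1 1⟩ |>.trans (hμ1 1), fun h => ?_⟩
  have e : L ∘ₗ (C h).subtype = μ h :=
    LinearMap.ext (hl _ (hC h) (h1 h) (μ h) (hμ h) (hμ1 h))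
  rw [← (hC h).rTensor_coact ⟨h, hmem h⟩, contractLeft_rTensor, e]
  exact hμ h ⟨h, hmem h⟩

theorem IsLinearlyReductive.integral_unique (hG : IsLinearlyReductive k H) {l m : H →ₗ[k] k}
    (hl : ∀ h, contractLeft H l (comul (R := k) h) = algebraMap k H (l h))
    (hm : ∀ h, contractLeft H m (comul (R := k) h) = algebraMap k H (m h))
    (h1 : l 1 = m 1) : l = m := by
  ext h
  obtain ⟨C, _, hC, hC'⟩ := exists_isSubcomodule (k := k) h
  obtain ⟨D, _, hD, hD'⟩ := exists_isSubcomodule (k := k) (1 : H)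
  have hE := hC'.sup hD'
  have := Submodule.finite_sup C D
  have key : ∀ n : H →ₗ[k] k, (∀ h, contractLeft H n (comul (R := k) h) = algebraMap k H (n h)) →
      hE.groupRep.IsInvariant (n ∘ₗ (C ⊔ D).subtype) := by
    intro n hn v
    rw [← contractLeft_rTensor]
    exact (congrArg _ (hE.rTensor_coact v)).trans (hn v)
  exact LinearMap.congr_fun (hE.integral_unique hG (le_sup_right (a := C) hD) (key l hl) (key m hm)
    h1) ⟨h, le_sup_left (a := C) hC⟩

theorem add_pow_of_natCast_eq_zero {p : ℕ} [Fact p.Prime] {R : Type*} [CommRing R]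
    (h : (p : R) = 0) (x y : R) : (x + y) ^ p = x ^ p + y ^ p := by
  rw [add_pow_eq_addDefect, h, zero_mul, add_zero]

theorem natCast_eq_zero_of_algebra {p : ℕ} (k : Type*) [Field k] [CharP k p] (R : Type*)
    [CommRing R] [Algebra k R] : (p : R) = 0 := by
  rw [← map_natCast (algebraMap k R), CharP.cast_eq_zero, map_zero]

/-- The invariant integral of a smooth linearly reductive group commutes with the Frobenius. -/
theorem IsLinearlyReductive.integral_pow (hG : IsLinearlyReductive k H) {p : ℕ} [hp : Fact p.Prime]
    [CharP k p] [PerfectField k] [Algebra.Smooth k H] {l : H →ₗ[k] k} (hl1 : l 1 = 1)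
    (hl : ∀ h, contractLeft H l (comul (R := k) h) = algebraMap k H (l h)) (h : H) :
    l (h ^ p) = l h ^ p := by
  have : ExpChar k p := .prime hp.out
  have hperf : PerfectRing k p := PerfectField.toPerfectRing p
  have hred : IsReduced H := isReduced_of_smooth k H
  have : Nontrivial H := by
    refine nontrivial_of_ne (0 : H) 1 fun h => ?_
    have := congrArg (counit (R := k)) h
    simp at this
  have : CharP H p := charP_of_injective_algebraMap (algebraMap k H).injective p
  have hpow : ∀ c : k, ((frobeniusEquiv k p).symm c) ^ p = c := fun c =>
    (frobeniusEquiv k p).apply_symm_apply c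
  have hinj : ∀ a b : k, a ^ p = b ^ p → a = b := fun a b hab => (frobeniusEquiv k p).injective hab
  -- The Frobenius twist `x ↦ l (x ^ p) ^ (1 / p)`, linear because `k` is perfect. Its invariance
  -- may be checked on `p`-th powers since `H` is reduced, and uniqueness of the integral then gives
  -- `d = l`.
  let d : H →ₗ[k] k :=
    { toFun := fun x => (frobeniusEquiv k p).symm (l (x ^ p))
      map_add' := fun x y => by
        rw [add_pow_of_natCast_eq_zero (natCast_eq_zero_of_algebra k H), map_add, map_add]
      map_smul' := fun c x => by
        apply hinj
        rw [hpow, smul_pow, map_smul, RingHom.id_apply, smul_eq_mul, smul_eq_mul, mul_pow, hpow] }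
  have hd : ∀ x, d x ^ p = l (x ^ p) := fun x => hpow _
  have key : ∀ x : H ⊗[k] H, contractLeft H d x ^ p = contractLeft H l (x ^ p) := by
    intro x
    induction x using TensorProduct.induction_on with
    | zero => simp [hp.out.ne_zero]
    | add a b ha hb =>
      rw [map_add, add_pow_of_natCast_eq_zero (natCast_eq_zero_of_algebra k H), ha, hb,
        add_pow_of_natCast_eq_zero (natCast_eq_zero_of_algebra k (H ⊗[k] H)), map_add]
    | tmul a b =>
      rw [contractLeft_tmul, Algebra.TensorProduct.tmul_pow, contractLeft_tmul, smul_pow, hd]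
  have hdl : d = l := by
    refine hG.integral_unique (fun x => ?_) hl ?_
    · apply frobenius_inj H p
      rw [frobenius_def, frobenius_def, key, ← map_pow (algebraMap k H), hd, ← hl, Bialgebra.comul_pow]
    · apply hinj
      rw [hd, hl1, one_pow, one_pow, hl1]
  rw [← hd, hdl]

end Haar

end

section

/-! ### The Reynolds operator of a coaction -/

section Reynolds

open Coalgebra

variable {k : Type u} [Field k] {H : Type u} [CommRing H] [HopfAlgebra k H]
  {A : Type u} [CommRing A] [Algebra k A]

/-- The subring of invariants of a coaction. -/
def coinvariants (c : A →ₐ[k] H ⊗[k] A) : Subring A :=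
  RingHom.eqLocus (c : A →+* H ⊗[k] A)
    (Algebra.TensorProduct.includeRight : A →ₐ[k] H ⊗[k] A).toRingHom

theorem mem_coinvariants {c : A →ₐ[k] H ⊗[k] A} {a : A} : a ∈ coinvariants c ↔ c a = 1 ⊗ₜ a :=
  Iff.rfl

/-- The Reynolds operator defined by an invariant integral. -/
def reynolds (l : H →ₗ[k] k) (c : A →ₐ[k] H ⊗[k] A) : A →+ A :=
  (contractLeft A l ∘ₗ c.toLinearMap).toAddMonoidHom

theorem reynolds_apply (l : H →ₗ[k] k) (c : A →ₐ[k] H ⊗[k] A) (a : A) :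
    reynolds l c a = contractLeft A l (c a) := rfl

/-- A coaction of a Hopf algebra is coassociative. -/
def IsCoassoc (c : A →ₐ[k] H ⊗[k] A) : Prop :=
  ∀ a, c.toLinearMap.lTensor H (c a) =
    TensorProduct.assoc k H H A ((comul (R := k)).rTensor A (c a))

theorem contractLeft_one_tmul_mul (l : H →ₗ[k] k) (b : A) (x : H ⊗[k] A) :
    contractLeft A l ((1 ⊗ₜ b) * x) = b * contractLeft A l x := by
  induction x using TensorProduct.induction_on with
  | zero => simp
  | add x y hx hy => rw [mul_add, map_add, hx, hy, map_add, mul_add]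
  | tmul h a => simp

theorem isReynolds_reynolds {p : ℕ} [hp : Fact p.Prime] [CharP k p] {l : H →ₗ[k] k} (hl1 : l 1 = 1)
    (hl : ∀ h, contractLeft H l (comul (R := k) h) = algebraMap k H (l h))
    (hlp : ∀ h, l (h ^ p) = l h ^ p) {c : A →ₐ[k] H ⊗[k] A} (hc : IsCoassoc c) :
    IsReynolds p (coinvariants c) (reynolds l c) where
  mem a := by
    rw [mem_coinvariants, reynolds_apply]
    have h1 : ∀ x : H ⊗[k] A, c (contractLeft A l x) =
        contractLeft (H ⊗[k] A) l (c.toLinearMap.lTensor H x) := by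
      intro x
      induction x using TensorProduct.induction_on with
      | zero => simp
      | add x y hx hy => simp only [map_add, hx, hy]
      | tmul h a => simp
    have h2 : ∀ x : H ⊗[k] A, contractLeft (H ⊗[k] A) l
        (TensorProduct.assoc k H H A ((comul (R := k)).rTensor A x)) =
        1 ⊗ₜ contractLeft A l x := by
      intro x
      induction x using TensorProduct.induction_on with
      | zero => simp
      | add x y hx hy => simp only [map_add, hx, hy, TensorProduct.tmul_add]
      | tmul h a =>
        have h3 : ∀ y : H ⊗[k] H, contractLeft (H ⊗[k] A) l (TensorProduct.assoc k H H A (y ⊗ₜ a)) =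
            contractLeft H l y ⊗ₜ a := by
          intro y
          induction y using TensorProduct.induction_on with
          | zero => simp
          | add x y hx hy => simp only [map_add, TensorProduct.add_tmul, hx, hy]
          | tmul h h' => simp [TensorProduct.smul_tmul']
        rw [LinearMap.rTensor_tmul, h3, hl, contractLeft_tmul, Algebra.algebraMap_eq_smul_one,
          TensorProduct.smul_tmul]
    -- By coassociativity the coaction of an average is the average of a comultiplication, and
    -- invariance of `l` makes that constant in the group variable.
    rw [h1, hc, h2]
  map_mul b hb a := by
    rw [reynolds_apply, map_mul, mem_coinvariants.1 hb, contractLeft_one_tmul_mul, reynolds_apply]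
  map_one := by
    rw [reynolds_apply, map_one, Algebra.TensorProduct.one_def, contractLeft_tmul, hl1, one_smul]
  map_pow a := by
    rw [reynolds_apply, reynolds_apply, map_pow]
    generalize c a = x
    induction x using TensorProduct.induction_on with
    | zero => simp [hp.out.ne_zero]
    | add a b ha hb =>
      rw [map_add, add_pow_of_natCast_eq_zero (natCast_eq_zero_of_algebra k A), ← ha, ← hb,
        add_pow_of_natCast_eq_zero (natCast_eq_zero_of_algebra k (H ⊗[k] A)), map_add]
    | tmul a b =>
      rw [contractLeft_tmul, Algebra.TensorProduct.tmul_pow, contractLeft_tmul, smul_pow, hlp]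

theorem reynolds_map {A' : Type u} [CommRing A'] [Algebra k A'] (l : H →ₗ[k] k)
    {c : A →ₐ[k] H ⊗[k] A} {c' : A' →ₐ[k] H ⊗[k] A'} (f : A →ₐ[k] A')
    (h : ∀ a, c' (f a) = Algebra.TensorProduct.map (AlgHom.id k H) f (c a)) (a : A) :
    reynolds l c' (f a) = f (reynolds l c a) := by
  rw [reynolds_apply, reynolds_apply, h]
  generalize c a = x
  induction x using TensorProduct.induction_on with
  | zero => simp
  | add a b ha hb => simp only [map_add, ha, hb]
  | tmul a b => simp

end Reynolds

end

section

/-! ### The coaction on the sections over an invariant affine open -/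

section Coaction

open scoped MonObj

variable {k : Type u} [Field k] {H : Type u} [CommRing H] [HopfAlgebra k H]

/-- The sections of a `k`-scheme form a `k`-algebra. -/
@[reducible]
def sectionsAlgebra (Y : Over (Spec (.of k))) (V : Y.left.Opens) : Algebra k Γ(Y.left, V) :=
  ((Scheme.ΓSpecIso (.of k)).inv ≫ Y.hom.appLE ⊤ V le_top).hom.toAlgebra

attribute [local instance] sectionsAlgebra

/-- The spectrum of a `k`-algebra, as a `k`-scheme. -/
def specOver (k : Type u) [Field k] (R : Type u) [CommRing R] [Algebra k R] : Over (Spec (.of k)) :=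
  Over.mk (Spec.map (CommRingCat.ofHom (algebraMap k R)))

variable {R R' : Type u} [CommRing R] [Algebra k R] [CommRing R'] [Algebra k R']

/-- The morphism of spectra defined by a homomorphism of `k`-algebras. -/
def specOverMap (g : R →ₐ[k] R') : specOver k R' ⟶ specOver k R :=
  Over.homMk (Spec.map (CommRingCat.ofHom g.toRingHom)) (by
    change Spec.map _ ≫ Spec.map _ = Spec.map _
    rw [← Spec.map_comp, ← CommRingCat.ofHom_comp]
    congr 2
    exact g.comp_algebraMap)

/-- The point of `Spec H` defined by a homomorphism of `k`-algebras. -/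
def groupPoint (α : H →ₐ[k] R) : specOver k R ⟶ groupOf k H :=
  Over.homMk (Spec.map (CommRingCat.ofHom α.toRingHom)) (by
    change Spec.map _ ≫ Spec.map _ = Spec.map _
    rw [← Spec.map_comp, ← CommRingCat.ofHom_comp]
    congr 2
    exact α.comp_algebraMap)

variable {Y : Over (Spec (.of k))} {V : Y.left.Opens} (hV : IsAffineOpen V)

theorem fromSpec_comp_hom :
    hV.fromSpec ≫ Y.hom = Spec.map (CommRingCat.ofHom (algebraMap k Γ(Y.left, V))) := by
  have h := IsAffineOpen.SpecMap_appLE_fromSpec Y.hom (isAffineOpen_top (Spec (.of k))) hV le_top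
  rw [IsAffineOpen.fromSpec_top, Scheme.isoSpec_Spec_inv, ← Spec.map_comp] at h
  exact h.symm

/-- The point of a scheme defined by a homomorphism out of the sections over an affine open. -/
def affinePoint (β : Γ(Y.left, V) →ₐ[k] R) : specOver k R ⟶ Y :=
  Over.homMk (Spec.map (CommRingCat.ofHom β.toRingHom) ≫ hV.fromSpec) (by
    refine (Category.assoc _ _ _).trans ((congrArg _ (fromSpec_comp_hom hV)).trans ?_)
    change Spec.map _ ≫ Spec.map _ = Spec.map _
    rw [← Spec.map_comp, ← CommRingCat.ofHom_comp]
    congr 2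
    exact β.comp_algebraMap)

theorem affinePoint_injective {β β' : Γ(Y.left, V) →ₐ[k] R}
    (h : affinePoint hV β = affinePoint hV β') : β = β' := by
  have h1 := congrArg CommaMorphism.left h
  change Spec.map _ ≫ hV.fromSpec = Spec.map _ ≫ hV.fromSpec at h1
  rw [cancel_mono] at h1
  have h2 := Spec.map_injective h1
  exact AlgHom.ext fun x => congrArg (fun f => CommRingCat.Hom.hom f x) h2

theorem specOverMap_affinePoint (g : R →ₐ[k] R') (β : Γ(Y.left, V) →ₐ[k] R) :
    specOverMap g ≫ affinePoint hV β = affinePoint hV (g.comp β) := by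
  ext : 1
  change Spec.map _ ≫ Spec.map _ ≫ hV.fromSpec = Spec.map _ ≫ hV.fromSpec
  rw [← Spec.map_comp_assoc]
  rfl

theorem specOverMap_groupPoint (g : R →ₐ[k] R') (α : H →ₐ[k] R) :
    specOverMap g ≫ groupPoint α = groupPoint (g.comp α) := by
  ext : 1
  change Spec.map _ ≫ Spec.map _ = Spec.map _
  rw [← Spec.map_comp]
  rfl

/-- Points landing in an affine open are algebra homomorphisms, so the group action there can be
translated into Hopf-algebraic terms by evaluating it on universal points. -/
theorem exists_affinePoint (x : specOver k R ⟶ Y) (hx : ∀ z, x.left z ∈ V) :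
    ∃ β : Γ(Y.left, V) →ₐ[k] R, x = affinePoint hV β := by
  have hr : Set.range x.left ⊆ Set.range hV.fromSpec := by
    rw [hV.range_fromSpec]
    rintro _ ⟨z, rfl⟩
    exact hx z
  let f : Spec (.of R) ⟶ Spec Γ(Y.left, V) := IsOpenImmersion.lift hV.fromSpec x.left hr
  have hf : f ≫ hV.fromSpec = x.left := IsOpenImmersion.lift_fac _ _ _
  have hk : CommRingCat.ofHom (algebraMap k Γ(Y.left, V)) ≫ Spec.preimage f =
      CommRingCat.ofHom (algebraMap k R) := by
    apply Spec.map_injective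
    rw [Spec.map_comp, Spec.map_preimage, ← fromSpec_comp_hom hV, ← Category.assoc, hf]
    exact Over.w x
  refine ⟨⟨(Spec.preimage f).hom, fun c => congrArg (fun f => CommRingCat.Hom.hom f c) hk⟩, ?_⟩
  ext : 1
  change x.left = Spec.map (Spec.preimage f) ≫ hV.fromSpec
  rw [Spec.map_preimage, hf]

theorem lift_comp_pullbackSpecIso_hom (α α' : H →ₐ[k] R)
    (w : Spec.map (CommRingCat.ofHom α.toRingHom) ≫ Spec.map (CommRingCat.ofHom (algebraMap k H)) =
      Spec.map (CommRingCat.ofHom α'.toRingHom) ≫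
        Spec.map (CommRingCat.ofHom (algebraMap k H))) :
    pullback.lift (Spec.map (CommRingCat.ofHom α.toRingHom))
      (Spec.map (CommRingCat.ofHom α'.toRingHom)) w ≫ (pullbackSpecIso k H H).hom =
    Spec.map (CommRingCat.ofHom
      (Algebra.TensorProduct.lift α α' fun _ _ => Commute.all _ _).toRingHom) := by
  rw [← Iso.eq_comp_inv]
  apply pullback.hom_ext
  · rw [pullback.lift_fst, Category.assoc, pullbackSpecIso_inv_fst, ← Spec.map_comp,
      ← CommRingCat.ofHom_comp]
    congr 2
    ext x
    simp
  · rw [pullback.lift_snd, Category.assoc, pullbackSpecIso_inv_snd, ← Spec.map_comp,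
      ← CommRingCat.ofHom_comp]
    congr 2
    ext x
    simp

theorem mul_groupPoint (α α' : H →ₐ[k] R) : groupPoint α * groupPoint α' =
    groupPoint ((Algebra.TensorProduct.lift α α' fun _ _ => Commute.all _ _).comp
      (Bialgebra.comulAlgHom k H)) := by
  ext : 1
  have w : Spec.map (CommRingCat.ofHom α.toRingHom) ≫
      Spec.map (CommRingCat.ofHom (algebraMap k H)) =
      Spec.map (CommRingCat.ofHom α'.toRingHom) ≫
        Spec.map (CommRingCat.ofHom (algebraMap k H)) :=
    (Over.w (groupPoint α)).trans (Over.w (groupPoint α')).symm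
  have h1 : (CartesianMonoidalCategory.lift (groupPoint α) (groupPoint α')).left =
      pullback.lift (Spec.map (CommRingCat.ofHom α.toRingHom))
        (Spec.map (CommRingCat.ofHom α'.toRingHom)) w := rfl
  have h2 : (groupPoint α * groupPoint α').left =
      (CartesianMonoidalCategory.lift (groupPoint α) (groupPoint α')).left ≫
        (MonObj.mul (X := groupOf k H)).left := rfl
  have h3 := mul_spec_asOver_spec_left (R := .of k) (A := .of H)
  refine h2.trans ((congrArg₂ (fun f g => f ≫ g) h1 h3).trans ?_)
  refine (Category.assoc _ _ _).symm.trans ?_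
  refine (congrArg (fun f => f ≫ Spec.map _) (lift_comp_pullbackSpecIso_hom α α' w)).trans ?_
  exact (Spec.map_comp _ _).symm

variable [ModObj (groupOf k H) Y]

theorem smul_eq_lift_act {T : Over (Spec (.of k))} (g : T ⟶ groupOf k H) (y : T ⟶ Y) :
    g • y = CartesianMonoidalCategory.lift g y ≫ act (groupOf k H) Y := rfl

theorem groupPoint_smul_affinePoint_mem
    (h : (act (groupOf k H) Y).left ⁻¹ᵁ V = (proj (groupOf k H) Y).left ⁻¹ᵁ V)
    (α : H →ₐ[k] R) (β : Γ(Y.left, V) →ₐ[k] R) (z) :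
    (groupPoint α • affinePoint hV β).left z ∈ V := by
  rw [smul_eq_lift_act]
  change (CartesianMonoidalCategory.lift (groupPoint α) (affinePoint hV β)).left z ∈
    (act (groupOf k H) Y).left ⁻¹ᵁ V
  rw [h]
  change (CartesianMonoidalCategory.lift (groupPoint α) (affinePoint hV β) ≫
    CartesianMonoidalCategory.snd _ _).left z ∈ V
  rw [CartesianMonoidalCategory.lift_snd, ← SetLike.mem_coe, ← hV.range_fromSpec]
  exact ⟨_, rfl⟩

/-- Let the universal point of `G` act on the universal point of `V`, both over `H ⊗ Γ(V)`;
invariance of `V` keeps the result inside `V`. -/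
theorem exists_coaction
    (h : (act (groupOf k H) Y).left ⁻¹ᵁ V = (proj (groupOf k H) Y).left ⁻¹ᵁ V) : ∃ c : Γ(Y.left, V) →ₐ[k] H ⊗[k] Γ(Y.left, V),
    groupPoint (Algebra.TensorProduct.includeLeft : H →ₐ[k] H ⊗[k] Γ(Y.left, V)) •
      affinePoint hV (Algebra.TensorProduct.includeRight :
        Γ(Y.left, V) →ₐ[k] H ⊗[k] Γ(Y.left, V)) = affinePoint hV c :=
  exists_affinePoint hV _ (groupPoint_smul_affinePoint_mem hV h _ _)

variable (h : (act (groupOf k H) Y).left ⁻¹ᵁ V = (proj (groupOf k H) Y).left ⁻¹ᵁ V)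

/-- The coaction on the sections over an invariant affine open. -/
def coaction : Γ(Y.left, V) →ₐ[k] H ⊗[k] Γ(Y.left, V) := (exists_coaction hV h).choose

theorem smul_affinePoint_includeRight :
    groupPoint (Algebra.TensorProduct.includeLeft : H →ₐ[k] H ⊗[k] Γ(Y.left, V)) •
      affinePoint hV (Algebra.TensorProduct.includeRight :
        Γ(Y.left, V) →ₐ[k] H ⊗[k] Γ(Y.left, V)) = affinePoint hV (coaction hV h) :=
  (exists_coaction hV h).choose_spec

theorem groupPoint_smul_affinePoint (α : H →ₐ[k] R) (β : Γ(Y.left, V) →ₐ[k] R) :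
    groupPoint α • affinePoint hV β = affinePoint hV
      ((Algebra.TensorProduct.lift α β fun _ _ => Commute.all _ _).comp (coaction hV h)) := by
  rw [← specOverMap_affinePoint, ← smul_affinePoint_includeRight hV h, ModObj.comp_smul,
    specOverMap_affinePoint, specOverMap_groupPoint]
  congr 2
  · ext x
    simp
  · ext x
    simp

/-- Associativity of the action at the three universal points over `H ⊗ H ⊗ A`. -/
theorem isCoassoc_coaction : IsCoassoc (coaction hV h) := by
  let A := Γ(Y.left, V)
  let i₁ : H →ₐ[k] H ⊗[k] (H ⊗[k] A) := Algebra.TensorProduct.includeLeft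
  let j : H ⊗[k] A →ₐ[k] H ⊗[k] (H ⊗[k] A) := Algebra.TensorProduct.includeRight
  let i₂ : H →ₐ[k] H ⊗[k] (H ⊗[k] A) := j.comp Algebra.TensorProduct.includeLeft
  let i₃ : A →ₐ[k] H ⊗[k] (H ⊗[k] A) := j.comp Algebra.TensorProduct.includeRight
  have h1 := mul_smul (groupPoint i₁) (groupPoint i₂) (affinePoint hV i₃)
  rw [mul_groupPoint, groupPoint_smul_affinePoint hV h, groupPoint_smul_affinePoint hV h,
    groupPoint_smul_affinePoint hV h] at h1
  have h2 := affinePoint_injective hV h1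
  have e1 : ∀ x : H ⊗[k] A, Algebra.TensorProduct.lift i₁
      ((Algebra.TensorProduct.lift i₂ i₃ fun _ _ => Commute.all _ _).comp (coaction hV h))
      (fun _ _ => Commute.all _ _) x = (coaction hV h).toLinearMap.lTensor H x := by
    have e2 : Algebra.TensorProduct.lift i₂ i₃ (fun _ _ => Commute.all _ _) = j := by
      ext x <;> simp [i₂, i₃]
    intro x
    induction x using TensorProduct.induction_on with
    | zero => simp
    | add x y hx hy => simp only [map_add, hx, hy]
    | tmul x y => simp [e2, i₁, j]
  have e3 : ∀ x : H ⊗[k] A, Algebra.TensorProduct.lift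
      ((Algebra.TensorProduct.lift i₁ i₂ fun _ _ => Commute.all _ _).comp
        (Bialgebra.comulAlgHom k H)) i₃ (fun _ _ => Commute.all _ _) x =
      TensorProduct.assoc k H H A ((Coalgebra.comul (R := k)).rTensor A x) := by
    intro x
    induction x using TensorProduct.induction_on with
    | zero => simp
    | add x y hx hy => simp only [map_add, hx, hy]
    | tmul x y =>
      have e4 : ∀ z : H ⊗[k] H, Algebra.TensorProduct.lift i₁ i₂ (fun _ _ => Commute.all _ _) z *
          i₃ y = TensorProduct.assoc k H H A (z ⊗ₜ y) := by
        intro z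
        induction z using TensorProduct.induction_on with
        | zero => simp
        | add x y hx hy => simp only [map_add, TensorProduct.add_tmul, add_mul, hx, hy]
        | tmul x z => simp [i₁, i₂, i₃, j]
      simpa using e4 (Coalgebra.comul (R := k) x)
  intro a
  rw [← e1, ← e3]
  exact (DFunLike.congr_fun h2 a).symm

theorem coaction_map {W : Y.left.Opens} (hW : IsAffineOpen W)
    (h' : (act (groupOf k H) Y).left ⁻¹ᵁ W = (proj (groupOf k H) Y).left ⁻¹ᵁ W)
    (f : Γ(Y.left, V) →ₐ[k] Γ(Y.left, W)) (hf : Spec.map (CommRingCat.ofHom f.toRingHom) ≫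
      hV.fromSpec = hW.fromSpec) (a : Γ(Y.left, V)) :
    coaction hW h' (f a) = Algebra.TensorProduct.map (AlgHom.id k H) f (coaction hV h a) := by
  have h0 : ∀ {R : Type u} [CommRing R] [Algebra k R] (β : Γ(Y.left, W) →ₐ[k] R),
      affinePoint hW β = affinePoint hV (β.comp f) := by
    intro R _ _ β
    ext : 1
    change Spec.map _ ≫ hW.fromSpec = Spec.map _ ≫ hV.fromSpec
    rw [← hf, ← Spec.map_comp_assoc]
    rfl
  have h1 := smul_affinePoint_includeRight hW h'
  rw [h0, h0, groupPoint_smul_affinePoint hV h] at h1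
  have h2 := DFunLike.congr_fun (affinePoint_injective hV h1) a
  refine h2.symm.trans ?_
  rw [AlgHom.comp_apply]
  generalize coaction hV h a = x
  induction x using TensorProduct.induction_on with
  | zero => simp
  | add x y hx hy => simp only [map_add, hx, hy]
  | tmul x y => simp


theorem specMap_fromSpec_appLE {X : Scheme.{u}} {U : X.Opens} (hU : IsAffineOpen U)
    {A : CommRingCat.{u}} (g : Γ(X, U) ⟶ A) (e) :
    (Spec.map g ≫ hU.fromSpec).appLE U ⊤ e = g ≫ (Scheme.ΓSpecIso A).inv := by
  rw [Scheme.ΓSpecIso_inv_naturality, Scheme.Hom.comp_appLE, hU.fromSpec_app_self]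
  have h := Scheme.Hom.map_appLE (Spec.map g)
    (U := hU.fromSpec ⁻¹ᵁ U) (V := ⊤) e (eqToHom hU.fromSpec_preimage_self).op
  exact (Category.assoc _ _ _).trans (congrArg _ (h.trans (Scheme.Hom.appLE_eq_app _)))

theorem affinePoint_appLE (β : Γ(Y.left, V) →ₐ[k] R) (e) (a : Γ(Y.left, V)) :
    (affinePoint hV β).left.appLE V ⊤ e a = (Scheme.ΓSpecIso (.of R)).inv (β a) :=
  congrArg (fun f => CommRingCat.Hom.hom f a)
    (specMap_fromSpec_appLE hV (CommRingCat.ofHom β.toRingHom) e)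

/-- The chart of `G × Y` over an affine open of `Y`. -/
def productChart (H : Type u) [CommRing H] [HopfAlgebra k H] :
    specOver k (H ⊗[k] Γ(Y.left, V)) ⟶ groupOf k H ⊗ Y :=
  CartesianMonoidalCategory.lift
    (groupPoint (Algebra.TensorProduct.includeLeft : H →ₐ[k] H ⊗[k] Γ(Y.left, V)))
    (affinePoint hV (Algebra.TensorProduct.includeRight :
        Γ(Y.left, V) →ₐ[k] H ⊗[k] Γ(Y.left, V)))

theorem isOpenImmersion_and_range_of_pullback_chart {T G Z S U : Scheme.{u}} {g : G ⟶ S}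
    {y : Z ⟶ S} {u : U ⟶ S} (j : U ⟶ Z) [IsOpenImmersion j] (t : T ⟶ pullback g y)
    (hu : j ≫ y = u) (e : T ≅ pullback g u) (h1 : t ≫ pullback.fst g y = e.hom ≫ pullback.fst g u)
    (h2 : t ≫ pullback.snd g y = e.hom ≫ pullback.snd g u ≫ j) :
    IsOpenImmersion t ∧ Set.range t = pullback.snd g y ⁻¹' Set.range j := by
  have w1 : g ≫ 𝟙 S = 𝟙 G ≫ g := by simp
  have w2 : u ≫ 𝟙 S = j ≫ y := by simp [hu]
  have ht : t = e.hom ≫ pullback.map g u g y (𝟙 _) j (𝟙 _) w1 w2 := by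
    apply pullback.hom_ext
    · rw [h1, Category.assoc, pullback.lift_fst, Category.comp_id]
    · rw [h2, Category.assoc, pullback.lift_snd]
  have hm := Scheme.Pullback.range_map g u g y (𝟙 G) j (𝟙 S) w1 w2
  rw [ht]
  refine ⟨inferInstance, ?_⟩
  have he : Set.range (e.hom ≫ pullback.map g u g y (𝟙 _) j (𝟙 _) w1 w2) =
      Set.range (pullback.map g u g y (𝟙 _) j (𝟙 _) w1 w2) := by
    refine Set.ext fun z => ⟨?_, ?_⟩
    · rintro ⟨x, rfl⟩
      exact ⟨_, (Scheme.Hom.comp_apply _ _ _).symm⟩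
    · rintro ⟨x, rfl⟩
      exact ⟨e.inv x, by rw [← Scheme.Hom.comp_apply, Iso.inv_hom_id_assoc]⟩
  rw [he, hm]
  ext z
  simp

theorem productChart_spec : IsOpenImmersion (productChart hV H).left ∧
    Set.range (productChart hV H).left =
      (proj (groupOf k H) Y).left ⁻¹' Set.range hV.fromSpec := by
  refine isOpenImmersion_and_range_of_pullback_chart (g := (groupOf k H).hom) (y := Y.hom)
    hV.fromSpec (productChart hV H).left (fromSpec_comp_hom hV)
    (pullbackSpecIso k H Γ(Y.left, V)).symm ?_ ?_
  · have e := congrArg CommaMorphism.left (CartesianMonoidalCategory.lift_fst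
      (groupPoint (Algebra.TensorProduct.includeLeft : H →ₐ[k] H ⊗[k] Γ(Y.left, V)))
      (affinePoint hV (Algebra.TensorProduct.includeRight :
        Γ(Y.left, V) →ₐ[k] H ⊗[k] Γ(Y.left, V))))
    exact e.trans (pullbackSpecIso_inv_fst k H Γ(Y.left, V)).symm
  · have e := congrArg CommaMorphism.left (CartesianMonoidalCategory.lift_snd
      (groupPoint (Algebra.TensorProduct.includeLeft : H →ₐ[k] H ⊗[k] Γ(Y.left, V)))
      (affinePoint hV (Algebra.TensorProduct.includeRight :
        Γ(Y.left, V) →ₐ[k] H ⊗[k] Γ(Y.left, V))))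
    exact e.trans (pullbackSpecIso_inv_snd_assoc k H Γ(Y.left, V) hV.fromSpec).symm

theorem opensRange_productChart (hi : IsOpenImmersion (productChart hV H).left) :
    (productChart hV H).left.opensRange = (proj (groupOf k H) Y).left ⁻¹ᵁ V := by
  apply TopologicalSpace.Opens.ext
  refine (productChart_spec hV).2.trans ?_
  rw [hV.range_fromSpec]
  rfl

theorem _root_.AlgebraicGeometry.IsOpenImmersion.appLE_injective {T Z : Scheme.{u}} (t : T ⟶ Z)
    [IsOpenImmersion t] {U : Z.Opens} (hU : U = t.opensRange) (e : ⊤ ≤ t ⁻¹ᵁ U) :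
    Function.Injective (t.appLE U ⊤ e) := by
  have h1 : t ⁻¹ᵁ U = ⊤ := top_le_iff.1 e
  have : IsIso (t.app U) := t.isIso_app U hU.le
  have h2 : t.appLE U ⊤ e = t.app U ≫ T.presheaf.map (eqToHom h1.symm).op := rfl
  rw [h2]
  exact (ConcreteCategory.bijective_of_isIso _).1

/-- The chart `productChart` covers the whole preimage of `V` in `G × Y`, so sections there may be
compared on it. The pullbacks along the action and the projection become the coaction and `a ↦ 1 ⊗
a`. -/
theorem mem_coinvariants_coaction_iff (a : Γ(Y.left, V)) :
    a ∈ coinvariants (coaction hV h) ↔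
      (act (groupOf k H) Y).left.appLE V ((proj (groupOf k H) Y).left ⁻¹ᵁ V) h.ge a =
        (proj (groupOf k H) Y).left.app V a := by
  have hi : IsOpenImmersion (productChart hV H).left := (productChart_spec hV).1
  have hT : ⊤ ≤ (productChart hV H).left ⁻¹ᵁ ((proj (groupOf k H) Y).left ⁻¹ᵁ V) := by
    rw [← opensRange_productChart hV hi, Scheme.Hom.preimage_opensRange]
  have hinj := AlgebraicGeometry.IsOpenImmersion.appLE_injective (productChart hV H).left
    (opensRange_productChart hV hi).symm hT
  have e1 : ∀ (g : groupOf k H ⊗ Y ⟶ Y) (β : Γ(Y.left, V) →ₐ[k] H ⊗[k] Γ(Y.left, V)) 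
      (e : (proj (groupOf k H) Y).left ⁻¹ᵁ V ≤ g.left ⁻¹ᵁ V),
      productChart hV H ≫ g = affinePoint hV β →
      (productChart hV H).left.appLE ((proj (groupOf k H) Y).left ⁻¹ᵁ V) ⊤ hT
        (g.left.appLE V ((proj (groupOf k H) Y).left ⁻¹ᵁ V) e a) =
      (Scheme.ΓSpecIso (.of (H ⊗[k] Γ(Y.left, V)))).inv (β a) := by
    intro g β e hg
    have e2 : ∀ f : specOver k (H ⊗[k] Γ(Y.left, V)) ⟶ Y, f = affinePoint hV β →
        ∀ e', f.left.appLE V ⊤ e' a = (Scheme.ΓSpecIso (.of (H ⊗[k] Γ(Y.left, V)))).inv (β a) := by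
      rintro _ rfl e'
      exact affinePoint_appLE hV β e' a
    refine Eq.trans ?_ (e2 _ hg (fun x hx => e (hT hx)))
    exact congrArg (fun f => CommRingCat.Hom.hom f a) (Scheme.Hom.appLE_comp_appLE
      (productChart hV H).left g.left V ((proj (groupOf k H) Y).left ⁻¹ᵁ V) ⊤ e hT)
  have e3 := e1 (act (groupOf k H) Y) (coaction hV h) h.ge (smul_affinePoint_includeRight hV h)
  have e4 := e1 (proj (groupOf k H) Y) Algebra.TensorProduct.includeRight le_rfl
    (CartesianMonoidalCategory.lift_snd _ _)
  rw [Scheme.Hom.appLE_eq_app] at e4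
  rw [mem_coinvariants, ← hinj.eq_iff, e3, e4]
  exact ((ConcreteCategory.bijective_of_isIso
    (Scheme.ΓSpecIso (.of (H ⊗[k] Γ(Y.left, V)))).inv).1.eq_iff).symm

end Coaction

end

section

/-! ### Witt vectors of length two -/

section WittVectors

variable (p : ℕ) [Fact p.Prime] {k : Type u} [Field k] [CharP k p]

theorem W2.p_mul_p : (p : W2 p k) * p = 0 := by
  have h : WittVector.truncate (p := p) (R := k) 2 (p * p) = 0 := by
    rw [← RingHom.mem_ker, WittVector.mem_ker_truncate]
    intro i hi
    interval_cases i
    · exact WittVector.mul_charP_coeff_zero _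
    · rw [WittVector.mul_charP_coeff_succ]
      have : ((p : WittVector p k)).coeff 0 = 0 := by
        rw [← one_mul (p : WittVector p k), WittVector.mul_charP_coeff_zero]
      rw [this, zero_pow (Fact.out : p.Prime).ne_zero]
  simpa using h

theorem W2.residue_eq_zero_of_p_mul {x : W2 p k} (hx : (p : W2 p k) * x = 0) :
    residue p k x = 0 := by
  obtain ⟨y, rfl⟩ := WittVector.truncate_surjective p 2 k x
  have h : WittVector.truncate (p := p) (R := k) 2 (y * p) = 0 := by
    rw [map_mul, map_natCast, mul_comm, hx]
  have h1 := (WittVector.mem_ker_truncate 2 _).1 h 1 (by norm_num)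
  rw [WittVector.mul_charP_coeff_succ] at h1
  rw [residue_apply, WittVector.coeff_truncate]
  exact pow_eq_zero_iff (Fact.out : p.Prime).ne_zero |>.1 h1

theorem W2.exists_eq_p_mul [PerfectField k] {x : W2 p k} (hx : residue p k x = 0) :
    ∃ y, x = p * y := by
  have : PerfectRing k p := PerfectField.toPerfectRing p
  obtain ⟨y, rfl⟩ := WittVector.truncate_surjective p 2 k x
  rw [residue_apply, WittVector.coeff_truncate] at hx
  have h1 := WittVector.eq_iterate_verschiebung (x := y) (n := 1) (by
    intro i hi
    obtain rfl : i = 0 := by omega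
    exact hx)
  obtain ⟨w, hw⟩ := (WittVector.frobenius_bijective p k).2 (y.shift 1)
  refine ⟨WittVector.truncate 2 w, ?_⟩
  rw [Function.iterate_one, ← hw, WittVector.verschiebung_frobenius] at h1
  rw [h1, map_mul, map_natCast, mul_comm]

theorem W2.residue_surjective : Function.Surjective (residue p k) := by
  intro a
  refine ⟨WittVector.truncate 2 (WittVector.teichmuller p a), ?_⟩
  rw [residue_apply, WittVector.coeff_truncate]
  exact WittVector.teichmuller_coeff_zero p a

/-- Take a `p`-th root of the residue. Elements of this form lie in every descended ring
(`pow_add_p_mul_mem`), which yields the structure over `W2 p k`. -/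
theorem W2.exists_eq_pow_add [PerfectField k] (x : W2 p k) :
    ∃ a b, x = a ^ p + p * b := by
  have : PerfectRing k p := PerfectField.toPerfectRing p
  obtain ⟨c, hc⟩ := (frobeniusEquiv k p).surjective (residue p k x)
  obtain ⟨a, rfl⟩ := W2.residue_surjective p c
  obtain ⟨b, hb⟩ := W2.exists_eq_p_mul p (x := x - a ^ p) (by
    rw [map_sub, map_pow, ← hc, frobeniusEquiv_apply, frobenius_def, sub_self])
  exact ⟨a, b, by rw [← hb]; ring⟩

theorem W2.exists_comp_residue_eq [PerfectField k] {T : Type u} [CommRing T] (w : W2 p k →+* T)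
    (hw : (p : T) = 0) : ∃ v : k →+* T, v.comp (residue p k) = w := by
  refine ⟨(residue p k).liftOfSurjective (W2.residue_surjective p) ⟨w, fun x hx => ?_⟩,
    RingHom.ext fun x => RingHom.liftOfRightInverse_comp_apply _ _
      (Function.rightInverse_surjInv (W2.residue_surjective p)) _ x⟩
  obtain ⟨y, rfl⟩ := W2.exists_eq_p_mul p hx
  rw [RingHom.mem_ker, map_mul, map_natCast, hw, zero_mul]

/-- The equational criterion for flatness, applied to the one-term relation `c • s = 0`. -/
theorem _root_.Module.Flat.dvd_of_mul_eq_zero {W S : Type u} [CommRing W] [CommRing S]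
    [Algebra W S] [Module.Flat W S] {c d : W} (h : ∀ a, c * a = 0 → d ∣ a) {s : S}
    (hs : algebraMap W S c * s = 0) : algebraMap W S d ∣ s := by
  obtain ⟨n, a, y, h4, h5⟩ := Module.Flat.isTrivialRelation_of_sum_smul_eq_zero (R := W) (M := S)
    (f := fun _ : Fin 1 => c) (x := fun _ => s) (by
      rw [Fin.sum_univ_one, Algebra.smul_def]
      exact hs)
  rw [show s = _ from h4 0]
  refine Finset.dvd_sum fun j _ => ?_
  have h7 := h5 j
  rw [Fin.sum_univ_one] at h7
  rw [Algebra.smul_def]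
  exact dvd_mul_of_dvd_left (map_dvd (algebraMap W S) (h _ h7)) _

theorem _root_.RingHom.Flat.dvd_of_mul_eq_zero {W S : Type u} [CommRing W] [CommRing S]
    {w : W →+* S} (hw : w.Flat) {c d : W} (h : ∀ a, c * a = 0 → d ∣ a) {s : S}
    (hs : w c * s = 0) : w d ∣ s :=
  @Module.Flat.dvd_of_mul_eq_zero W S _ _ w.toAlgebra hw _ _ h _ hs

end WittVectors

/-! ### Liftings as thickenings -/

namespace Lifting

variable {p : ℕ} [Fact p.Prime] {k : Type u} [Field k] [CharP k p] [PerfectField k]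
  {Y : Over (Spec (.of k))} (Yt : Lifting p Y)

instance isClosedImmersion_incl : IsClosedImmersion Yt.incl := by
  have : IsClosedImmersion (Spec.map (CommRingCat.ofHom (residue p k))) :=
    IsClosedImmersion.spec_of_surjective _ (W2.residue_surjective p)
  exact MorphismProperty.of_isPullback Yt.isPullback.flip this

instance surjective_incl : Surjective Yt.incl := by
  have : Surjective (Spec.map (CommRingCat.ofHom (residue p k))) := by
    refine ⟨fun x => ?_⟩
    have h : x ∈ Set.range (PrimeSpectrum.comap (residue p k)) := by
      rw [range_comap_of_surjective _ _ (W2.residue_surjective p)]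
      intro y hy
      obtain ⟨z, rfl⟩ := W2.exists_eq_p_mul p hy
      have h2 : (p : W2 p k) ∈ x.asIdeal := x.2.mem_of_pow_mem 2 (by
        rw [pow_two, W2.p_mul_p]; exact x.asIdeal.zero_mem)
      exact x.asIdeal.mul_mem_right _ h2
    exact h
  exact MorphismProperty.of_isPullback Yt.isPullback.flip this

theorem p_mul_p (U : Yt.total.left.Opens) : (p : Γ(Yt.total.left, U)) * p = 0 := by
  have h := congrArg ((Scheme.ΓSpecIso (.of (W2 p k))).inv ≫ Yt.total.hom.appLE ⊤ U le_top).hom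
    (W2.p_mul_p (k := k) p)
  rw [map_mul, map_zero] at h
  have h2 := map_natCast ((Scheme.ΓSpecIso (.of (W2 p k))).inv ≫
    Yt.total.hom.appLE ⊤ U le_top).hom p
  rwa [h2] at h

theorem incl_app_p (U : Yt.total.left.Opens) (s) : Yt.incl.app U (p * s) = 0 := by
  rw [map_mul, map_natCast, natCast_section_eq_zero (natCast_top_eq_zero p Y), zero_mul]

/-- On the closed subscheme `p = 0` of `U` the map from `W2 p k` factors through `k`, so the
pullback property factors its inclusion through `Y`. A section vanishing on `Y` therefore vanishes
modulo `p`. -/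
theorem exists_eq_p_mul {U : Yt.total.left.Opens} (hU : IsAffineOpen U) {s : Γ(Yt.total.left, U)}
    (hs : Yt.incl.app U s = 0) : ∃ t, s = p * t := by
  let S := Γ(Yt.total.left, U)
  let I : Ideal S := Ideal.span {(p : S)}
  let π : Γ(Yt.total.left, U) ⟶ CommRingCat.of (S ⧸ I) := CommRingCat.ofHom (Ideal.Quotient.mk I)
  let w : CommRingCat.of (W2 p k) ⟶ S :=
    (Scheme.ΓSpecIso (.of (W2 p k))).inv ≫ Yt.total.hom.appLE ⊤ U le_top
  have hp : (p : S ⧸ I) = 0 := by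
    rw [← map_natCast (Ideal.Quotient.mk I)]
    exact Ideal.Quotient.eq_zero_iff_mem.2 (Ideal.mem_span_singleton_self _)
  obtain ⟨v, hv'⟩ := W2.exists_comp_residue_eq p (w ≫ π).hom hp
  have hv : CommRingCat.ofHom (residue p k) ≫ CommRingCat.ofHom v = w ≫ π :=
    CommRingCat.hom_ext hv'
  have hw : hU.fromSpec ≫ Yt.total.hom = Spec.map w := by
    have h := IsAffineOpen.SpecMap_appLE_fromSpec Yt.total.hom
      (isAffineOpen_top (Spec (.of (W2 p k)))) hU le_top
    rw [IsAffineOpen.fromSpec_top, Scheme.isoSpec_Spec_inv, ← Spec.map_comp] at h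
    exact h.symm
  have hc : (Spec.map π ≫ hU.fromSpec) ≫ Yt.total.hom =
      Spec.map (CommRingCat.ofHom v) ≫ Spec.map (CommRingCat.ofHom (residue p k)) := by
    rw [Category.assoc, hw, ← Spec.map_comp, ← Spec.map_comp, hv]
  have hl := Yt.isPullback.lift_fst _ _ hc
  have h1 : ∀ g : Spec (.of (S ⧸ I)) ⟶ Y.left, (g ≫ Yt.incl).app U s = 0 := by
    intro g
    rw [Scheme.Hom.comp_app]
    exact (congrArg (g.app _).hom hs).trans (map_zero (g.app _).hom)
  have e : ⊤ ≤ (Spec.map π ≫ hU.fromSpec) ⁻¹ᵁ U := by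
    rw [Scheme.Hom.comp_preimage, hU.fromSpec_preimage_self]
    exact le_rfl
  have h2 := congrArg ((Spec (.of (S ⧸ I))).presheaf.map (homOfLE e).op).hom
    ((congrArg (fun f => (Scheme.Hom.app f U) s = 0) hl).mp (h1 _))
  have h2 := h2.trans (map_zero ((Spec (.of (S ⧸ I))).presheaf.map (homOfLE e).op).hom)
  have h3 := congrArg (fun f => CommRingCat.Hom.hom f s) (specMap_fromSpec_appLE hU π e)
  have h2 : π s = 0 := by
    apply (ConcreteCategory.bijective_of_isIso (Scheme.ΓSpecIso (.of (S ⧸ I))).inv).1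
    exact (h3.symm.trans h2).trans (map_zero (Scheme.ΓSpecIso (.of (S ⧸ I))).inv.hom).symm
  obtain ⟨t, ht⟩ := Ideal.mem_span_singleton.1 (Ideal.Quotient.eq_zero_iff_mem.1 h2)
  exact ⟨t, ht⟩

theorem flat_sections {U : Yt.total.left.Opens} (hU : IsAffineOpen U) :
    ((Scheme.ΓSpecIso (.of (W2 p k))).inv ≫ Yt.total.hom.appLE ⊤ U le_top).hom.Flat := by
  have hf := Yt.flat
  have h1 : (Yt.total.hom.appLE ⊤ U le_top).hom.Flat :=
    HasRingHomProperty.appLE @Flat Yt.total.hom hf ⟨_, isAffineOpen_top _⟩ ⟨U, hU⟩ le_top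
  exact RingHom.Flat.comp (RingHom.Flat.of_bijective
    (ConcreteCategory.bijective_of_isIso (Scheme.ΓSpecIso (.of (W2 p k))).inv)) h1

theorem incl_app_eq_zero_of_isAffineOpen {U : Yt.total.left.Opens} (hU : IsAffineOpen U)
    {s : Γ(Yt.total.left, U)} (hs : p * s = 0) : Yt.incl.app U s = 0 := by
  have h := (Yt.flat_sections hU).dvd_of_mul_eq_zero (c := (p : W2 p k)) (d := p) (s := s)
    (fun a ha => W2.exists_eq_p_mul p (W2.residue_eq_zero_of_p_mul p ha)) (by rwa [map_natCast])
  rw [map_natCast] at h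
  obtain ⟨t, rfl⟩ := h
  exact Yt.incl_app_p U t

/-- Flatness is used on affine opens only; vanishing of the reduction is local, so non-affine opens
follow. -/
theorem incl_app_eq_zero {U : Yt.total.left.Opens} {s : Γ(Yt.total.left, U)} (hs : p * s = 0) :
    Yt.incl.app U s = 0 := by
  refine TopCat.Sheaf.eq_of_locally_eq' Y.left.sheaf
    (fun x : U => Yt.incl ⁻¹ᵁ (exists_isAffineOpen_mem_and_subset x.2).choose) (Yt.incl ⁻¹ᵁ U)
    (fun x => homOfLE ?_) ?_ _ _ (fun x => ?_)
  · exact fun y hy => (exists_isAffineOpen_mem_and_subset x.2).choose_spec.2.2 hy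
  · intro y hy
    exact TopologicalSpace.Opens.mem_iSup.2 ⟨⟨Yt.incl y, hy⟩,
      (exists_isAffineOpen_mem_and_subset (show Yt.incl y ∈ U from hy)).choose_spec.2.1⟩
  · let V := (exists_isAffineOpen_mem_and_subset x.2).choose
    have hV : V ≤ U := (exists_isAffineOpen_mem_and_subset x.2).choose_spec.2.2
    have h1 := Yt.incl_app_eq_zero_of_isAffineOpen
      (exists_isAffineOpen_mem_and_subset x.2).choose_spec.1
      (s := (Yt.total.left.presheaf.map (homOfLE hV).op).hom s) (by
        have h2 := congrArg (Yt.total.left.presheaf.map (homOfLE hV).op).hom hs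
        rwa [map_mul, map_natCast, map_zero] at h2)
    have h3 := congrArg (fun f => CommRingCat.Hom.hom f s)
      (Yt.incl.naturality (homOfLE hV).op)
    exact (h3.symm.trans h1).trans (map_zero (Y.left.presheaf.map _).hom).symm

end Lifting

end

section

/-! ### Affine opens of a lifting -/

/-- The restriction of sections. -/
abbrev res {X : Scheme.{u}} {U V : X.Opens} (h : V ≤ U) : Γ(X, U) →+* Γ(X, V) :=
  (X.presheaf.map (homOfLE h).op).hom

theorem res_res {X : Scheme.{u}} {U V W : X.Opens} (h : V ≤ U) (h' : W ≤ V) (s : Γ(X, U)) :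
    res h' (res h s) = res (h'.trans h) s :=
  congrArg (fun f => CommRingCat.Hom.hom f s)
    (X.presheaf.map_comp (homOfLE h).op (homOfLE h').op).symm

theorem res_self {X : Scheme.{u}} {U : X.Opens} (h : U ≤ U) (s : Γ(X, U)) : res h s = s :=
  congrArg (fun f => CommRingCat.Hom.hom f s) (X.presheaf.map_id (Opposite.op U))

theorem appLE_res {X Y : Scheme.{u}} (f : X ⟶ Y) {U U' : Y.Opens} {V V' : X.Opens}
    (e : V ≤ f ⁻¹ᵁ U) (e' : V' ≤ f ⁻¹ᵁ U') (hU : U' ≤ U) (hV : V' ≤ V) (s : Γ(Y, U)) :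
    f.appLE U' V' e' (res hU s) = res hV (f.appLE U V e s) := by
  have h1 := Scheme.Hom.map_appLE f e' (homOfLE hU).op
  have h2 := Scheme.Hom.appLE_map f e (homOfLE hV).op
  exact congrArg (fun f => CommRingCat.Hom.hom f s) (h1.trans h2.symm)

theorem eq_of_locally_res_eq {X : Scheme.{u}} {U : X.Opens} {s t : Γ(X, U)}
    (h : ∀ x ∈ U, ∃ (V : X.Opens) (hV : V ≤ U), x ∈ V ∧ res hV s = res hV t) : s = t := by
  choose V hV hx hst using h
  refine X.sheaf.eq_of_locally_eq' (fun x : U => V x x.2) U (fun x => homOfLE (hV x x.2))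
    (fun x hx' => ?_) s t (fun x => hst x x.2)
  exact TopologicalSpace.Opens.mem_iSup.2 ⟨⟨x, hx'⟩, hx x hx'⟩

theorem eq_of_affine_res_eq {X : Scheme.{u}} {U : X.Opens} {s t : Γ(X, U)}
    (h : ∀ (V : X.Opens) (hV : V ≤ U), IsAffineOpen V → res hV s = res hV t) : s = t := by
  refine eq_of_locally_res_eq fun x hx => ?_
  obtain ⟨V, hV, hxV, hVU⟩ := exists_isAffineOpen_mem_and_subset hx
  exact ⟨V, hVU, hxV, h V hVU hV⟩

namespace Lifting

variable {p : ℕ} [Fact p.Prime] {k : Type u} [Field k] [CharP k p] [PerfectField k]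
  {Y : Over (Spec (.of k))} (Yt : Lifting p Y)

theorem isHomeomorph_incl : IsHomeomorph Yt.incl := by
  rw [isHomeomorph_iff_continuous_isClosedMap_bijective]
  exact ⟨Yt.incl.continuous, Yt.incl.isClosedEmbedding.isClosedMap,
    Yt.incl.isClosedEmbedding.injective, Yt.incl.surjective⟩

/-- The homeomorphism from the lifting to the special fibre. -/
def retract : TopCat.of Yt.total.left ⟶ TopCat.of Y.left :=
  TopCat.ofHom ⟨Yt.isHomeomorph_incl.homeomorph.symm,
    Yt.isHomeomorph_incl.homeomorph.symm.continuous⟩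

theorem retract_incl (y : Y.left) : Yt.retract (Yt.incl y) = y :=
  Yt.isHomeomorph_incl.homeomorph.symm_apply_apply y

theorem incl_retract (y : Yt.total.left) : Yt.incl (Yt.retract y) = y :=
  Yt.isHomeomorph_incl.homeomorph.apply_symm_apply y

/-- The open subset of the lifting defined by an open subset of the special fibre. -/
def tilde (V : Y.left.Opens) : Yt.total.left.Opens :=
  (TopologicalSpace.Opens.map Yt.retract).obj V

theorem preimage_tilde (V : Y.left.Opens) : Yt.incl ⁻¹ᵁ Yt.tilde V = V := by
  ext y
  change Yt.retract (Yt.incl y) ∈ V ↔ y ∈ V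
  rw [Yt.retract_incl]

theorem tilde_mono {V V' : Y.left.Opens} (h : V ≤ V') : Yt.tilde V ≤ Yt.tilde V' :=
  fun _ hy => h hy

theorem incl_app_res {U U' : Yt.total.left.Opens} (h : U' ≤ U) (s : Γ(Yt.total.left, U)) :
    Yt.incl.app U' (res h s) = res (Yt.incl.preimage_mono h) (Yt.incl.app U s) :=
  congrArg (fun f => CommRingCat.Hom.hom f s) (Yt.incl.naturality (homOfLE h).op)

theorem pow_eq_of_incl_app_eq {U : Yt.total.left.Opens} {s t : Γ(Yt.total.left, U)}
    (h : Yt.incl.app U s = Yt.incl.app U t) : s ^ p = t ^ p := by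
  refine eq_of_affine_res_eq fun V hVU hV => ?_
  rw [map_pow, map_pow]
  obtain ⟨c, hc⟩ := Yt.exists_eq_p_mul hV (s := res hVU s - res hVU t) (by
    rw [map_sub, incl_app_res, incl_app_res, h, sub_self])
  rw [sub_eq_iff_eq_add.1 hc]
  obtain ⟨r, hr⟩ := exists_add_pow_prime_eq (Fact.out : p.Prime) (p * c) (res hVU t)
  have h2 : ((p : Γ(Yt.total.left, V)) * c) ^ p = 0 := by
    obtain ⟨n, hn⟩ := Nat.exists_eq_add_of_le (Fact.out : p.Prime).two_le
    have h3 : ((p : Γ(Yt.total.left, V)) * c) ^ 2 = 0 := by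
      rw [mul_pow, pow_two (p : Γ(Yt.total.left, V)), Yt.p_mul_p, zero_mul]
    exact (congrArg (fun m => ((p : Γ(Yt.total.left, V)) * c) ^ m) hn).trans
      (by rw [pow_add, h3, zero_mul])
  rw [hr, h2, zero_add, show (p : Γ(Yt.total.left, V)) * (p * c) * res hVU t * r =
    p * p * (c * res hVU t * r) by ring, Yt.p_mul_p, zero_mul, add_zero]

/-- Local lifts of `b` have the same reduction on overlaps, so their `p`-th powers agree there and
glue. No cohomology is needed to lift `p`-th powers. -/
theorem exists_incl_app_eq_pow {U : Yt.total.left.Opens} (b : Γ(Y.left, Yt.incl ⁻¹ᵁ U)) :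
    ∃ s, Yt.incl.app U s = b ^ p := by
  have h0 : ∀ x : U, ∃ (V : Yt.total.left.Opens) (hV : V ≤ U) (s : Γ(Yt.total.left, V)),
      x.1 ∈ V ∧ Yt.incl.app V s = res (Yt.incl.preimage_mono hV) b := fun x => by
    obtain ⟨V, hV, hxV, hVU⟩ := exists_isAffineOpen_mem_and_subset x.2
    obtain ⟨s, hs⟩ := Yt.incl.app_surjective V hV (res (Yt.incl.preimage_mono hVU) b)
    exact ⟨V, hVU, s, hxV, hs⟩
  choose V hV s hx hs using h0
  obtain ⟨t, ht, -⟩ := Yt.total.left.sheaf.existsUnique_gluing' V U (fun x => homOfLE (hV x))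
    (fun x hx' => TopologicalSpace.Opens.mem_iSup.2 ⟨⟨x, hx'⟩, hx ⟨x, hx'⟩⟩)
    (fun x => s x ^ p) (fun x y => by
      have h1 : Yt.incl.app (V x ⊓ V y) (res inf_le_left (s x)) =
          Yt.incl.app (V x ⊓ V y) (res inf_le_right (s y)) := by
        rw [incl_app_res, incl_app_res, hs, hs, res_res, res_res]
      have h2 := Yt.pow_eq_of_incl_app_eq h1
      rw [← map_pow, ← map_pow] at h2
      exact h2)
  refine ⟨t, eq_of_locally_res_eq fun y hy => ?_⟩
  refine ⟨Yt.incl ⁻¹ᵁ V ⟨_, hy⟩, fun z hz => hV _ hz, hx _, ?_⟩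
  have h3 : res (hV ⟨_, hy⟩) t = s ⟨_, hy⟩ ^ p := ht ⟨_, hy⟩
  have h4 := Yt.incl_app_res (hV ⟨_, hy⟩) t
  rw [h3, map_pow, hs] at h4
  rw [← h4, map_pow]

/-- Sections lifting `b ^ p` have affine basic opens once the basic open of `b` is small enough, and
their reductions generate the unit ideal. Every element of the generated ideal has a `p`-th power
that lifts to `Ideal.span T`; applied to `1`, this gives the unit ideal upstairs. -/
theorem isAffineOpen_of_preimage {U : Yt.total.left.Opens} (hU : IsAffineOpen (Yt.incl ⁻¹ᵁ U)) :
    IsAffineOpen U := by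
  let q : Γ(Yt.total.left, U) →+* Γ(Y.left, Yt.incl ⁻¹ᵁ U) := (Yt.incl.app U).hom
  let T : Set Γ(Yt.total.left, U) := {s | IsAffineOpen (Yt.total.left.basicOpen s)}
  refine isAffineOpen_of_isAffineOpen_basicOpen U T ?_ fun s hs => hs
  have h1 : Ideal.span {b : Γ(Y.left, Yt.incl ⁻¹ᵁ U) | ∃ s ∈ T, q s = b ^ p} = ⊤ := by
    rw [← hU.self_le_iSup_basicOpen_iff]
    intro y hy
    obtain ⟨U', hU', hyU', hle⟩ := exists_isAffineOpen_mem_and_subset (show Yt.incl y ∈ U from hy)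
    obtain ⟨b, hb, hyb⟩ := hU.exists_basicOpen_le (V := Yt.incl ⁻¹ᵁ U') ⟨y, hyU'⟩ hy
    obtain ⟨s, hs⟩ := Yt.exists_incl_app_eq_pow b
    refine TopologicalSpace.Opens.mem_iSup.2 ⟨⟨b, s, ?_, hs⟩, hyb⟩
    have h2 : Yt.total.left.basicOpen s ≤ U' := by
      intro z hz
      obtain ⟨y', rfl⟩ := Yt.incl.surjective z
      have h3 : y' ∈ Yt.incl ⁻¹ᵁ Yt.total.left.basicOpen s := hz
      rw [Scheme.preimage_basicOpen, hs, Scheme.basicOpen_pow _ _ (Fact.out : p.Prime).pos] at h3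
      exact hb h3
    have h4 : Yt.total.left.basicOpen (res hle s) = Yt.total.left.basicOpen s := by
      rw [Scheme.basicOpen_res, inf_eq_right.2 h2]
    change IsAffineOpen _
    rw [← h4]
    exact hU'.basicOpen _
  have hchar : (p : Γ(Y.left, Yt.incl ⁻¹ᵁ U)) = 0 :=
    natCast_section_eq_zero (natCast_top_eq_zero p Y) _
  have h2 : (Ideal.span T).map q = ⊤ := by
    rw [← Ideal.radical_eq_top, eq_top_iff, ← h1, Ideal.span_le]
    rintro b ⟨s, hs, hb⟩
    exact ⟨p, hb ▸ Ideal.mem_map_of_mem q (Ideal.subset_span hs)⟩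
  have h3 : ∀ b ∈ (Ideal.span T).map q, ∃ s ∈ Ideal.span T, q s = b ^ p := by
    intro b hb
    induction hb using Submodule.span_induction with
    | mem b hb =>
      obtain ⟨s, hs, rfl⟩ := hb
      exact ⟨s ^ p, Ideal.pow_mem_of_mem _ hs _ (Fact.out : p.Prime).pos, map_pow _ _ _⟩
    | zero => exact ⟨0, Ideal.zero_mem _, by rw [map_zero, zero_pow (Fact.out : p.Prime).ne_zero]⟩
    | add b c _ _ hb hc =>
      obtain ⟨s, hs, hs'⟩ := hb
      obtain ⟨t, ht, ht'⟩ := hc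
      exact ⟨s + t, Ideal.add_mem _ hs ht, by rw [map_add, hs', ht', add_pow_of_natCast_eq_zero hchar]⟩
    | smul a b _ hb =>
      obtain ⟨s, hs, hs'⟩ := hb
      obtain ⟨t, ht⟩ := Yt.exists_incl_app_eq_pow a
      exact ⟨t * s, Ideal.mul_mem_left _ _ hs, by
        rw [map_mul, hs', smul_eq_mul, mul_pow, ← ht]⟩
  obtain ⟨s, hs, hs'⟩ := h3 1 (h2 ▸ Submodule.mem_top)
  rw [Ideal.eq_top_iff_one]
  have h5 := Yt.pow_eq_of_incl_app_eq (s := s) (t := 1) (by rw [map_one]; exact hs'.trans (one_pow p))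
  rw [one_pow] at h5
  exact h5 ▸ Ideal.pow_mem_of_mem _ hs _ (Fact.out : p.Prime).pos

theorem isAffineOpen_tilde {V : Y.left.Opens} (hV : IsAffineOpen V) : IsAffineOpen (Yt.tilde V) :=
  Yt.isAffineOpen_of_preimage ((Yt.preimage_tilde V).symm ▸ hV)

/-- The reduction of sections. -/
def redHom (V : Y.left.Opens) : Γ(Yt.total.left, Yt.tilde V) →+* Γ(Y.left, V) :=
  (Yt.incl.appLE (Yt.tilde V) V (Yt.preimage_tilde V).ge).hom

theorem redHom_res {V V' : Y.left.Opens} (h : V' ≤ V) (s : Γ(Yt.total.left, Yt.tilde V)) :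
    Yt.redHom V' (res (Yt.tilde_mono h) s) = res h (Yt.redHom V s) :=
  appLE_res Yt.incl _ _ _ _ _

theorem redHom_eq_zero_iff {V : Y.left.Opens} {s : Γ(Yt.total.left, Yt.tilde V)} :
    Yt.redHom V s = 0 ↔ Yt.incl.app (Yt.tilde V) s = 0 := by
  have h : ∀ t, Yt.redHom V t = res (Yt.preimage_tilde V).ge (Yt.incl.app (Yt.tilde V) t) :=
    fun t => rfl
  rw [h]
  refine ⟨fun h0 => ?_, fun h0 => by rw [h0, map_zero]⟩
  have h1 := congrArg (res (Yt.preimage_tilde V).le) h0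
  rwa [res_res, res_self, map_zero] at h1

theorem redHom_surjective {V : Y.left.Opens} (hV : IsAffineOpen V) :
    Function.Surjective (Yt.redHom V) := by
  intro b
  obtain ⟨s, hs⟩ := Yt.incl.app_surjective _ (Yt.isAffineOpen_tilde hV)
    (res (Yt.preimage_tilde V).le b)
  refine ⟨s, ?_⟩
  change res (Yt.preimage_tilde V).ge (Yt.incl.app (Yt.tilde V) s) = b
  rw [hs, res_res, res_self]

theorem LiftsFrobenius.apply {Yt : Lifting p Y} {FYt : Yt.total.left ⟶ Yt.total.left}
    (hFYt : Yt.LiftsFrobenius FYt) (y : Yt.total.left) : FYt y = y := by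
  obtain ⟨x, rfl⟩ := Yt.incl.surjective y
  have h : (Yt.incl ≫ FYt) x = (frob p Y ≫ Yt.incl) x :=
    congrArg (fun f : Y.left ⟶ Yt.total.left => f x) hFYt
  rw [Scheme.Hom.comp_apply, Scheme.Hom.comp_apply] at h
  exact h

theorem LiftsFrobenius.preimage_eq {Yt : Lifting p Y} {FYt : Yt.total.left ⟶ Yt.total.left}
    (hFYt : Yt.LiftsFrobenius FYt) (U : Yt.total.left.Opens) : FYt ⁻¹ᵁ U = U := by
  ext y
  change FYt y ∈ U ↔ y ∈ U
  rw [hFYt.apply]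

/-- The action of the lifted Frobenius on sections. -/
def LiftsFrobenius.onSections {Yt : Lifting p Y} {FYt : Yt.total.left ⟶ Yt.total.left}
    (hFYt : Yt.LiftsFrobenius FYt) (U : Yt.total.left.Opens) :
    Γ(Yt.total.left, U) →+* Γ(Yt.total.left, U) :=
  (FYt.appLE U U (hFYt.preimage_eq U).ge).hom

theorem LiftsFrobenius.onSections_res {Yt : Lifting p Y} {FYt : Yt.total.left ⟶ Yt.total.left}
    (hFYt : Yt.LiftsFrobenius FYt) {U U' : Yt.total.left.Opens} (h : U' ≤ U) (s) :
    hFYt.onSections U' (res h s) = res h (hFYt.onSections U s) :=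
  appLE_res FYt _ _ _ _ _

theorem LiftsFrobenius.redHom_onSections {Yt : Lifting p Y}
    {FYt : Yt.total.left ⟶ Yt.total.left} (hFYt : Yt.LiftsFrobenius FYt) (V : Y.left.Opens) (s) :
    Yt.redHom V (hFYt.onSections _ s) = Yt.redHom V s ^ p := by
  have h1 := Scheme.Hom.appLE_comp_appLE Yt.incl FYt (Yt.tilde V) (Yt.tilde V) V
    (hFYt.preimage_eq _).ge (Yt.preimage_tilde V).ge
  have h2 := Scheme.Hom.appLE_comp_appLE (frob p Y) Yt.incl (Yt.tilde V) V V
    (Yt.preimage_tilde V).ge le_rfl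
  have h3 : ∀ (f g : Y.left ⟶ Yt.total.left) (_ : f = g) (e e'),
      f.appLE (Yt.tilde V) V e = g.appLE (Yt.tilde V) V e' := by
    rintro f _ rfl e e'
    rfl
  have h4 := h1.trans ((h3 _ _ hFYt _ _).trans h2.symm)
  refine (congrArg (fun f => CommRingCat.Hom.hom f s) h4).trans ?_
  change (frob p Y).appLE V V le_rfl (Yt.redHom V s) = _
  have h5 : (frob p Y).appLE V V le_rfl = (frob p Y).app V :=
    Scheme.Hom.appLE_eq_app _
  rw [h5]
  exact absFrobenius_app p Y.left _ V _

/-- The sections of a Frobenius lifting over an affine open. -/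
def LiftsFrobenius.frobLiftAlg {Yt : Lifting p Y} {FYt : Yt.total.left ⟶ Yt.total.left}
    (hFYt : Yt.LiftsFrobenius FYt) {V : Y.left.Opens} (hV : IsAffineOpen V) :
    FrobLiftAlg p Γ(Yt.total.left, Yt.tilde V) Γ(Y.left, V) where
  q := Yt.redHom V
  surj := Yt.redHom_surjective hV
  φ := hFYt.onSections _
  q_eq_zero _ hx := Yt.exists_eq_p_mul (Yt.isAffineOpen_tilde hV) (Yt.redHom_eq_zero_iff.1 hx)
  tors _ hx := Yt.redHom_eq_zero_iff.2 (Yt.incl_app_eq_zero hx)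
  sq := Yt.p_mul_p _
  q_φ := hFYt.redHom_onSections V

theorem LiftsFrobenius.isHom_res {Yt : Lifting p Y} {FYt : Yt.total.left ⟶ Yt.total.left}
    (hFYt : Yt.LiftsFrobenius FYt) {V V' : Y.left.Opens} (hV : IsAffineOpen V)
    (hV' : IsAffineOpen V') (h : V' ≤ V) :
    (hFYt.frobLiftAlg hV).IsHom (hFYt.frobLiftAlg hV') (res (Yt.tilde_mono h)) (res h) where
  q := Yt.redHom_res h
  φ := hFYt.onSections_res _

end Lifting

end

section

/-! ### Descent along a good quotient -/

section Reynolds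

variable {p : ℕ} [Fact p.Prime] {k : Type u} [Field k] [CharP k p] [PerfectField k]
  {H : Type u} [CommRing H] [HopfAlgebra k H] {Y X : Over (Spec (.of k))}
  [ModObj (groupOf k H) Y] {π : Y ⟶ X}

attribute [local instance] sectionsAlgebra

theorem IsGoodQuotient.preimage_act_eq (hπ : IsGoodQuotient (groupOf k H) π) (W : X.left.Opens) :
    (act (groupOf k H) Y).left ⁻¹ᵁ π.left ⁻¹ᵁ W = (proj (groupOf k H) Y).left ⁻¹ᵁ π.left ⁻¹ᵁ W := by
  rw [← Scheme.Hom.comp_preimage, ← Scheme.Hom.comp_preimage, ← Over.comp_left, ← Over.comp_left,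
    hπ.invariant]

theorem IsGoodQuotient.isAffineOpen_preimage (hπ : IsGoodQuotient (groupOf k H) π)
    (W : X.left.affineOpens) : IsAffineOpen (π.left ⁻¹ᵁ W) :=
  have := hπ.affine
  W.2.preimage π.left

/-- The restriction of sections, as a homomorphism of `k`-algebras. -/
def resAlgHom {V V' : Y.left.Opens} (h : V' ≤ V) : Γ(Y.left, V) →ₐ[k] Γ(Y.left, V') where
  __ := res h
  commutes' c := by
    have h1 := Scheme.Hom.appLE_map Y.hom (U := ⊤) (V := V) le_top (homOfLE h).op
    exact congrArg (fun f => CommRingCat.Hom.hom ((Scheme.ΓSpecIso (.of k)).inv ≫ f) c) h1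

theorem IsGoodQuotient.exists_reynolds [Algebra.Smooth k H] (hG : IsLinearlyReductive k H)
    (hπ : IsGoodQuotient (groupOf k H) π) :
    ∃ R : ∀ W : X.left.affineOpens, Γ(Y.left, π.left ⁻¹ᵁ W) →+ Γ(Y.left, π.left ⁻¹ᵁ W),
      (∀ W : X.left.affineOpens, IsReynolds p (π.left.app W).hom.range (R W)) ∧
      ∀ (W W' : X.left.affineOpens) (h : W'.1 ≤ W.1) (a),
        R W' (res (π.left.preimage_mono h) a) = res (π.left.preimage_mono h) (R W a) := by
  obtain ⟨l, hl1, hl⟩ := hG.exists_integral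
  refine ⟨fun W => reynolds l (coaction (hπ.isAffineOpen_preimage W) (hπ.preimage_act_eq W)),
    fun W => ?_, fun W W' h a => ?_⟩
  · have h1 : (π.left.app W).hom.range =
        coinvariants (coaction (hπ.isAffineOpen_preimage W) (hπ.preimage_act_eq W)) := by
      ext a
      rw [mem_coinvariants_coaction_iff, ← SetLike.mem_coe, RingHom.coe_range]
      exact Set.ext_iff.1 (hπ.range_eq W) a
    rw [h1]
    exact isReynolds_reynolds hl1 hl (hG.integral_pow hl1 hl) (isCoassoc_coaction _ _)
  · exact reynolds_map l (resAlgHom (π.left.preimage_mono h))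
      (coaction_map _ _ _ _ (resAlgHom (π.left.preimage_mono h))
        (IsAffineOpen.map_fromSpec (hπ.isAffineOpen_preimage W) (hπ.isAffineOpen_preimage W')
          (homOfLE (π.left.preimage_mono h)).op)) a

theorem Lifting.LiftsFrobenius.exists_splitting {Yt : Lifting p Y}
    {FYt : Yt.total.left ⟶ Yt.total.left} (hFYt : Yt.LiftsFrobenius FYt)
    (hYfin : IsEssFiniteType Y) (hYnor : IsNormal Y.left) :
    ∃ τ : ∀ V : Y.left.affineOpens, Γ(Y.left, V) →+ Γ(Y.left, V),
      (∀ V : Y.left.affineOpens, IsFrobeniusSplitting p (τ V)) ∧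
      ∀ (V V' : Y.left.affineOpens) (h : V'.1 ≤ V.1) (a), τ V' (res h a) = res h (τ V a) := by
  have := isLocallyNoetherian_of_isEssFiniteType hYfin
  have h0 : ∀ V : Y.left.affineOpens, ∃ τ, (hFYt.frobLiftAlg V.2).IsSplitting τ := fun V => by
    have := IsLocallyNoetherian.component_noetherian V
    exact FrobLiftAlg.exists_isSplitting _ (isLocallyFFinite_of_isEssFiniteType hYfin V.2)
      (hYnor.isNormalRing V.2)
  choose τ hτ using h0
  refine ⟨fun V => AddMonoidHom.mk' (τ V) ((hτ V).map_add
    (isLocallyFFinite_of_isEssFiniteType hYfin V.2) (hYnor.isNormalRing V.2)), fun V => ⟨?_, ?_⟩,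
    fun V V' h a => ?_⟩
  · exact (hτ V).map_pow_mul
      (isLocallyFFinite_of_isEssFiniteType hYfin V.2) (hYnor.isNormalRing V.2)
  · exact (hτ V).map_one
      (isLocallyFFinite_of_isEssFiniteType hYfin V.2) (hYnor.isNormalRing V.2)
  · exact FrobLiftAlg.IsHom.map_splitting (hFYt.isHom_res V.2 V'.2 h) (hτ V) (hτ V')
      (isLocallyFFinite_of_isEssFiniteType hYfin V.2) (hYnor.isNormalRing V'.2)
      (by
        intro P _ L _ _ _ _ hL
        exact isLocalization_comap_of_le V.2 V'.2 h P L hL) a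

end Reynolds

/-- Compatible subrings of the sections of a lifting of `Y` that lift the sections of `X`, with
compatible liftings of the Frobenius. -/
structure DescentDatum {p : ℕ} [Fact p.Prime] {k : Type u} [Field k] [CharP k p] [PerfectField k]
    {Y X : Over (Spec (.of k))} (π : Y ⟶ X) (Yt : Lifting p Y) where
  /-- the sections over an affine open -/
  ring (W : X.left.affineOpens) : Subring Γ(Yt.total.left, Yt.tilde (π.left ⁻¹ᵁ W))
  exists_app_eq {W : X.left.affineOpens} (s) (hs : s ∈ ring W) : ∃ b, π.left.app W b = Yt.redHom _ s
  exists_redHom_eq {W : X.left.affineOpens} (b) : ∃ s ∈ ring W, Yt.redHom _ s = π.left.app W b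
  exists_eq_p_mul {W : X.left.affineOpens} (s) (hs : s ∈ ring W) (h0 : Yt.redHom _ s = 0) : ∃ t ∈ ring W, s = p * t
  res_mem {W W' : X.left.affineOpens} (h : W'.1 ≤ W.1) {s} (hs : s ∈ ring W) :
    res (Yt.tilde_mono (π.left.preimage_mono h)) s ∈ ring W'
  mem_of_locally {W : X.left.affineOpens} (s b) (hs : π.left.app W b = Yt.redHom _ s)
    (h : ∀ x ∈ W.1, ∃ (W' : X.left.affineOpens) (h : W'.1 ≤ W.1), x ∈ W'.1 ∧
      res (Yt.tilde_mono (π.left.preimage_mono h)) s ∈ ring W') : s ∈ ring W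
  pow_add_p_mul_mem {W : X.left.affineOpens} (s t) (hs : ∃ b, π.left.app W b = Yt.redHom _ s)
    (ht : ∃ b, π.left.app W b = Yt.redHom _ t) : s ^ p + p * t ∈ ring W
  /-- the lifting of the Frobenius -/
  frob (W : X.left.affineOpens) : ring W →+* ring W
  redHom_frob {W : X.left.affineOpens} (s) : Yt.redHom _ (frob W s).1 = Yt.redHom _ s.1 ^ p
  frob_res {W W' : X.left.affineOpens} (h : W'.1 ≤ W.1) (s : ring W) (s' : ring W')
    (hs : s'.1 = res (Yt.tilde_mono (π.left.preimage_mono h)) s.1) :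
    (frob W' s').1 = res (Yt.tilde_mono (π.left.preimage_mono h)) (frob W s).1

/-- The ring over `W` is the invariant part of the Frobenius lifting on its preimage. Compatibility
and locality hold because membership amounts to the vanishing of a section, the obstruction, that
commutes with restriction. -/
theorem IsGoodQuotient.exists_descentDatum {p : ℕ} [Fact p.Prime] {k : Type u} [Field k]
    [CharP k p] [PerfectField k] {H : Type u} [CommRing H] [HopfAlgebra k H] [Algebra.Smooth k H]
    (hG : IsLinearlyReductive k H) {Y X : Over (Spec (.of k))} (hYfin : IsEssFiniteType Y)
    (hYnor : IsNormal Y.left) [ModObj (groupOf k H) Y] {π : Y ⟶ X}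
    (hπ : IsGoodQuotient (groupOf k H) π) {Yt : Lifting p Y}
    {FYt : Yt.total.left ⟶ Yt.total.left} (hFYt : Yt.LiftsFrobenius FYt) :
    Nonempty (DescentDatum π Yt) := by
  obtain ⟨R, hR, hRR⟩ := hπ.exists_reynolds (p := p) hG
  obtain ⟨τ, hτ, hττ⟩ := hFYt.exists_splitting hYfin hYnor
  have hV := hπ.isAffineOpen_preimage
  let F (W : X.left.affineOpens) := hFYt.frobLiftAlg (hV W)
  have hτ' (W : X.left.affineOpens) := hτ ⟨_, hV W⟩
  have hF {W W' : X.left.affineOpens} (h : W'.1 ≤ W.1) :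
      (F W).IsHom (F W') (res (Yt.tilde_mono (π.left.preimage_mono h)))
        (res (π.left.preimage_mono h)) := hFYt.isHom_res _ _ _
  have happ {W W' : X.left.affineOpens} (h : W'.1 ≤ W.1) (b) :
      res (π.left.preimage_mono h) (π.left.app W b) = π.left.app W' (res h b) :=
    (congrArg (fun f => CommRingCat.Hom.hom f b) (π.left.naturality (homOfLE h).op)).symm
  exact ⟨{
    ring W := (F W).invariants (hR W) (hτ' W)
    exists_app_eq s hs := hs.1
    exists_redHom_eq b := FrobLiftAlg.exists_mem_invariants (hR _) (hτ' _) ⟨b, rfl⟩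
    exists_eq_p_mul s hs h0 := FrobLiftAlg.exists_eq_p_mul (hR _) (hτ' _) hs h0
    res_mem {W W'} h {s} hs := (hF h).map_mem_invariants (hR _) (hτ' _) (hRR W W' h)
      (hττ ⟨_, hV W⟩ ⟨_, hV W'⟩ (π.left.preimage_mono h)) (hR _) (hτ' _) (by
        rintro _ ⟨b, rfl⟩
        exact ⟨_, (happ h b).symm⟩) hs
    mem_of_locally {W} s b hs h := by
      refine ⟨⟨b, hs⟩, ?_⟩
      refine eq_of_locally_res_eq fun y hy => ?_
      obtain ⟨W', hW', hyW', hs'⟩ := h _ hy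
      refine ⟨π.left ⁻¹ᵁ W', π.left.preimage_mono hW', hyW', ?_⟩
      rw [map_zero]
      exact ((hF hW').obstr (hRR W W' hW')
        (hττ ⟨_, hV W⟩ ⟨_, hV W'⟩ (π.left.preimage_mono hW')) s).symm.trans hs'.2
    pow_add_p_mul_mem s t hs ht :=
      FrobLiftAlg.pow_add_p_mul_mem_invariants (hR _) (hτ' _) hs ht
    frob W := ((F W).descend (hR W) (hτ' W)).φ
    redHom_frob {W} s := congrArg Subtype.val (((F W).descend (hR W) (hτ' W)).q_φ s)
    frob_res {W W'} h s s' hs := (hF h).map_descend_φ (hR _) (hτ' _) (hRR W W' h) (hR _) (hτ' _)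
      s s' hs }⟩

end

section

/-! ### Thickenings -/

/-- A sheaf of rings on a scheme that reduces to the structure sheaf and, over affine opens, is a
flat lifting modulo `p ^ 2`. -/
structure Thickening (p : ℕ) (X : Scheme.{u}) where
  /-- the underlying presheaf -/
  presheaf : TopCat.Presheaf CommRingCat.{u} (TopCat.of X)
  isSheaf : presheaf.IsSheaf
  /-- the reduction -/
  q : presheaf ⟶ X.presheaf
  surj {U : X.Opens} (hU : IsAffineOpen U) : Function.Surjective (q.app (.op U)).hom
  q_eq_zero {U : X.Opens} (hU : IsAffineOpen U) (s : presheaf.obj (.op U)) :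
    q.app (.op U) s = 0 → ∃ t, s = p * t
  p_mul_p (U : X.Opens) : (p : presheaf.obj (.op U)) * p = 0
  p_eq_zero : (p : Γ(X, ⊤)) = 0
  tors {U : X.Opens} (s : presheaf.obj (.op U)) : p * s = 0 → q.app (.op U) s = 0

namespace Thickening

open TopologicalSpace Opposite

variable {p : ℕ} {X : Scheme.{u}} (T : Thickening p X)

/-- The restriction of sections. -/
abbrev res {U V : X.Opens} (h : V ≤ U) : T.presheaf.obj (op U) →+* T.presheaf.obj (op V) :=
  (T.presheaf.map (homOfLE h).op).hom

/-- The reduction of sections. -/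
abbrev red (U : X.Opens) : T.presheaf.obj (op U) →+* Γ(X, U) := (T.q.app (op U)).hom

theorem red_res {U V : X.Opens} (h : V ≤ U) (s) : T.red V (T.res h s) = FrobLift.res h (T.red U s) :=
  congrArg (fun f => CommRingCat.Hom.hom f s) (T.q.naturality (homOfLE h).op)

theorem res_res {U V W : X.Opens} (h : V ≤ U) (h' : W ≤ V) (s) :
    T.res h' (T.res h s) = T.res (h'.trans h) s :=
  congrArg (fun f => CommRingCat.Hom.hom f s)
    (T.presheaf.map_comp (homOfLE h).op (homOfLE h').op).symm

theorem isUnit_of_isUnit_red {U : X.Opens} (hU : IsAffineOpen U) {s : T.presheaf.obj (op U)}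
    (h : IsUnit (T.red U s)) : IsUnit s := by
  obtain ⟨b, hb⟩ := h.exists_right_inv
  obtain ⟨t, rfl⟩ := T.surj hU b
  obtain ⟨c, hc⟩ := T.q_eq_zero hU (s * t - 1) (by
    change T.red U (s * t - 1) = 0
    rw [map_sub, map_mul, map_one]
    exact sub_eq_zero.2 hb)
  refine IsUnit.of_mul_eq_one (t * (1 - p * c)) ?_
  rw [← mul_assoc, sub_eq_iff_eq_add.1 hc]
  linear_combination -c ^ 2 * T.p_mul_p U

/-- The reduction on stalks. -/
abbrev stalkRed (x : X) : T.presheaf.stalk x →+* X.presheaf.stalk x :=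
  ((TopCat.Presheaf.stalkFunctor CommRingCat x).map T.q).hom

theorem stalkRed_germ {U : X.Opens} {x : X} (hx : x ∈ U) (s : T.presheaf.obj (op U)) :
    T.stalkRed x (T.presheaf.germ U x hx s) = X.presheaf.germ U x hx (T.red U s) :=
  TopCat.Presheaf.stalkFunctor_map_germ_apply U x hx T.q s

theorem germ_res {U V : X.Opens} (h : V ≤ U) {x : X} (hx : x ∈ V) (s : T.presheaf.obj (op U)) :
    T.presheaf.germ V x hx (T.res h s) = T.presheaf.germ U x (h hx) s :=
  TopCat.Presheaf.germ_res_apply T.presheaf (homOfLE h) x hx s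

theorem _root_.AlgebraicGeometry.Scheme.exists_isUnit_res {X : Scheme.{u}} {U : X.Opens} {x : X}
    {hx : x ∈ U} {s : Γ(X, U)} (h : IsUnit (X.presheaf.germ U x hx s)) :
    ∃ (V : X.Opens) (hV : V ≤ U), IsAffineOpen V ∧ x ∈ V ∧ IsUnit (FrobLift.res hV s) := by
  obtain ⟨V, i, hxV, hV⟩ := X.toRingedSpace.isUnit_res_of_isUnit_germ U s x hx h
  obtain ⟨W, hW, hxW, hWV⟩ := exists_isAffineOpen_mem_and_subset hxV
  have h1 : W ≤ V := hWV
  refine ⟨W, h1.trans i.le, hW, hxW, ?_⟩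
  rw [← FrobLift.res_res i.le h1]
  exact IsUnit.map (FrobLift.res h1) hV

instance isLocalHom_stalkRed (x : X) : IsLocalHom (T.stalkRed x) where
  map_nonunit a ha := by
    obtain ⟨U, hxU, s, rfl⟩ := TopCat.Presheaf.exists_germ_eq T.presheaf a
    rw [stalkRed_germ] at ha
    obtain ⟨W, hWU, hW, hxW, h⟩ := AlgebraicGeometry.Scheme.exists_isUnit_res ha
    rw [← red_res] at h
    have h2 := (T.isUnit_of_isUnit_red hW h).map (T.presheaf.germ W x hxW).hom
    exact (congrArg IsUnit (T.germ_res hWU hxW s)).mp h2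

/-- The locally ringed space defined by a thickening. -/
def toLRS : LocallyRingedSpace.{u} where
  carrier := TopCat.of X
  presheaf := T.presheaf
  IsSheaf := T.isSheaf
  isLocalRing x := (T.stalkRed x).domain_isLocalRing

/-- The inclusion of a scheme in its thickening. -/
def ofScheme : X.toLocallyRingedSpace ⟶ T.toLRS where
  base := 𝟙 _
  c := T.q
  prop x := by
    refine ⟨fun a ha => ?_⟩
    obtain ⟨U, hxU, s, rfl⟩ := TopCat.Presheaf.exists_germ_eq T.presheaf a
    have h := PresheafedSpace.stalkMap_germ_apply (X := X.toPresheafedSpace)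
      (Y := T.toLRS.toPresheafedSpace) ⟨𝟙 _, T.q⟩ U x hxU s
    have h1 := (congrArg IsUnit h).mp ha
    exact isUnit_of_map_unit (T.stalkRed x) _ ((congrArg IsUnit (T.stalkRed_germ hxU s)).mpr h1)

/-- The restriction of a thickening to an open subscheme. -/
def restrict (W : X.Opens) : Thickening p W where
  presheaf := W.isOpenEmbedding.functor.op ⋙ T.presheaf
  isSheaf := (T.toLRS.restrict W.isOpenEmbedding).IsSheaf
  q := Functor.whiskerLeft _ T.q
  surj hU := T.surj (hU.image_of_isOpenImmersion W.ι)
  q_eq_zero hU := T.q_eq_zero (hU.image_of_isOpenImmersion W.ι)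
  p_mul_p U := T.p_mul_p (W.ι ''ᵁ U)
  p_eq_zero := natCast_section_eq_zero T.p_eq_zero (W.ι ''ᵁ ⊤)
  tors {U} := T.tors (U := W.ι ''ᵁ U)

/-! ### Thickenings of affine schemes are affine. -/

section Affine

variable [IsAffine X]

theorem exists_pow_mul_eq_zero (b : Γ(X, ⊤)) {s : Γ(X, ⊤)}
    (h : FrobLift.res (X.basicOpen_le b) s = 0) : ∃ n, b ^ n * s = 0 :=
  exists_pow_mul_eq_zero_of_res_basicOpen_eq_zero_of_isAffineOpen X (isAffineOpen_top X) s b h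

theorem exists_res_eq_pow_mul (b : Γ(X, ⊤)) (t : Γ(X, X.basicOpen b)) :
    ∃ n s, FrobLift.res (X.basicOpen_le b) s = FrobLift.res (X.basicOpen_le b) b ^ n * t :=
  exists_eq_pow_mul_of_isAffineOpen X ⊤ (isAffineOpen_top X) b t

/-- The injectivity half of comparing the stalk with a localization. A power of `f` makes `s` a
multiple `p * t`; by `tors` the reduction of `t` vanishes near `x`, and a second power leaves a
multiple of `p * p = 0`. -/
theorem exists_mul_eq_zero {x : X} {s : T.presheaf.obj (op ⊤)}
    (hs : T.presheaf.germ ⊤ x trivial s = 0) :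
    ∃ f : T.presheaf.obj (op ⊤), IsUnit (T.presheaf.germ ⊤ x trivial f) ∧ f * s = 0 := by
  obtain ⟨V, hxV, i, i', hV⟩ := TopCat.Presheaf.germ_eq T.presheaf x (U := ⊤) (V := ⊤) trivial trivial s 0
    (hs.trans (map_zero (T.presheaf.germ ⊤ x trivial).hom).symm)
  obtain ⟨b, hb, hxb⟩ := (isAffineOpen_top X).exists_basicOpen_le (V := V) ⟨x, hxV⟩ trivial
  have h0 : T.res (X.basicOpen_le b) s = 0 := by
    have h1 : T.res i.le s = 0 := hV.trans (map_zero (T.presheaf.map i'.op).hom)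
    rw [← T.res_res i.le hb, h1, map_zero]
  obtain ⟨f, hf⟩ := T.surj (isAffineOpen_top X) b
  have hu : IsUnit (T.presheaf.germ ⊤ x trivial f) := by
    refine isUnit_of_map_unit (T.stalkRed x) _ ?_
    have h1 := T.stalkRed_germ (U := ⊤) (x := x) trivial f
    refine (congrArg IsUnit (h1.trans (congrArg _ hf))).mpr ?_
    exact (Scheme.mem_basicOpen X b x trivial).1 hxb
  obtain ⟨n, hn⟩ := exists_pow_mul_eq_zero b (s := T.red ⊤ s) (by rw [← red_res, h0, map_zero])
  obtain ⟨t, ht⟩ := T.q_eq_zero (isAffineOpen_top X) (f ^ n * s) (by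
    change T.red ⊤ (f ^ n * s) = 0
    rw [map_mul, map_pow]
    exact (congrArg (fun c => c ^ n * T.red ⊤ s) hf).trans hn)
  have h2 : T.red (X.basicOpen b) (T.res (X.basicOpen_le b) t) = 0 := by
    refine T.tors _ ?_
    have h3 := congrArg (T.res (X.basicOpen_le b)) ht
    rwa [map_mul, h0, mul_zero, map_mul, map_natCast, eq_comm] at h3
  obtain ⟨m, hm⟩ := exists_pow_mul_eq_zero b (s := T.red ⊤ t) (by rw [← red_res, h2])
  obtain ⟨w, hw⟩ := T.q_eq_zero (isAffineOpen_top X) (f ^ m * t) (by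
    change T.red ⊤ (f ^ m * t) = 0
    rw [map_mul, map_pow]
    exact (congrArg (fun c => c ^ m * T.red ⊤ t) hf).trans hm)
  refine ⟨f ^ m * f ^ n, ?_, ?_⟩
  · rw [map_mul, map_pow, map_pow]
    exact (hu.pow m).mul (hu.pow n)
  · linear_combination f ^ m * ht + p * hw + w * T.p_mul_p ⊤

/-- The surjectivity half: denominators are cleared modulo `p`, and then once more for the error
term divided by `p`. -/
theorem exists_mul_germ_eq {x : X} (t : T.presheaf.stalk x) :
    ∃ f s : T.presheaf.obj (op ⊤), IsUnit (T.presheaf.germ ⊤ x trivial f) ∧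
      T.presheaf.germ ⊤ x trivial f * t = T.presheaf.germ ⊤ x trivial s := by
  obtain ⟨V, hxV, t, rfl⟩ := TopCat.Presheaf.exists_germ_eq T.presheaf t
  obtain ⟨b, hb, hxb⟩ := (isAffineOpen_top X).exists_basicOpen_le (V := V) ⟨x, hxV⟩ trivial
  obtain ⟨f, hf⟩ := T.surj (isAffineOpen_top X) b
  have hbe := X.basicOpen_le b
  have hu : IsUnit (T.presheaf.germ ⊤ x trivial f) := by
    refine isUnit_of_map_unit (T.stalkRed x) _ ?_
    have h1 := T.stalkRed_germ (U := ⊤) (x := x) trivial f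
    refine (congrArg IsUnit (h1.trans (congrArg _ hf))).mpr ?_
    exact (Scheme.mem_basicOpen X b x trivial).1 hxb
  have hfr : T.red (X.basicOpen b) (T.res hbe f) = FrobLift.res hbe b := by
    rw [red_res]
    exact congrArg _ hf
  obtain ⟨n, c, hc⟩ := exists_res_eq_pow_mul b (T.red _ (T.res hb t))
  obtain ⟨s, rfl⟩ := T.surj (isAffineOpen_top X) c
  obtain ⟨w, hw⟩ := T.q_eq_zero ((isAffineOpen_top X).basicOpen b)
    (T.res hbe f ^ n * T.res hb t - T.res hbe s) (by
      change T.red _ (T.res hbe f ^ n * T.res hb t - T.res hbe s) = 0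
      rw [map_sub, map_mul, map_pow, hfr, T.red_res hbe s]
      exact sub_eq_zero.2 hc.symm)
  obtain ⟨m, d, hd⟩ := exists_res_eq_pow_mul b (T.red _ w)
  obtain ⟨e, rfl⟩ := T.surj (isAffineOpen_top X) d
  obtain ⟨v, hv⟩ := T.q_eq_zero ((isAffineOpen_top X).basicOpen b)
    (T.res hbe f ^ m * w - T.res hbe e) (by
      change T.red _ (T.res hbe f ^ m * w - T.res hbe e) = 0
      rw [map_sub, map_mul, map_pow, hfr, T.red_res hbe e]
      exact sub_eq_zero.2 hd.symm)
  refine ⟨f ^ m * f ^ n, f ^ m * s + p * e, ?_, ?_⟩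
  · rw [map_mul, map_pow, map_pow]
    exact (hu.pow m).mul (hu.pow n)
  · have h1 : T.res hbe (f ^ m * f ^ n) * T.res hb t = T.res hbe (f ^ m * s + p * e) := by
      simp only [map_mul, map_add, map_pow, map_natCast]
      linear_combination T.res hbe f ^ m * hw + p * hv + v * T.p_mul_p (X.basicOpen b)
    have h2 := congrArg (T.presheaf.germ (X.basicOpen b) x hxb).hom h1
    rw [map_mul] at h2
    refine Eq.trans ?_ (h2.trans (T.germ_res hbe hxb _))
    exact congrArg₂ _ (T.germ_res hbe hxb _).symm (T.germ_res hb hxb _).symm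

theorem isIso_stalkMap_toΓSpec (x : T.toLRS) : IsIso (T.toLRS.toΓSpec.stalkMap x) := by
  let P : PrimeSpectrum (T.presheaf.obj (op ⊤)) := T.toLRS.toΓSpecFun x
  let R := T.presheaf.obj (op ⊤)
  let A := (Spec.structureSheaf R).presheaf.stalk P
  let g : A →+* T.presheaf.stalk x := (T.toLRS.toΓSpec.stalkMap x).hom
  have hg : ∀ r, g (algebraMap R A r) = T.presheaf.germ ⊤ x trivial r := fun r =>
    congrArg (fun f => CommRingCat.Hom.hom f r) (T.toLRS.toStalk_stalkMap_toΓSpec x)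
  have hl : IsLocalHom g := LocallyRingedSpace.isLocalHomStalkMap _ x
  have hM : ∀ a : A, ∃ r m, IsUnit (algebraMap R A m) ∧ a * algebraMap R A m = algebraMap R A r := by
    intro a
    obtain ⟨⟨r, m⟩, h⟩ := IsLocalization.surj P.asIdeal.primeCompl a
    exact ⟨r, m, IsLocalization.map_units A m, h⟩
  have hu : ∀ f, IsUnit (T.presheaf.germ ⊤ x trivial f) → IsUnit (algebraMap R A f) := by
    intro f hf
    exact isUnit_of_map_unit g _ ((hg f).symm ▸ hf)
  suffices h : Function.Bijective g from (ConcreteCategory.isIso_iff_bijective _).2 h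
  constructor
  · rw [injective_iff_map_eq_zero]
    intro a ha
    obtain ⟨r, m, hm, ham⟩ := hM a
    obtain ⟨f, hf, hfr⟩ := T.exists_mul_eq_zero (x := x) (s := r) (by
      rw [← hg, ← ham, map_mul, ha, zero_mul])
    have h1 : algebraMap R A f * algebraMap R A r = 0 := by rw [← map_mul, hfr, map_zero]
    rw [(hu f hf).mul_right_eq_zero, ← ham, hm.mul_left_eq_zero] at h1
    exact h1
  · intro t
    obtain ⟨f, s, hf, hfs⟩ := T.exists_mul_germ_eq t
    obtain ⟨v, hv⟩ := (hu f hf).exists_left_inv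
    refine ⟨v * algebraMap R A s, ?_⟩
    rw [map_mul, hg, ← hfs, ← hg, ← mul_assoc, ← map_mul, hv, map_one, one_mul]

theorem isHomeomorph_toΓSpec : IsHomeomorph T.toLRS.toΓSpecFun := by
  have h1 : IsHomeomorph (X.toLocallyRingedSpace.toΓSpecFun) := by
    have : IsIso X.toSpecΓ := IsAffine.affine
    exact (Scheme.homeoOfIso (asIso X.toSpecΓ)).isHomeomorph
  have h2 : IsHomeomorph (PrimeSpectrum.comap (T.red ⊤)) := by
    refine PrimeSpectrum.isHomeomorph_comap _ (fun a => ?_) (fun a ha => ?_)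
    · obtain ⟨s, hs⟩ := T.surj (isAffineOpen_top X) a
      exact ⟨1, one_pos, s, hs.trans (pow_one a).symm⟩
    · obtain ⟨t, rfl⟩ := T.q_eq_zero (isAffineOpen_top X) a ha
      exact mem_nilradical.2 ⟨2, by rw [mul_pow, pow_two (p : T.presheaf.obj (op ⊤)), T.p_mul_p, zero_mul]⟩
  have h3 : T.toLRS.toΓSpecFun = PrimeSpectrum.comap (T.red ⊤) ∘ X.toLocallyRingedSpace.toΓSpecFun := by
    funext x
    apply PrimeSpectrum.ext
    ext r
    rw [← not_iff_not]
    refine (T.toLRS.notMem_prime_iff_unit_in_stalk r x).trans (Iff.trans ?_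
      (X.toLocallyRingedSpace.notMem_prime_iff_unit_in_stalk (T.red ⊤ r) x).symm)
    have h4 := T.stalkRed_germ (U := ⊤) (x := x) trivial r
    exact (@isUnit_map_iff _ _ _ _ _ _ _ (T.stalkRed x) (T.isLocalHom_stalkRed x) _).symm.trans (iff_of_eq (congrArg IsUnit h4))
  rw [h3]
  exact h2.comp h1

theorem isIso_toΓSpec : IsIso T.toLRS.toΓSpec := by
  have h0 : ∀ x, IsIso (T.toLRS.toΓSpec.stalkMap x) := T.isIso_stalkMap_toΓSpec
  have h : LocallyRingedSpace.IsOpenImmersion T.toLRS.toΓSpec :=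
    LocallyRingedSpace.IsOpenImmersion.of_stalk_iso _ T.isHomeomorph_toΓSpec.isOpenEmbedding
  have h2 : Epi T.toLRS.toΓSpec.base :=
    (TopCat.epi_iff_surjective _).2 T.isHomeomorph_toΓSpec.surjective
  exact LocallyRingedSpace.IsOpenImmersion.to_iso _

end Affine

/-- The scheme defined by a thickening. -/
def toScheme : Scheme.{u} where
  __ := T.toLRS
  local_affine x := by
    obtain ⟨W, hW, hxW, -⟩ := exists_isAffineOpen_mem_and_subset (x := x) (U := ⊤) trivial
    have : IsAffine W := hW
    exact ⟨⟨W, hxW⟩, _, ⟨@asIso _ _ _ _ _ (T.restrict W).isIso_toΓSpec⟩⟩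

end Thickening

end

section

/-! ### The scheme defined by a thickening -/

/-- The only ideals of `W` are `0`, `(c)` and `W`, so injectivity is at issue for `(c)` alone, where
every tensor has the form `c ⊗ m`. -/
theorem flat_of_forall_p_mul {W M : Type u} [CommRing W] [AddCommGroup M] [Module W M] (c : W)
    (hc : ∀ a : W, IsUnit a ∨ c ∣ a) (hcc : c * c = 0)
    (h : ∀ m : M, c • m = 0 → ∃ m', m = c • m') : Module.Flat W M := by
  rw [Module.Flat.iff_rTensor_injective']
  intro I
  have hI : I = ⊥ ∨ I = ⊤ ∨ I = Ideal.span {c} := by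
    by_cases h1 : ∃ a ∈ I, IsUnit a
    · obtain ⟨a, ha, hu⟩ := h1
      exact .inr (.inl (I.eq_top_of_isUnit_mem ha hu))
    by_cases h2 : c ∈ I
    · refine .inr (.inr (le_antisymm (fun a ha => ?_) ((Ideal.span_singleton_le_iff_mem I).2 h2)))
      exact Ideal.mem_span_singleton.2 ((hc a).resolve_left fun hu => h1 ⟨a, ha, hu⟩)
    · refine .inl (eq_bot_iff.2 fun a ha => ?_)
      obtain ⟨b, rfl⟩ := (hc a).resolve_left fun hu => h1 ⟨a, ha, hu⟩
      rcases hc b with ⟨b, rfl⟩ | ⟨d, rfl⟩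
      · exact (h2 ((Ideal.mul_unit_mem_iff_mem I b.isUnit).1 ha)).elim
      · rw [← mul_assoc, hcc, zero_mul]
        exact Ideal.zero_mem _
  rcases hI with rfl | rfl | rfl
  · intro x y _
    have : Subsingleton (TensorProduct W (⊥ : Ideal W) M) := inferInstance
    exact Subsingleton.elim x y
  · have h1 : (⊤ : Ideal W).subtype = (Submodule.topEquiv : (⊤ : Ideal W) ≃ₗ[W] W).toLinearMap := rfl
    rw [h1]
    exact (LinearEquiv.rTensor M (Submodule.topEquiv : (⊤ : Ideal W) ≃ₗ[W] W)).injective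
  · rw [← LinearMap.ker_eq_bot, LinearMap.ker_eq_bot']
    let c' : Ideal.span {c} := ⟨c, Ideal.mem_span_singleton_self c⟩
    have h1 : ∀ x : TensorProduct W (Ideal.span {c}) M, ∃ m, x = c' ⊗ₜ m := by
      intro x
      induction x using TensorProduct.induction_on with
      | zero => exact ⟨0, by rw [TensorProduct.tmul_zero]⟩
      | add x y hx hy =>
        obtain ⟨m, rfl⟩ := hx
        obtain ⟨n, rfl⟩ := hy
        exact ⟨m + n, by rw [TensorProduct.tmul_add]⟩
      | tmul a m =>
        obtain ⟨b, hb⟩ := Ideal.mem_span_singleton.1 a.2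
        refine ⟨b • m, ?_⟩
        rw [← TensorProduct.smul_tmul]
        congr 1
        exact Subtype.ext (hb.trans (mul_comm _ _))
    intro x hx
    obtain ⟨m, rfl⟩ := h1 x
    have h2 := congrArg (TensorProduct.lid W M) hx
    rw [LinearMap.rTensor_tmul, TensorProduct.lid_tmul, map_zero] at h2
    obtain ⟨m', rfl⟩ := h m h2
    rw [← TensorProduct.smul_tmul, show c • c' = 0 from Subtype.ext hcc, TensorProduct.zero_tmul]

theorem W2.isUnit_or_dvd (p : ℕ) [Fact p.Prime] {k : Type u} [Field k] [CharP k p] [PerfectField k]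
    (a : W2 p k) : IsUnit a ∨ (p : W2 p k) ∣ a := by
  by_cases h : residue p k a = 0
  · exact .inr (W2.exists_eq_p_mul p h)
  · obtain ⟨b, hb⟩ := W2.residue_surjective p (residue p k a)⁻¹
    obtain ⟨c, hc⟩ := W2.exists_eq_p_mul p (x := a * b - 1) (by
      rw [map_sub, map_mul, hb, mul_inv_cancel₀ h, map_one, sub_self])
    refine .inl (IsUnit.of_mul_eq_one (b * (1 - p * c)) ?_)
    rw [← mul_assoc, sub_eq_iff_eq_add.1 hc]
    linear_combination -c ^ 2 * W2.p_mul_p (k := k) p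

theorem W2.flat_of_forall_p_mul (p : ℕ) [Fact p.Prime] {k : Type u} [Field k] [CharP k p]
    [PerfectField k] {S : Type u} [CommRing S] (w : W2 p k →+* S)
    (h : ∀ s : S, p * s = 0 → ∃ t, s = p * t) : w.Flat := by
  let : Algebra (W2 p k) S := w.toAlgebra
  have e : ∀ s : S, (p : W2 p k) • s = p * s := fun s => by rw [Algebra.smul_def, map_natCast]
  refine FrobLift.flat_of_forall_p_mul (M := S) (p : W2 p k) (W2.isUnit_or_dvd p) (W2.p_mul_p p)
    fun m hm => ?_
  rw [e] at hm
  obtain ⟨t, ht⟩ := h m hm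
  exact ⟨t, ht.trans (e t).symm⟩

namespace Thickening

open TopologicalSpace Opposite

variable {p : ℕ} {X : Scheme.{u}} (T : Thickening p X)

theorem isAffineOpen {W : X.Opens} (hW : IsAffineOpen W) : IsAffineOpen (X := T.toScheme) W := by
  have : IsAffine W := hW
  have h := (T.restrict W).isIso_toΓSpec
  refine ⟨?_⟩
  have h2 : IsIso (Scheme.forgetToLocallyRingedSpace.map
      (Scheme.toSpecΓ (Scheme.Opens.toScheme (X := T.toScheme) W))) := h
  exact isIso_of_reflects_iso _ Scheme.forgetToLocallyRingedSpace

/-- The inclusion of a scheme in its thickening. -/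
def incl : X ⟶ T.toScheme := ⟨T.ofScheme⟩

instance isClosedImmersion_incl : IsClosedImmersion T.incl := by
  have : SurjectiveOnStalks T.incl := by
    refine ⟨fun x t => ?_⟩
    obtain ⟨U, hxU, s, rfl⟩ := TopCat.Presheaf.exists_germ_eq X.presheaf t
    obtain ⟨W, hW, hxW, hWU⟩ := exists_isAffineOpen_mem_and_subset hxU
    obtain ⟨s', hs'⟩ := T.surj hW (FrobLift.res hWU s)
    refine ⟨T.presheaf.germ W x hxW s', ?_⟩
    have h := PresheafedSpace.stalkMap_germ_apply (X := X.toPresheafedSpace)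
      (Y := T.toLRS.toPresheafedSpace) ⟨𝟙 _, T.q⟩ W x hxW s'
    refine h.trans ((congrArg (X.presheaf.germ W x hxW).hom hs').trans ?_)
    exact TopCat.Presheaf.germ_res_apply X.presheaf (homOfLE hWU) x hxW s
  have : IsPreimmersion T.incl := ⟨Topology.IsEmbedding.id⟩
  refine IsClosedImmersion.of_isPreimmersion _ ?_
  have h : Set.range T.incl = Set.univ := Set.range_id
  rw [h]
  exact isClosed_univ

/-- Sections with zero reduction are locally multiples of `p`, so they pull back to zero wherever `p
= 0`. This factors such morphisms through `X` and gives the universal property of the special fibre.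
-/
theorem ker_incl_le {S : Scheme.{u}} (a : S ⟶ T.toScheme) (h : (p : Γ(S, ⊤)) = 0) :
    T.incl.ker ≤ a.ker := by
  refine Scheme.IdealSheafData.le_ofIdeals_iff.2 fun U s hs => ?_
  have hs0 : T.red U.1 s = 0 := T.incl.ideal_ker_le U hs
  have key : ∀ (V : X.Opens) (s : T.presheaf.obj (op V)), T.red V s = 0 → a.app V s = 0 := by
    intro V s hs0
    refine eq_of_locally_res_eq fun x hx => ?_
    obtain ⟨W, hW, hxW, hWV⟩ := exists_isAffineOpen_mem_and_subset (X := X) (U := V) (x := a x) hx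
    have hWV' : W ≤ V := hWV
    obtain ⟨t, ht⟩ := T.q_eq_zero hW (T.res hWV' s)
      ((T.red_res hWV' s).trans ((congrArg _ hs0).trans (map_zero _)))
    refine ⟨a ⁻¹ᵁ W, a.preimage_mono (U := W) (U' := V) hWV', hxW, ?_⟩
    have h1 : a.app W (T.res hWV' s) =
        FrobLift.res (X := S) (a.preimage_mono (U := W) (U' := V) hWV') (a.app V s) :=
      congrArg (fun f => CommRingCat.Hom.hom f s) (a.naturality (homOfLE hWV').op)
    have h2 : (a.app W).hom (T.res hWV' s) = 0 := by
      have h3 : ∀ c : T.toScheme.presheaf.obj (op W), (a.app W).hom (p * c) = 0 := fun c => by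
        rw [map_mul, map_natCast, natCast_section_eq_zero h, zero_mul]
      exact (congrArg (a.app W).hom ht).trans (h3 t)
    rw [map_zero]
    exact h1.symm.trans h2
  exact key U.1 s hs0

theorem _root_.AlgebraicGeometry.Scheme.appTop_toSpecΓ_comp_map {S : Scheme.{u}} {R : CommRingCat.{u}}
    (f : R ⟶ Γ(S, ⊤)) : (Scheme.ΓSpecIso R).inv ≫ (S.toSpecΓ ≫ Spec.map f).appTop = f := by
  rw [Scheme.Hom.comp_appTop, ← Scheme.ΓSpecIso_inv_naturality_assoc, Scheme.toSpecΓ_appTop,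
    Iso.inv_hom_id, Category.comp_id]

theorem _root_.AlgebraicGeometry.Scheme.appTop_comp_toSpecΓ_comp_map {Z S : Scheme.{u}}
    {R : CommRingCat.{u}} (i : Z ⟶ S) (f : R ⟶ Γ(S, ⊤)) :
    (Scheme.ΓSpecIso R).inv ≫ (i ≫ S.toSpecΓ ≫ Spec.map f).appTop = f ≫ i.appTop := by
  rw [Scheme.Hom.comp_appTop, ← Category.assoc, Scheme.appTop_toSpecΓ_comp_map]

theorem _root_.AlgebraicGeometry.Scheme.hom_ext_ΓSpecIso_inv {Z : Scheme.{u}}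
    {R : CommRingCat.{u}} {f g : Z ⟶ Spec R}
    (h : (Scheme.ΓSpecIso R).inv ≫ f.appTop = (Scheme.ΓSpecIso R).inv ≫ g.appTop) : f = g :=
  ext_to_Spec h

section Structure

variable {p : ℕ} [Fact p.Prime] {k : Type u} [Field k] [CharP k p] [PerfectField k]
  {X : Over (Spec (.of k))} (T : Thickening p X.left) (w : W2 p k →+* T.presheaf.obj (op ⊤))

/-- The structure morphism of a thickening over the Witt vectors of length two. -/
def toSpecW2 : T.toScheme ⟶ Spec (.of (W2 p k)) :=
  Scheme.toSpecΓ T.toScheme ≫ Spec.map (CommRingCat.ofHom w)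

theorem flat_toSpecW2 : Flat (T.toSpecW2 w) := by
  refine HasRingHomProperty.of_iSup_eq_top (P := @Flat)
    (fun W : X.left.affineOpens => (⟨W.1, T.isAffineOpen W.2⟩ : T.toScheme.affineOpens)) ?_ ?_
  · exact iSup_affineOpens_eq_top X.left
  · intro W
    have h : ((Scheme.ΓSpecIso (.of (W2 p k))).inv ≫
        (T.toSpecW2 w).appLE ⊤ W.1 le_top).hom.Flat :=
      W2.flat_of_forall_p_mul p _ fun s hs => T.q_eq_zero W.2 s (T.tors s hs)
    have h2 : ((T.toSpecW2 w).appLE ⊤ W.1 le_top) = (Scheme.ΓSpecIso (.of (W2 p k))).hom ≫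
        (Scheme.ΓSpecIso (.of (W2 p k))).inv ≫ (T.toSpecW2 w).appLE ⊤ W.1 le_top := by
      rw [Iso.hom_inv_id_assoc]
    have h3 := RingHom.Flat.comp (RingHom.Flat.of_bijective
      (ConcreteCategory.bijective_of_isIso (Scheme.ΓSpecIso (.of (W2 p k))).hom)) h
    exact (congrArg (fun f => (CommRingCat.Hom.hom f).Flat) h2).mpr h3

theorem incl_comp_toSpecW2 (hw : ∀ a, T.red ⊤ (w a) =
      ((Scheme.ΓSpecIso (.of k)).inv ≫ X.hom.appTop).hom (residue p k a)) :
    T.incl ≫ T.toSpecW2 w = X.hom ≫ Spec.map (CommRingCat.ofHom (residue p k)) := by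
  have h : CommRingCat.ofHom w ≫ T.incl.appTop =
      CommRingCat.ofHom (residue p k) ≫ (Scheme.ΓSpecIso (.of k)).inv ≫ X.hom.appTop := by
    ext a
    exact hw a
  refine Scheme.hom_ext_ΓSpecIso_inv ?_
  rw [Scheme.Hom.comp_appTop X.hom, ← Scheme.ΓSpecIso_inv_naturality_assoc]
  exact (Scheme.appTop_comp_toSpecΓ_comp_map T.incl (CommRingCat.ofHom w)).trans h

theorem isPullback_incl (hw : ∀ a, T.red ⊤ (w a) =
      ((Scheme.ΓSpecIso (.of k)).inv ≫ X.hom.appTop).hom (residue p k a)) :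
    IsPullback T.incl X.hom (T.toSpecW2 w)
    (Spec.map (CommRingCat.ofHom (residue p k))) := by
  have hcl : IsClosedImmersion (Spec.map (CommRingCat.ofHom (residue p k))) :=
    IsClosedImmersion.spec_of_surjective _ (W2.residue_surjective p)
  refine ⟨⟨T.incl_comp_toSpecW2 w hw⟩, ⟨PullbackCone.IsLimit.mk _
    (fun s => IsClosedImmersion.lift T.incl s.fst
      (T.ker_incl_le s.fst (natCast_top_eq_zero p (Over.mk s.snd))))
    (fun s => IsClosedImmersion.lift_fac _ _ _) (fun s => ?_) (fun s m h1 h2 => ?_)⟩⟩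
  · rw [← cancel_mono (Spec.map (CommRingCat.ofHom (residue p k))), Category.assoc,
      ← T.incl_comp_toSpecW2 w hw, IsClosedImmersion.lift_fac_assoc, s.condition]
  · rw [← cancel_mono T.incl, h1, IsClosedImmersion.lift_fac]

/-- The lifting defined by a thickening. -/
def toLifting (hw : ∀ a, T.red ⊤ (w a) =
      ((Scheme.ΓSpecIso (.of k)).inv ≫ X.hom.appTop).hom (residue p k a)) :
    Lifting p X where
  total := Over.mk (T.toSpecW2 w)
  flat := T.flat_toSpecW2 w
  incl := T.incl
  isPullback := T.isPullback_incl w hw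

end Structure

end Thickening

end

section

/-! ### The thickening of a good quotient -/

namespace DescentDatum

open TopologicalSpace Opposite

variable {p : ℕ} [Fact p.Prime] {k : Type u} [Field k] [CharP k p] [PerfectField k]
  {Y X : Over (Spec (.of k))} {π : Y ⟶ X} {Yt : Lifting p Y} (D : DescentDatum π Yt)

/-- The restriction of sections of the lifting over preimages of open subsets of the quotient. -/
abbrev _root_.FrobLift.Lifting.resπ (π : Y ⟶ X) (Yt : Lifting p Y) {U V : X.left.Opens} (h : V ≤ U) :
    Γ(Yt.total.left, Yt.tilde (π.left ⁻¹ᵁ U)) →+* Γ(Yt.total.left, Yt.tilde (π.left ⁻¹ᵁ V)) :=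
  res (Yt.tilde_mono (π.left.preimage_mono h))

theorem app_res {U V : X.left.Opens} (π : Y ⟶ X) (h : V ≤ U) (b : Γ(X.left, U)) :
    π.left.app V (res h b) = res (π.left.preimage_mono h) (π.left.app U b) :=
  congrArg (fun f => CommRingCat.Hom.hom f b) (π.left.naturality (homOfLE h).op)

/-- The sections over an open subset of the quotient. -/
def sections (U : X.left.Opens) :
    Subring (Γ(Yt.total.left, Yt.tilde (π.left ⁻¹ᵁ U)) × Γ(X.left, U)) where
  carrier := {a | π.left.app U a.2 = Yt.redHom _ a.1 ∧
    ∀ (W : X.left.affineOpens) (h : W.1 ≤ U), Yt.resπ π h a.1 ∈ D.ring W}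
  mul_mem' {a b} ha hb := ⟨by rw [Prod.fst_mul, Prod.snd_mul, map_mul, map_mul, ha.1, hb.1],
    fun W h => by rw [Prod.fst_mul, map_mul]; exact mul_mem (ha.2 W h) (hb.2 W h)⟩
  one_mem' := ⟨by rw [Prod.fst_one, Prod.snd_one, map_one, map_one],
    fun W h => by rw [Prod.fst_one, map_one]; exact one_mem _⟩
  add_mem' {a b} ha hb := ⟨by rw [Prod.fst_add, Prod.snd_add, map_add, map_add, ha.1, hb.1],
    fun W h => by rw [Prod.fst_add, map_add]; exact add_mem (ha.2 W h) (hb.2 W h)⟩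
  zero_mem' := ⟨by rw [Prod.fst_zero, Prod.snd_zero, map_zero, map_zero],
    fun W h => by rw [Prod.fst_zero, map_zero]; exact zero_mem _⟩
  neg_mem' {a} ha := ⟨by rw [Prod.fst_neg, Prod.snd_neg, map_neg, map_neg, ha.1],
    fun W h => by rw [Prod.fst_neg, map_neg]; exact neg_mem (ha.2 W h)⟩

theorem res_mem_sections {U V : X.left.Opens} (h : V ≤ U) {a} (ha : a ∈ D.sections U) :
    (Yt.resπ π h a.1, res h a.2) ∈ D.sections V :=
  ⟨by rw [app_res, ha.1, Yt.redHom_res], fun W hW => by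
    rw [res_res]
    exact ha.2 W (hW.trans h)⟩

theorem _root_.AlgebraicGeometry.Scheme.exists_affineOpens_le {X : Scheme.{u}} {U : X.Opens} {x : X}
    (hx : x ∈ U) : ∃ W : X.affineOpens, x ∈ W.1 ∧ W.1 ≤ U := by
  obtain ⟨W, hW, hxW, hle⟩ := exists_isAffineOpen_mem_and_subset hx
  exact ⟨⟨W, hW⟩, hxW, hle⟩

theorem mem_sections_of_locally {U : X.left.Opens}
    {a : Γ(Yt.total.left, Yt.tilde (π.left ⁻¹ᵁ U)) × Γ(X.left, U)}
    (h : ∀ x ∈ U, ∃ (V : X.left.Opens) (hV : V ≤ U), x ∈ V ∧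
      (Yt.resπ π hV a.1, res hV a.2) ∈ D.sections V) : a ∈ D.sections U := by
  have h1 : π.left.app U a.2 = Yt.redHom _ a.1 := by
    refine eq_of_locally_res_eq fun y hy => ?_
    obtain ⟨V, hV, hyV, hm⟩ := h (π.left y) hy
    refine ⟨_, π.left.preimage_mono hV, hyV, ?_⟩
    rw [← app_res, ← Yt.redHom_res]
    exact hm.1
  refine ⟨h1, fun W hW => ?_⟩
  refine D.mem_of_locally _ (res hW a.2) ?_ fun x hx => ?_
  · rw [app_res, Yt.redHom_res, h1]
  · obtain ⟨V, hV, hxV, hm⟩ := h x (hW hx)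
    obtain ⟨W', hxW', hle⟩ := Scheme.exists_affineOpens_le (show x ∈ W.1 ⊓ V from ⟨hx, hxV⟩)
    refine ⟨W', hle.trans inf_le_left, hxW', ?_⟩
    have h4 := hm.2 W' (hle.trans inf_le_right)
    rw [res_res] at h4 ⊢
    exact h4

/-- The restriction of sections. -/
def resSections {U V : X.left.Opens} (h : V ≤ U) : D.sections U →+* D.sections V :=
  ((Yt.resπ π h).prodMap (res h)).restrict _ _ fun _ ha => D.res_mem_sections h ha

/-- The presheaf of sections. -/
def presheaf : TopCat.Presheaf CommRingCat.{u} (TopCat.of X.left) where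
  obj U := .of (D.sections U.unop)
  map i := CommRingCat.ofHom (D.resSections i.unop.le)
  map_id U := by
    refine CommRingCat.hom_ext (RingHom.ext fun a : D.sections U.unop => ?_)
    exact Subtype.ext (Prod.ext (res_self le_rfl a.1.1) (res_self le_rfl a.1.2))
  map_comp {U _ _} i j := by
    refine CommRingCat.hom_ext (RingHom.ext fun a : D.sections U.unop => ?_)
    exact Subtype.ext (Prod.ext (res_res _ _ a.1.1).symm (res_res _ _ a.1.2).symm)

theorem isSheaf_presheaf : D.presheaf.IsSheaf := by
  rw [TopCat.Presheaf.isSheaf_iff_isSheafUniqueGluing]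
  intro ι U sf hsf
  have hsf1 : ∀ i j, Yt.resπ π (inf_le_left : U i ⊓ U j ≤ U i) (sf i).1.1 =
      Yt.resπ π (inf_le_right : U i ⊓ U j ≤ U j) (sf j).1.1 :=
    fun i j => congrArg (fun a : D.sections (U i ⊓ U j) => a.1.1) (hsf i j)
  have hsf2 : ∀ i j, res (X := X.left) (inf_le_left : U i ⊓ U j ≤ U i) (sf i).1.2 =
      res (X := X.left) (inf_le_right : U i ⊓ U j ≤ U j) (sf j).1.2 :=
    fun i j => congrArg (fun a : D.sections (U i ⊓ U j) => a.1.2) (hsf i j)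
  have hle : ∀ i, U i ≤ iSup U := le_iSup U
  obtain ⟨s, hs, -⟩ := Yt.total.left.sheaf.existsUnique_gluing'
    (fun i => Yt.tilde (π.left ⁻¹ᵁ U i)) (Yt.tilde (π.left ⁻¹ᵁ iSup U))
    (fun i => homOfLE (Yt.tilde_mono (π.left.preimage_mono (hle i))))
    (fun y hy => by
      obtain ⟨i, hi⟩ := Opens.mem_iSup.1 (show π.left (Yt.retract y) ∈ iSup U from hy)
      exact Opens.mem_iSup.2 ⟨i, hi⟩)
    (fun i => (sf i).1.1) hsf1
  obtain ⟨b, hb, -⟩ := X.left.sheaf.existsUnique_gluing' U (iSup U) (fun i => homOfLE (hle i))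
    le_rfl (fun i => (sf i).1.2) hsf2
  have hs' : ∀ i, Yt.resπ π (hle i) s = (sf i).1.1 := hs
  have hb' : ∀ i, res (X := X.left) (hle i) b = (sf i).1.2 := hb
  have hmem : (s, b) ∈ D.sections (iSup U) := by
    refine D.mem_sections_of_locally (U := iSup U) (a := (s, b)) fun x hx => ?_
    obtain ⟨i, hi⟩ := Opens.mem_iSup.1 hx
    refine ⟨U i, hle i, hi, ?_⟩
    have h2 : (Yt.resπ π (hle i) s, res (X := X.left) (hle i) b) = (sf i).1 :=
      Prod.ext (hs' i) (hb' i)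
    exact h2 ▸ (sf i).2
  refine ⟨⟨(s, b), hmem⟩, fun i => Subtype.ext (Prod.ext (hs' i) (hb' i)), fun a ha => ?_⟩
  have ha1 : ∀ i, Yt.resπ π (hle i) a.1.1 = (sf i).1.1 := fun i =>
    congrArg (fun a : D.sections (U i) => a.1.1) (ha i)
  have ha2 : ∀ i, res (X := X.left) (hle i) a.1.2 = (sf i).1.2 := fun i =>
    congrArg (fun a : D.sections (U i) => a.1.2) (ha i)
  refine Subtype.ext (Prod.ext ?_ ?_)
  · refine eq_of_locally_res_eq fun y hy => ?_
    obtain ⟨i, hi⟩ := Opens.mem_iSup.1 (show π.left (Yt.retract y) ∈ iSup U from hy)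
    exact ⟨_, Yt.tilde_mono (π.left.preimage_mono (hle i)), hi, (ha1 i).trans (hs' i).symm⟩
  · refine eq_of_locally_res_eq (X := X.left) fun y hy => ?_
    obtain ⟨i, hi⟩ := Opens.mem_iSup.1 hy
    exact ⟨_, hle i, hi, (ha2 i).trans (hb' i).symm⟩

/-- The thickening of the quotient. -/
def thickening (hπ : ∀ U, Function.Injective (π.left.app U)) : Thickening p X.left where
  presheaf := D.presheaf
  isSheaf := D.isSheaf_presheaf
  q := { app U := CommRingCat.ofHom ((RingHom.snd _ _).comp (D.sections U.unop).subtype) }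
  surj {U} hU b := by
    obtain ⟨s, hs, hsb⟩ := D.exists_redHom_eq (W := ⟨U, hU⟩) b
    exact ⟨⟨(s, b), hsb.symm, fun W h => D.res_mem (W := ⟨U, hU⟩) h hs⟩, rfl⟩
  q_eq_zero {U} hU a ha := by
    have ha0 : a.1.2 = 0 := ha
    have h1 := a.2.2 ⟨U, hU⟩ le_rfl
    rw [res_self] at h1
    obtain ⟨t, ht, hst⟩ := D.exists_eq_p_mul _ h1 (by rw [← a.2.1, ha0, map_zero])
    obtain ⟨b, hb⟩ := D.exists_app_eq t ht
    refine ⟨⟨(t, b), hb, fun W h => D.res_mem (W := ⟨U, hU⟩) h ht⟩, Subtype.ext (Prod.ext hst ?_)⟩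
    change a.1.2 = (p : Γ(X.left, U)) * b
    rw [ha0, natCast_section_eq_zero (natCast_top_eq_zero p X), zero_mul]
  p_mul_p U := Subtype.ext (Prod.ext (Yt.p_mul_p _) (by
    change (p : Γ(X.left, U)) * p = 0
    rw [natCast_section_eq_zero (natCast_top_eq_zero p X), zero_mul]))
  p_eq_zero := natCast_top_eq_zero p X
  tors {U} a ha := by
    refine hπ U ?_
    have h1 : (p : Γ(Yt.total.left, Yt.tilde (π.left ⁻¹ᵁ U))) * a.1.1 = 0 :=
      congrArg (fun a : D.sections U => a.1.1) ha
    exact a.2.1.trans ((Yt.redHom_eq_zero_iff.2 (Yt.incl_app_eq_zero h1)).trans (map_zero _).symm)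

end DescentDatum

end

section

/-! ### The lifted quotient morphism -/

theorem _root_.AlgebraicGeometry.Scheme.hom_ext_of_app {X Y : Scheme.{u}} {f g : X ⟶ Y}
    (h : ∀ x, f x = g x)
    (h' : ∀ (U : Y.Opens) (s : Γ(Y, U)), g.app U s =
      res (fun x hx => (congrArg (· ∈ U) (h x)).mpr hx : g ⁻¹ᵁ U ≤ f ⁻¹ᵁ U) (f.app U s)) : f = g := by
  refine Scheme.Hom.ext (TopCat.hom_ext (ContinuousMap.ext h)) fun U => ?_
  ext s
  exact (h' U s).symm

/-- The structure homomorphism of the sections of a lifting. -/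
def Lifting.structureHom {p : ℕ} [Fact p.Prime] {k : Type u} [Field k] {Y : Over (Spec (.of k))}
    (Yt : Lifting p Y) (V : Yt.total.left.Opens) : W2 p k →+* Γ(Yt.total.left, V) :=
  ((Scheme.ΓSpecIso (.of (W2 p k))).inv ≫ Yt.total.hom.appLE ⊤ V le_top).hom

/-- The structure homomorphism of the sections of a scheme over a field. -/
def baseHom {k : Type u} [Field k] (Y : Over (Spec (.of k))) (V : Y.left.Opens) :
    k →+* Γ(Y.left, V) :=
  ((Scheme.ΓSpecIso (.of k)).inv ≫ Y.hom.appLE ⊤ V le_top).hom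

theorem Lifting.res_structureHom {p : ℕ} [Fact p.Prime] {k : Type u} [Field k]
    {Y : Over (Spec (.of k))} (Yt : Lifting p Y) {U V : Yt.total.left.Opens} (h : V ≤ U) (a) :
    res h (Yt.structureHom U a) = Yt.structureHom V a :=
  (appLE_res Yt.total.hom le_top le_top le_top h _).symm.trans
    (congrArg _ (res_self _ _))

theorem app_baseHom {k : Type u} [Field k] {Y X : Over (Spec (.of k))} (π : Y ⟶ X)
    (U : X.left.Opens) (a) : π.left.app U (baseHom X U a) = baseHom Y (π.left ⁻¹ᵁ U) a := by
  have h : ∀ f : Y.left ⟶ Spec (.of k), π.left ≫ X.hom = f → X.hom.appLE ⊤ U le_top ≫ π.left.app U =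
      f.appLE ⊤ (π.left ⁻¹ᵁ U) le_top := by
    rintro _ rfl
    exact (congrArg (X.hom.appLE ⊤ U le_top ≫ ·) (Scheme.Hom.appLE_eq_app π.left).symm).trans
      (Scheme.Hom.appLE_comp_appLE π.left X.hom ⊤ U (π.left ⁻¹ᵁ U) le_top le_rfl)
  exact congrArg (fun f => CommRingCat.Hom.hom ((Scheme.ΓSpecIso (.of k)).inv ≫ f) a) (h _ (Over.w π))

section

variable {p : ℕ} [Fact p.Prime] {k : Type u} [Field k] [CharP k p] [PerfectField k]
  {Y X : Over (Spec (.of k))}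

theorem Lifting.redHom_structureHom (Yt : Lifting p Y) (V : Y.left.Opens) (a) :
    Yt.redHom V (Yt.structureHom _ a) = baseHom Y V (residue p k a) := by
  have h1 := Scheme.Hom.appLE_comp_appLE Yt.incl Yt.total.hom ⊤ (Yt.tilde V) V
    le_top (Yt.preimage_tilde V).ge
  have h2 := Scheme.Hom.appLE_comp_appLE Y.hom (Spec.map (CommRingCat.ofHom (residue p k))) ⊤ ⊤ V
    le_top le_top
  have h3 : ∀ (f g : Y.left ⟶ Spec (.of (W2 p k))) (_ : f = g) (e e'),
      f.appLE ⊤ V e = g.appLE ⊤ V e' := by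
    rintro f _ rfl e e'
    rfl
  have h4 := h1.trans ((h3 _ _ Yt.isPullback.w _ _).trans h2.symm)
  have h5 : (Scheme.ΓSpecIso (.of (W2 p k))).inv ≫
      (Spec.map (CommRingCat.ofHom (residue p k))).appLE ⊤ ⊤ le_top =
      CommRingCat.ofHom (residue p k) ≫ (Scheme.ΓSpecIso (.of k)).inv := by
    refine Eq.trans ?_ (Scheme.ΓSpecIso_inv_naturality _).symm
    exact congrArg ((Scheme.ΓSpecIso (.of (W2 p k))).inv ≫ ·)
      (Scheme.Hom.appLE_eq_app (Spec.map (CommRingCat.ofHom (residue p k))))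
  refine (congrArg (fun f => CommRingCat.Hom.hom ((Scheme.ΓSpecIso (.of (W2 p k))).inv ≫ f) a) h4).trans ?_
  exact congrArg (fun f => CommRingCat.Hom.hom (f ≫ Y.hom.appLE ⊤ V le_top) a) h5

end

namespace DescentDatum

open TopologicalSpace Opposite

variable {p : ℕ} [Fact p.Prime] {k : Type u} [Field k] [CharP k p] [PerfectField k]
  {Y X : Over (Spec (.of k))} {π : Y ⟶ X} {Yt : Lifting p Y} (D : DescentDatum π Yt)

/-- Writing a Witt vector as `b ^ p + p * c` avoids any compatibility between the lifted Frobenius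
and `W2 p k`; the reductions of `b` and `c` are constants and come from `X`. -/
theorem structureHom_mem_ring (W : X.left.affineOpens) (a) : Yt.structureHom _ a ∈ D.ring W := by
  obtain ⟨b, c, rfl⟩ := W2.exists_eq_pow_add p a
  rw [map_add, map_pow, map_mul, map_natCast]
  exact D.pow_add_p_mul_mem _ _
    ⟨baseHom X W (residue p k b), (app_baseHom π W _).trans (Yt.redHom_structureHom _ _).symm⟩
    ⟨baseHom X W (residue p k c), (app_baseHom π W _).trans (Yt.redHom_structureHom _ _).symm⟩

/-- The structure homomorphism of the sections over an open subset of the quotient. -/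
def structureHom (U : X.left.Opens) : W2 p k →+* D.sections U :=
  ((Yt.structureHom _).prod ((baseHom X U).comp (residue p k))).codRestrict _ fun a =>
    ⟨(app_baseHom π U _).trans (Yt.redHom_structureHom _ _).symm, fun W h => by
      rw [RingHom.prod_apply]
      rw [Yt.res_structureHom]
      exact D.structureHom_mem_ring W a⟩

variable (hπ : ∀ U, Function.Injective (π.left.app U))

/-- The lifting of the quotient. -/
def lifting : Lifting p X :=
  (D.thickening hπ).toLifting (D.structureHom ⊤) fun a => by
    exact congrArg (fun f => CommRingCat.Hom.hom ((Scheme.ΓSpecIso (.of k)).inv ≫ f)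
      (residue p k a)) (Scheme.Hom.appLE_eq_app X.hom)

theorem isUnit_germ_redHom (Yt : Lifting p Y) {V : Y.left.Opens} {y : Yt.total.left}
    (hy : y ∈ Yt.tilde V) (s : Γ(Yt.total.left, Yt.tilde V))
    (h : IsUnit (Yt.total.left.presheaf.germ _ _ hy s)) :
    IsUnit (Y.left.presheaf.germ V (Yt.retract y) hy (Yt.redHom V s)) := by
  obtain ⟨W, hWV, -, hyW, h1⟩ := Scheme.exists_isUnit_res h
  have hy' : Yt.retract y ∈ Yt.incl ⁻¹ᵁ W := (congrArg (· ∈ W) (Yt.incl_retract y)).mpr hyW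
  have hle : Yt.incl ⁻¹ᵁ W ≤ V := (Yt.incl.preimage_mono hWV).trans (Yt.preimage_tilde V).le
  have h2 := appLE_res Yt.incl (Yt.preimage_tilde V).ge le_rfl hWV hle s
  have h3 := h1.map (Yt.incl.appLE W (Yt.incl ⁻¹ᵁ W) le_rfl).hom
  have h4 := ((congrArg IsUnit h2).mp h3).map (Y.left.presheaf.germ _ _ hy').hom
  exact (congrArg IsUnit (TopCat.Presheaf.germ_res_apply Y.left.presheaf (homOfLE hle) _ hy'
    (Yt.redHom V s))).mp h4

/-- The morphism of presheafed spaces from the lifting to the thickening of the quotient. -/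
def toPresheafedSpaceHom :
    Yt.total.left.toPresheafedSpace ⟶ (D.thickening hπ).toLRS.toPresheafedSpace where
  base := Yt.retract ≫ π.left.base
  c := { app U := CommRingCat.ofHom ((RingHom.fst _ _).comp (D.sections U.unop).subtype) }

/-- The morphism of locally ringed spaces from the lifting to the thickening of the quotient. -/
def toLRSHom : Yt.total.left.toLocallyRingedSpace ⟶ (D.thickening hπ).toLRS where
  __ := D.toPresheafedSpaceHom hπ
  prop y := by
    refine ⟨fun a ha => ?_⟩
    obtain ⟨U, hxU, s, rfl⟩ := TopCat.Presheaf.exists_germ_eq D.presheaf a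
    have h := PresheafedSpace.stalkMap_germ_apply (D.toPresheafedSpaceHom hπ) U y hxU s
    have h1 := (congrArg IsUnit h).mp ha
    -- Units are detected after reduction, where the map on stalks is that of `π`, a local
    -- homomorphism.
    refine isUnit_of_map_unit ((D.thickening hπ).stalkRed (π.left (Yt.retract y))) _
      ((congrArg IsUnit ((D.thickening hπ).stalkRed_germ hxU s)).mpr ?_)
    have h2 := isUnit_germ_redHom Yt (V := π.left ⁻¹ᵁ U) (y := y) hxU s.1.1 h1
    have h3 := Scheme.Hom.germ_stalkMap_apply π.left U (Yt.retract y) hxU s.1.2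
    have h4 := (congrArg IsUnit (h3.trans (congrArg _ s.2.1))).mpr h2
    exact isUnit_of_map_unit (π.left.stalkMap (Yt.retract y)).hom _ h4

/-- The morphism from the lifting to the thickening of the quotient. -/
def toSchemeHom : Yt.total.left ⟶ (D.thickening hπ).toScheme := ⟨D.toLRSHom hπ⟩

theorem incl_comp_toSchemeHom :
    Yt.incl ≫ D.toSchemeHom hπ = π.left ≫ (D.thickening hπ).incl := by
  refine Scheme.hom_ext_of_app (fun y => ?_) fun U s => ?_
  · exact congrArg π.left (Yt.retract_incl y)
  · exact s.2.1

theorem toSchemeHom_comp_hom : D.toSchemeHom hπ ≫ (D.lifting hπ).total.hom = Yt.total.hom := by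
  refine Scheme.hom_ext_ΓSpecIso_inv ?_
  refine (Scheme.appTop_comp_toSpecΓ_comp_map (D.toSchemeHom hπ)
    (CommRingCat.ofHom (D.structureHom ⊤))).trans ?_
  exact congrArg ((Scheme.ΓSpecIso (.of (W2 p k))).inv ≫ ·) (Scheme.Hom.appLE_eq_app Yt.total.hom)

end DescentDatum

end

section

/-! ### The lifted Frobenius of the quotient -/

namespace DescentDatum

open TopologicalSpace Opposite

variable {p : ℕ} [Fact p.Prime] {k : Type u} [Field k] [CharP k p] [PerfectField k]
  {Y X : Over (Spec (.of k))} {π : Y ⟶ X} {Yt : Lifting p Y} (D : DescentDatum π Yt)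

/-- The section over an affine open defined by a section over a larger open subset. -/
def restrictAffine {U : X.left.Opens} {W : X.left.affineOpens} (h : W.1 ≤ U) :
    D.sections U →+* D.ring W :=
  ((Yt.resπ π h).comp ((RingHom.fst _ _).comp (D.sections U).subtype)).codRestrict _ fun a =>
    a.2.2 W h

theorem res_frob_restrictAffine {U : X.left.Opens} (a : D.sections U) {W W' : X.left.affineOpens}
    (h : W.1 ≤ U) (h' : W'.1 ≤ W.1) :
    Yt.resπ π h' (D.frob W (D.restrictAffine h a)).1 =
      (D.frob W' (D.restrictAffine (h'.trans h) a)).1 :=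
  (D.frob_res h' _ _ (res_res _ _ _).symm).symm

theorem eq_of_resπ_eq {U : X.left.Opens} {s t : Γ(Yt.total.left, Yt.tilde (π.left ⁻¹ᵁ U))}
    (h : ∀ (W : X.left.affineOpens) (hW : W.1 ≤ U), Yt.resπ π hW s = Yt.resπ π hW t) : s = t := by
  refine eq_of_locally_res_eq fun y hy => ?_
  obtain ⟨W, hyW, hW⟩ := Scheme.exists_affineOpens_le
    (show π.left (Yt.retract y) ∈ U from hy)
  exact ⟨_, Yt.tilde_mono (π.left.preimage_mono hW), hyW, h W hW⟩

/-- The descended Frobenius is given over affine opens; by `frob_res` its values agree on smaller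
affine opens and glue in the structure sheaf of the lifting of `Y`. -/
theorem exists_frob {U : X.left.Opens} (a : D.sections U) : ∃ c : D.sections U, c.1.2 = a.1.2 ^ p ∧
    ∀ (W : X.left.affineOpens) (h : W.1 ≤ U),
      Yt.resπ π h c.1.1 = (D.frob W (D.restrictAffine h a)).1 := by
  obtain ⟨s, hs, -⟩ := Yt.total.left.sheaf.existsUnique_gluing'
    (fun W : {W : X.left.affineOpens // W.1 ≤ U} => Yt.tilde (π.left ⁻¹ᵁ W.1.1))
    (Yt.tilde (π.left ⁻¹ᵁ U))
    (fun W => homOfLE (Yt.tilde_mono (π.left.preimage_mono W.2)))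
    (fun y hy => by
      obtain ⟨W, hyW, hW⟩ := Scheme.exists_affineOpens_le
        (show π.left (Yt.retract y) ∈ U from hy)
      exact Opens.mem_iSup.2 ⟨⟨W, hW⟩, hyW⟩)
    (fun W => (D.frob W.1 (D.restrictAffine W.2 a)).1)
    (fun W W' => by
      refine eq_of_locally_res_eq (X := Yt.total.left) fun y hy => ?_
      obtain ⟨W'', hyW, hW⟩ := Scheme.exists_affineOpens_le
        (show π.left (Yt.retract y) ∈ W.1.1 ⊓ W'.1.1 from hy)
      refine ⟨Yt.tilde (π.left ⁻¹ᵁ W''), Yt.tilde_mono (π.left.preimage_mono hW), hyW, ?_⟩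
      refine (res_res _ _ _).trans (Eq.trans ?_ (res_res _ _ _).symm)
      exact (D.res_frob_restrictAffine a W.2 (hW.trans inf_le_left)).trans
        (D.res_frob_restrictAffine a W'.2 (hW.trans inf_le_right)).symm)
  have hs' : ∀ (W : X.left.affineOpens) (h : W.1 ≤ U),
      Yt.resπ π h s = (D.frob W (D.restrictAffine h a)).1 := fun W h => hs ⟨W, h⟩
  refine ⟨⟨(s, a.1.2 ^ p), ?_, fun W h => ?_⟩, rfl, hs'⟩
  · refine eq_of_locally_res_eq fun y hy => ?_
    obtain ⟨W, hyW, hW⟩ := Scheme.exists_affineOpens_le (show π.left y ∈ U from hy)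
    refine ⟨_, π.left.preimage_mono hW, hyW, ?_⟩
    refine Eq.trans ?_ (Yt.redHom_res _ _)
    refine Eq.trans ?_ (congrArg _ (hs' W hW)).symm
    rw [D.redHom_frob, map_pow, map_pow, a.2.1]
    exact congrArg (· ^ p) (Yt.redHom_res _ _).symm
  · exact (congrArg (· ∈ D.ring W) (hs' W h)).mpr (D.frob W _).2

theorem sections_ext {U : X.left.Opens} {a b : D.sections U} (h : a.1.2 = b.1.2)
    (h' : ∀ (W : X.left.affineOpens) (hW : W.1 ≤ U), Yt.resπ π hW a.1.1 = Yt.resπ π hW b.1.1) :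
    a = b :=
  Subtype.ext (Prod.ext (eq_of_resπ_eq h') h)

/-- The lifted Frobenius on the sections over an open subset of the quotient. -/
def frobSections (U : X.left.Opens) : D.sections U →+* D.sections U where
  toFun a := (D.exists_frob a).choose
  map_one' := D.sections_ext ((D.exists_frob _).choose_spec.1.trans (one_pow p)) fun W hW => by
    rw [(D.exists_frob _).choose_spec.2 W hW, map_one, map_one]
    exact (map_one (Yt.resπ π hW)).symm
  map_zero' := D.sections_ext ((D.exists_frob _).choose_spec.1.trans
      (zero_pow (Fact.out : p.Prime).ne_zero)) fun W hW => by
    rw [(D.exists_frob _).choose_spec.2 W hW, map_zero, map_zero]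
    exact (map_zero (Yt.resπ π hW)).symm
  map_mul' a b := D.sections_ext ((D.exists_frob _).choose_spec.1.trans ((mul_pow _ _ p).trans
      (congrArg₂ (· * ·) (D.exists_frob a).choose_spec.1 (D.exists_frob b).choose_spec.1).symm))
      fun W hW => by
    rw [(D.exists_frob _).choose_spec.2 W hW, map_mul, map_mul]
    exact (congrArg₂ (· * ·) ((D.exists_frob a).choose_spec.2 W hW)
      ((D.exists_frob b).choose_spec.2 W hW)).symm.trans (map_mul (Yt.resπ π hW) _ _).symm
  map_add' a b := D.sections_ext ((D.exists_frob _).choose_spec.1.trans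
      ((add_pow_of_natCast_eq_zero (natCast_section_eq_zero (natCast_top_eq_zero p X) U) _ _).trans
      (congrArg₂ (· + ·) (D.exists_frob a).choose_spec.1 (D.exists_frob b).choose_spec.1).symm))
      fun W hW => by
    rw [(D.exists_frob _).choose_spec.2 W hW, map_add, map_add]
    exact (congrArg₂ (· + ·) ((D.exists_frob a).choose_spec.2 W hW)
      ((D.exists_frob b).choose_spec.2 W hW)).symm.trans (map_add (Yt.resπ π hW) _ _).symm

theorem frobSections_snd {U : X.left.Opens} (a : D.sections U) :
    (D.frobSections U a).1.2 = a.1.2 ^ p :=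
  (D.exists_frob a).choose_spec.1

theorem resπ_frobSections {U : X.left.Opens} (a : D.sections U) (W : X.left.affineOpens)
    (h : W.1 ≤ U) : Yt.resπ π h (D.frobSections U a).1.1 = (D.frob W (D.restrictAffine h a)).1 :=
  (D.exists_frob a).choose_spec.2 W h

theorem frobSections_res {U V : X.left.Opens} (h : V ≤ U) (a : D.sections U) :
    D.frobSections V (D.resSections h a) = D.resSections h (D.frobSections U a) := by
  refine Subtype.ext (Prod.ext (eq_of_resπ_eq fun W hW => ?_) ?_)
  · refine (D.resπ_frobSections _ W hW).trans (Eq.trans ?_ (res_res _ _ _).symm)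
    refine Eq.trans ?_ (D.resπ_frobSections a W (hW.trans h)).symm
    exact congrArg (fun c => (D.frob W c).1) (Subtype.ext (res_res _ _ _))
  · refine (D.frobSections_snd _).trans (Eq.trans ?_ (congrArg (res h) (D.frobSections_snd a)).symm)
    exact (map_pow (res h) _ _).symm

variable (hπ : ∀ U, Function.Injective (π.left.app U))

/-- The lifted Frobenius, as a morphism of presheafed spaces. -/
def frobPresheafedSpaceHom :
    (D.thickening hπ).toLRS.toPresheafedSpace ⟶ (D.thickening hπ).toLRS.toPresheafedSpace where
  base := 𝟙 _
  c :=
    { app U := CommRingCat.ofHom (D.frobSections U.unop)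
      naturality U _ i := CommRingCat.hom_ext (RingHom.ext fun a : D.sections U.unop =>
        D.frobSections_res i.unop.le a) }

/-- The lifted Frobenius, as a morphism of locally ringed spaces. -/
def frobLRSHom : (D.thickening hπ).toLRS ⟶ (D.thickening hπ).toLRS where
  __ := D.frobPresheafedSpaceHom hπ
  prop x := by
    refine ⟨fun a ha => ?_⟩
    have := (D.thickening hπ).isLocalHom_stalkRed x
    obtain ⟨U, hxU, s, rfl⟩ := TopCat.Presheaf.exists_germ_eq D.presheaf a
    have h := PresheafedSpace.stalkMap_germ_apply (D.frobPresheafedSpaceHom hπ) U x hxU s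
    have h1 := ((congrArg IsUnit h).mp ha).map ((D.thickening hπ).stalkRed x)
    refine isUnit_of_map_unit ((D.thickening hπ).stalkRed x) _
      ((congrArg IsUnit ((D.thickening hπ).stalkRed_germ hxU s)).mpr ?_)
    have h2 := (D.thickening hπ).stalkRed_germ hxU (D.frobSections U s)
    have h3 : X.left.presheaf.germ U x hxU (D.frobSections U s).1.2 =
        X.left.presheaf.germ U x hxU s.1.2 ^ p :=
      (congrArg _ (D.frobSections_snd s)).trans (map_pow (X.left.presheaf.germ U x hxU).hom _ _)
    exact (isUnit_pow_iff (Fact.out : p.Prime).ne_zero).1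
      ((congrArg IsUnit (h2.trans h3)).mp h1)

/-- The lifted Frobenius of the quotient. -/
def frobHom : (D.lifting hπ).total.left ⟶ (D.lifting hπ).total.left := ⟨D.frobLRSHom hπ⟩

theorem liftsFrobenius_frobHom : (D.lifting hπ).LiftsFrobenius (D.frobHom hπ) :=
  Scheme.hom_ext_of_app (fun _ => rfl) fun _ s =>
    ((res_self (X := X.left) le_rfl _).trans (D.frobSections_snd s)).symm

theorem exists_lifting (D : DescentDatum π Yt) (hπ : ∀ U, Function.Injective (π.left.app U)) :
    ∃ (Xt : Lifting p X) (πt : Yt.total ⟶ Xt.total) (FXt : Xt.total.left ⟶ Xt.total.left),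
      Yt.LiftsHom Xt π πt ∧ Xt.LiftsFrobenius FXt :=
  ⟨D.lifting hπ, Over.homMk (D.toSchemeHom hπ) (D.toSchemeHom_comp_hom hπ), D.frobHom hπ,
    D.incl_comp_toSchemeHom hπ, D.liftsFrobenius_frobHom hπ⟩

end DescentDatum

end

end FrobLift

theorem mainTheorem6 (p : ℕ) [Fact p.Prime] (k : Type u) [Field k] [CharP k p] [PerfectField k]
    -- `G = Spec H` is a smooth, linearly reductive affine algebraic group over `k`
    (H : Type u) [CommRing H] [HopfAlgebra k H] [Algebra.Smooth k H]
    (hG : FrobLift.IsLinearlyReductive k H)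
    (Y X : Over (Spec (.of k))) (hYfin : FrobLift.IsEssFiniteType Y)
    (hXfin : FrobLift.IsEssFiniteType X) (hYnor : FrobLift.IsNormal Y.left)
    [ModObj (FrobLift.groupOf k H) Y] (π : Y ⟶ X)
    (hπ : FrobLift.IsGoodQuotient (FrobLift.groupOf k H) π)
    -- a given Frobenius lifting of `Y`
    (Yt : FrobLift.Lifting p Y) (FYt : Yt.total.left ⟶ Yt.total.left)
    (hFYt : Yt.LiftsFrobenius FYt) :
    ∃ (Xt : FrobLift.Lifting p X) (πt : Yt.total ⟶ Xt.total)
      (FXt : Xt.total.left ⟶ Xt.total.left),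
      Yt.LiftsHom Xt π πt ∧ Xt.LiftsFrobenius FXt := by
  obtain ⟨D⟩ := hπ.exists_descentDatum hG hYfin hYnor hFYt
  exact D.exists_lifting hπ.injective

end
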